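/- Let $\mathfrak g$ be a finite-dimensional complex simple Lie algebra with a Cartan subalgebra $\mathfrak h$, a choice of positive roots $\Delta_+$, highest root $\theta$, and dual Coxeter number $h^\vee$, and let $(x|y)=\frac{1}{2h^\vee}\kappa(x,y)$, where $\kappa$ is the Killing form. Let $\widehat{\mathfrak g}=\mathfrak g[t,t^{-1}]\oplus\mathbb C K$ be the affine Lie algebra, with $K$ central and $[xt^m,yt^n]=[x,y]t^{m+n}+m(x|y)\delta_{m+n,0}K$. For $k\in\mathbb C$ let $V^k(\mathfrak g)=U(\widehat{\mathfrak g})\otimes_{U(\mathfrak g[t]\oplus\mathbb CK)}\mathbb C_k$ be the universal affine vertex algebra of level $k$, where $\mathfrak g[t]$ acts on $\mathbb C_k$ by zero and $K$ by $k$; write $x(n)$ for the action of $xt^n$, and $a\mapsto \sum_{n\in\mathbb Z} a_{(n)}z^{-n-1}$ for the state-field correspondence, so that $(x(-1)\mathbf 1)_{(n)}=x(n)$. A vector $v\in V^k(\mathfrak g)$ is called singular if $e_\alpha(0)v=0$ for all $\alpha\in\Delta_+$ and $f_\theta(1)v=0$, where $e_\alpha$ and $f_\theta$ are nonzero vectors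 of the root spaces $\mathfrak g_\alpha$ and $\mathfrak g_{-\theta}$. Suppose that the level is non-critical, that is, $k\neq -h^\vee$. Then every nonzero singular vector $v$ of $V^k(\mathfrak g)$ has nonzero image in Zhu's $C_2$-algebra $R_{V^k(\mathfrak g)}=V^k(\mathfrak g)/C_2(V^k(\mathfrak g))$, where $C_2(V)=\operatorname{span}_{\mathbb C}\{a_{(-2)}b : a,b\in V\}$. Equivalently, the principal symbol of $v$ for the Li filtration $F^\bullet V^k(\mathfrak g)$ has depth zero, that is, $v\in F^0V^k(\mathfrak g)\setminus F^1V^k(\mathfrak g)$, where $F^pV$ is the span of the vectors $(a_1)_{(-n_1-1)}\cdots(a_r)_{(-n_r-1)}b$ with $r\ge 0$, $a_i,b\in V$, $n_i\geq 1$ and $n_1+\cdots+n_r\geq p$. -/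

import Mathlib

/-!
# Universal affine vertex algebras

For a complex Lie algebra `g` with Killing form `κ` and a number `h` we build the affine Lie algebra
`ĝ = g[t, t⁻¹] ⊕ ℂ K` for the form `(x|y) = κ(x, y) / 2h`, its vacuum module `V^k(g)` of level `k`,
the state-field correspondence `Y` of the vertex algebra `V^k(g)`, and the quotient `V / C₂(V)`.
-/

noncomputable section

open scoped TensorProduct
open LieAlgebra VertexOperator

attribute [local instance 100] LieRing.ofAssociativeRing

/-- The bilinear form `(x|y) = κ(x, y) / 2h`, with `κ` the Killing form. For a simple Lie algebra and
`h` its dual Coxeter number this is the normalized invariant form. -/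
def normalizedForm (g : Type*) [LieRing g] [LieAlgebra ℂ g] (h : ℂ) :
    LinearMap.BilinForm ℂ g :=
  (1 / (2 * h)) • killingForm ℂ g

theorem normalizedForm_isSymm (g : Type*) [LieRing g] [LieAlgebra ℂ g] (h : ℂ) :
    (normalizedForm g h).IsSymm :=
  ⟨fun x y => by simp [normalizedForm, LieModule.traceForm_comm ℂ g g x y]⟩

theorem normalizedForm_lieInvariant (g : Type*) [LieRing g] [LieAlgebra ℂ g] (h : ℂ) :
    (normalizedForm g h).lieInvariant g := fun x y z => by
  have := LieModule.traceForm_lieInvariant ℂ g g x y z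
  simp only [normalizedForm, LinearMap.smul_apply, smul_eq_mul, this]
  ring

/-- The cocycle `x tᵐ, y tⁿ ↦ m (x|y) δ_{m+n,0}` of the loop algebra; the cocycle that Mathlib attaches
to a form `Φ` is `n Φ(x, y) δ_{m+n,0}`, whence the sign. -/
def affineCocycle (g : Type*) [LieRing g] [LieAlgebra ℂ g] (h : ℂ) :
    LieModule.Cohomology.twoCocycle ℂ (loopAlgebra ℂ ℤ g)
      (TrivialLieModule ℂ (loopAlgebra ℂ ℤ g) ℂ) :=
  LoopAlgebra.twoCocycleOfBilinear ℂ ℤ g (-normalizedForm g h)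
    (fun x y z => by simp [normalizedForm_lieInvariant g h x y z])
    ⟨fun x y => by simp [(normalizedForm_isSymm g h).eq x y]⟩

/-- The affine Lie algebra `ĝ = g[t, t⁻¹] ⊕ ℂ K`. -/
abbrev AffineLie (g : Type*) [LieRing g] [LieAlgebra ℂ g] (h : ℂ) : Type _ :=
  LieAlgebra.ofTwoCocycle (affineCocycle g h)

namespace AffineLie

variable {g : Type*} [LieRing g] [LieAlgebra ℂ g] {h : ℂ}

/-- The element `x(n) = x tⁿ` of `ĝ`. -/
def current (x : g) (n : ℤ) : AffineLie g h :=
  LieAlgebra.ofProd _ (AddMonoidAlgebra.single n (1 : ℂ) ⊗ₜ[ℂ] x, 0)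

/-- The central element `K` of `ĝ`. -/
def central : AffineLie g h :=
  LieAlgebra.ofProd _ (0, (TrivialLieModule.equiv ℂ (loopAlgebra ℂ ℤ g) ℂ).symm 1)

theorem current_add (x y : g) (n : ℤ) :
    (current (x + y) n : AffineLie g h) = current x n + current y n := by
  rw [current, current, current, ← of_add, Prod.mk_add_mk, add_zero, TensorProduct.tmul_add]

theorem current_smul (c : ℂ) (x : g) (n : ℤ) :
    (current (c • x) n : AffineLie g h) = c • current x n := by
  rw [current, current, ← of_smul, Prod.smul_mk, smul_zero, TensorProduct.tmul_smul]

theorem lie_current (x y : g) (m n : ℤ) :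
    ⁅(current x m : AffineLie g h), (current y n : AffineLie g h)⁆ =
      current ⁅x, y⁆ (m + n) +
        (if m + n = 0 then (m : ℂ) * normalizedForm g h x y else 0) •
          (central : AffineLie g h) := by
  rw [LieAlgebra.bracket_ofTwoCocycle]
  simp only [current, central, ← of_add, ← of_smul, Equiv.symm_apply_apply, lie_zero, sub_zero,
    add_zero, Prod.smul_mk, smul_zero, Prod.mk_add_mk, zero_add]
  refine Equiv.congr_arg (Prod.ext ?_ ?_)
  · change ⁅_, _⁆ = _
    rw [LieAlgebra.ExtendScalars.bracket_tmul, AddMonoidAlgebra.single_mul_single, mul_one]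
  · apply (TrivialLieModule.equiv ℂ (loopAlgebra ℂ ℤ g) ℂ).injective
    change LoopAlgebra.residuePairing ℂ ℤ g _ _ _ = _
    rw [LoopAlgebra.residuePairing_apply_apply, LoopAlgebra.toFinsupp_single_tmul,
      LoopAlgebra.toFinsupp_single_tmul, Finsupp.sum_single_index (by simp)]
    rw [map_smul, LinearEquiv.apply_symm_apply]
    by_cases hmn : m + n = 0
    · obtain rfl : n = -m := by lia
      simp
    · rw [if_neg hmn, Finsupp.single_eq_of_ne (by lia)]
      simp

theorem central_lie (a : AffineLie g h) : ⁅(central : AffineLie g h), a⁆ = 0 := by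
  rw [LieAlgebra.bracket_ofTwoCocycle]
  simp only [central, Equiv.symm_apply_apply, zero_lie, map_zero, LinearMap.zero_apply, zero_add,
    zero_sub]
  rw [trivial_lie_zero, neg_zero]
  rfl

theorem induction_on {p : AffineLie g h → Prop} (a : AffineLie g h)
    (current : ∀ x n, p (current x n)) (central : p central)
    (add : ∀ a b, p a → p b → p (a + b)) (smul : ∀ (c : ℂ) a, p a → p (c • a)) : p a := by
  obtain ⟨f, c⟩ := a
  have h1 : p (LieAlgebra.ofProd _ (f, 0)) := by
    obtain ⟨F, rfl⟩ := (LoopAlgebra.toFinsupp ℂ ℤ g).symm.surjective f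
    induction F using Finsupp.induction_linear with
    | zero => simpa [of_zero, ← Prod.zero_eq_mk] using smul 0 _ central
    | add F G hF hG =>
      have := add _ _ hF hG
      rwa [← of_add, Prod.mk_add_mk, add_zero, ← map_add] at this
    | single n x =>
      rw [LoopAlgebra.toFinsupp_symm_single]
      exact current x n
  have h2 := add _ _ h1 (smul (TrivialLieModule.equiv ℂ (loopAlgebra ℂ ℤ g) ℂ c) _ central)
  rw [AffineLie.central, ← of_smul, ← of_add, Prod.smul_mk, Prod.mk_add_mk, smul_zero, add_zero,
    zero_add, ← map_smul, smul_eq_mul, mul_one, LinearEquiv.symm_apply_apply] at h2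
  exact h2

end AffineLie

/-- The left ideal of `U(ĝ)` generated by `x tⁿ` (`x ∈ g`, `n ≥ 0`) and `K - k`. -/
def vacuumIdeal (g : Type*) [LieRing g] [LieAlgebra ℂ g] (h k : ℂ) :
    Submodule (UniversalEnvelopingAlgebra ℂ (AffineLie g h))
      (UniversalEnvelopingAlgebra ℂ (AffineLie g h)) :=
  Submodule.span _
    (Set.range (fun p : g × ℕ =>
        UniversalEnvelopingAlgebra.ι ℂ (AffineLie.current p.1 (p.2 : ℤ) : AffineLie g h)) ∪
      {UniversalEnvelopingAlgebra.ι ℂ (AffineLie.central : AffineLie g h) -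
        algebraMap ℂ _ k})

/-- The vacuum module `V^k(g) = U(ĝ) ⊗_{U(g[t] ⊕ ℂ K)} ℂ_k`, where `g[t]` acts on `ℂ_k` by zero and `K`
by `k`. Inducing a one-dimensional representation from a subalgebra amounts to dividing `U(ĝ)` by the
left ideal generated by the kernel of the character. -/
def UniversalAffine (g : Type*) [LieRing g] [LieAlgebra ℂ g] (h k : ℂ) : Type _ :=
  HasQuotient.Quotient (A := UniversalEnvelopingAlgebra ℂ (AffineLie g h)) (vacuumIdeal g h k)

namespace UniversalAffine

variable (g : Type*) [LieRing g] [LieAlgebra ℂ g] (h k : ℂ)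

instance : AddCommGroup (UniversalAffine g h k) :=
  inferInstanceAs (AddCommGroup (HasQuotient.Quotient
    (A := UniversalEnvelopingAlgebra ℂ (AffineLie g h)) (vacuumIdeal g h k)))

instance : Module (UniversalEnvelopingAlgebra ℂ (AffineLie g h)) (UniversalAffine g h k) :=
  inferInstanceAs (Module _ (HasQuotient.Quotient
    (A := UniversalEnvelopingAlgebra ℂ (AffineLie g h)) (vacuumIdeal g h k)))

instance : Module ℂ (UniversalAffine g h k) :=
  inferInstanceAs (Module ℂ (HasQuotient.Quotient
    (A := UniversalEnvelopingAlgebra ℂ (AffineLie g h)) (vacuumIdeal g h k)))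

instance : IsScalarTower ℂ (UniversalEnvelopingAlgebra ℂ (AffineLie g h))
    (UniversalAffine g h k) :=
  inferInstanceAs (IsScalarTower ℂ (UniversalEnvelopingAlgebra ℂ (AffineLie g h))
    (HasQuotient.Quotient
      (A := UniversalEnvelopingAlgebra ℂ (AffineLie g h)) (vacuumIdeal g h k)))

variable {g h k}

/-- The canonical projection `U(ĝ) → V^k(g)`, `u ↦ u ⊗ 1`. -/
def proj : UniversalEnvelopingAlgebra ℂ (AffineLie g h) →ₗ[UniversalEnvelopingAlgebra ℂ
    (AffineLie g h)] UniversalAffine g h k :=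
  (vacuumIdeal g h k).mkQ

theorem proj_surjective : Function.Surjective (proj : _ → UniversalAffine g h k) :=
  (vacuumIdeal g h k).mkQ_surjective

theorem proj_eq_zero_iff (u : UniversalEnvelopingAlgebra ℂ (AffineLie g h)) :
    (proj u : UniversalAffine g h k) = 0 ↔ u ∈ vacuumIdeal g h k :=
  Submodule.Quotient.mk_eq_zero _

end UniversalAffine

namespace VertexOperator

variable {V : Type*} [AddCommGroup V] [Module ℂ V]

theorem ncoeff_injective {A B : VertexOperator ℂ V} (h : ∀ n v, (A[[n]]) v = (B[[n]]) v) : A = B := by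
  apply HVertexOperator.coeff_inj
  funext n
  ext v
  simpa using h (-n - 1) v

theorem exists_forall_ncoeff_eq_zero (A : VertexOperator ℂ V) (v : V) :
    ∃ N : ℕ, ∀ n : ℤ, N ≤ n → (A[[n]]) v = 0 := by
  refine ⟨(-HahnSeries.order ((HahnModule.of ℂ).symm (A v))).toNat, fun n hn => ?_⟩
  exact ncoeff_eq_zero_of_lt_order A n v (by lia)

theorem ncoeff_add_apply (A B : VertexOperator ℂ V) (n : ℤ) (v : V) :
    ((A + B)[[n]]) v = (A[[n]]) v + (B[[n]]) v := by
  rw [map_add, Pi.add_apply, LinearMap.add_apply]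

theorem ncoeff_neg_apply (A : VertexOperator ℂ V) (n : ℤ) (v : V) :
    ((-A)[[n]]) v = -(A[[n]]) v := by
  rw [map_neg, Pi.neg_apply, LinearMap.neg_apply]

theorem ncoeff_sub_apply (A B : VertexOperator ℂ V) (n : ℤ) (v : V) :
    ((A - B)[[n]]) v = (A[[n]]) v - (B[[n]]) v := by
  rw [map_sub, Pi.sub_apply, LinearMap.sub_apply]

theorem ncoeff_smul_apply (c : ℂ) (A : VertexOperator ℂ V) (n : ℤ) (v : V) :
    ((c • A)[[n]]) v = c • (A[[n]]) v := by
  rw [map_smul, Pi.smul_apply, LinearMap.smul_apply]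

/-- The field with modes `f n`, for `f` with `f n v = 0` for `n` large, depending on `v`. -/
def ofModes (f : ℤ → Module.End ℂ V) (hf : ∀ v, ∃ N : ℕ, ∀ n : ℤ, N ≤ n → f n v = 0) :
    VertexOperator ℂ V :=
  of_coeff (fun n => f (-n - 1)) fun v => by
    obtain ⟨N, hN⟩ := hf v
    refine ⟨-N - 1, fun n hn => ?_⟩
    by_contra hlt
    exact hn (hN _ (by lia))

@[simp]
theorem ncoeff_ofModes (f : ℤ → Module.End ℂ V)
    (hf : ∀ v, ∃ N : ℕ, ∀ n : ℤ, N ≤ n → f n v = 0) (n : ℤ) : (ofModes f hf)[[n]] = f n := by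
  simp [ofModes]

/-- The coefficient `(-1)^j (n choose j)`, for `n` an integer. -/
def signedChoose (n : ℤ) (j : ℕ) : ℂ := (-1) ^ j * (Ring.choose n j : ℤ)

theorem outer_eq_sum (A B : VertexOperator ℂ V) (n m : ℤ) (v : V) (N : ℕ)
    (hN : ∀ i : ℤ, m + N ≤ i → (B[[i]]) v = 0) :
    ∑ᶠ j : ℕ, signedChoose n j • (A[[n - j]]) ((B[[m + j]]) v) =
      ∑ j ∈ Finset.range N, signedChoose n j • (A[[n - j]]) ((B[[m + j]]) v) := by
  apply finsum_eq_sum_of_support_subset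
  intro j hj
  simp only [Finset.coe_range, Set.mem_Iio]
  by_contra hlt
  exact hj (by simp only []; rw [hN _ (by lia)]; simp)

theorem inner_eq_sum (A B : VertexOperator ℂ V) (n m : ℤ) (v : V) (N : ℕ)
    (hN : ∀ i : ℤ, N ≤ i → (A[[i]]) v = 0) :
    ∑ᶠ j : ℕ, ((-1) ^ n * signedChoose n j) • (B[[n + m - j]]) ((A[[(j : ℤ)]]) v) =
      ∑ j ∈ Finset.range N, ((-1) ^ n * signedChoose n j) • (B[[n + m - j]]) ((A[[(j : ℤ)]]) v) := by
  apply finsum_eq_sum_of_support_subset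
  intro j hj
  simp only [Finset.coe_range, Set.mem_Iio]
  by_contra hlt
  exact hj (by simp only []; rw [hN _ (by lia)]; simp)

/-- The field with `m`-th mode `∑_{j ≥ 0} (-1)^j (n choose j) A_(n-j) B_(m+j)`. -/
def outerProduct (A : VertexOperator ℂ V) (n : ℤ) (B : VertexOperator ℂ V) :
    VertexOperator ℂ V :=
  ofModes
    (fun m =>
      { toFun := fun v => ∑ᶠ j : ℕ, signedChoose n j • (A[[n - j]]) ((B[[m + j]]) v)
        map_add' := fun v w => by
          obtain ⟨N₁, h₁⟩ := exists_forall_ncoeff_eq_zero B v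
          obtain ⟨N₂, h₂⟩ := exists_forall_ncoeff_eq_zero B w
          rw [outer_eq_sum A B n m v (N₁ + N₂ + (-m).toNat) fun i hi => h₁ i (by lia),
            outer_eq_sum A B n m w (N₁ + N₂ + (-m).toNat) fun i hi => h₂ i (by lia),
            outer_eq_sum A B n m (v + w) (N₁ + N₂ + (-m).toNat) fun i hi => by
              rw [map_add, h₁ i (by lia), h₂ i (by lia), add_zero] ]
          simp only [LinearMap.map_add, smul_add, Finset.sum_add_distrib]
        map_smul' := fun c v => by
          rw [RingHom.id_apply, smul_finsum]
          refine finsum_congr fun j => ?_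
          rw [map_smul, map_smul, smul_comm] })
    (fun v => by
      obtain ⟨N, hN⟩ := exists_forall_ncoeff_eq_zero B v
      refine ⟨N, fun m hm => ?_⟩
      change ∑ᶠ j : ℕ, _ = _
      rw [outer_eq_sum A B n m v 0 fun i hi => hN i (by lia)]
      simp)

/-- The field with `m`-th mode `∑_{j ≥ 0} (-1)^n (-1)^j (n choose j) B_(n+m-j) A_(j)`. -/
def innerProduct (A : VertexOperator ℂ V) (n : ℤ) (B : VertexOperator ℂ V) :
    VertexOperator ℂ V :=
  ofModes
    (fun m =>
      { toFun := fun v =>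
          ∑ᶠ j : ℕ, ((-1) ^ n * signedChoose n j) • (B[[n + m - j]]) ((A[[(j : ℤ)]]) v)
        map_add' := fun v w => by
          obtain ⟨N₁, h₁⟩ := exists_forall_ncoeff_eq_zero A v
          obtain ⟨N₂, h₂⟩ := exists_forall_ncoeff_eq_zero A w
          rw [inner_eq_sum A B n m v (N₁ + N₂) fun i hi => h₁ i (by lia),
            inner_eq_sum A B n m w (N₁ + N₂) fun i hi => h₂ i (by lia),
            inner_eq_sum A B n m (v + w) (N₁ + N₂) fun i hi => by
              rw [map_add, h₁ i (by lia), h₂ i (by lia), add_zero] ]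
          simp only [LinearMap.map_add, smul_add, Finset.sum_add_distrib]
        map_smul' := fun c v => by
          rw [RingHom.id_apply, smul_finsum]
          refine finsum_congr fun j => ?_
          rw [map_smul, map_smul, smul_comm] })
    (fun v => by
      obtain ⟨J, hJ⟩ := exists_forall_ncoeff_eq_zero A v
      choose N hN using fun j : ℕ => exists_forall_ncoeff_eq_zero B ((A[[(j : ℤ)]]) v)
      refine ⟨J + ∑ j ∈ Finset.range J, N j + n.natAbs, fun m hm => ?_⟩
      change ∑ᶠ j : ℕ, _ = _
      rw [inner_eq_sum A B n m v J fun i hi => hJ i (by lia)]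
      refine Finset.sum_eq_zero fun j hj => ?_
      have h1 := Finset.single_le_sum (f := N) (fun _ _ => Nat.zero_le _) hj
      have h2 := Finset.mem_range.mp hj
      rw [hN j _ (by lia), smul_zero])

/-- The `n`-th residue product `A_(n) B` of two fields, with modes
`(A_(n) B)_(m) = ∑_{j ≥ 0} (-1)^j (n choose j) (A_(n-j) B_(m+j) - (-1)^n B_(n+m-j) A_(j))`. -/
def nthProduct (A : VertexOperator ℂ V) (n : ℤ) (B : VertexOperator ℂ V) :
    VertexOperator ℂ V :=
  outerProduct A n B - innerProduct A n B

theorem ncoeff_outerProduct (A : VertexOperator ℂ V) (n : ℤ) (B : VertexOperator ℂ V) (m : ℤ)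
    (v : V) (N : ℕ) (hN : ∀ i : ℤ, m + N ≤ i → (B[[i]]) v = 0) :
    ((outerProduct A n B)[[m]]) v =
      ∑ j ∈ Finset.range N, signedChoose n j • (A[[n - j]]) ((B[[m + j]]) v) := by
  rw [← outer_eq_sum A B n m v N hN, outerProduct, ncoeff_ofModes]
  rfl

theorem ncoeff_innerProduct (A : VertexOperator ℂ V) (n : ℤ) (B : VertexOperator ℂ V) (m : ℤ)
    (v : V) (N : ℕ) (hN : ∀ i : ℤ, N ≤ i → (A[[i]]) v = 0) :
    ((innerProduct A n B)[[m]]) v =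
      ∑ j ∈ Finset.range N,
        ((-1) ^ n * signedChoose n j) • (B[[n + m - j]]) ((A[[(j : ℤ)]]) v) := by
  rw [← inner_eq_sum A B n m v N hN, innerProduct, ncoeff_ofModes]
  rfl

theorem outerProduct_linear (A A' : VertexOperator ℂ V) (n : ℤ) (B B' : VertexOperator ℂ V)
    (c : ℂ) :
    outerProduct (A + A') n B = outerProduct A n B + outerProduct A' n B ∧
    outerProduct (c • A) n B = c • outerProduct A n B ∧
    outerProduct A n (B + B') = outerProduct A n B + outerProduct A n B' ∧
    outerProduct A n (c • B) = c • outerProduct A n B := by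
  have key (m : ℤ) (v : V) : ∃ N : ℕ, (∀ i : ℤ, m + N ≤ i → (B[[i]]) v = 0) ∧
      (∀ i : ℤ, m + N ≤ i → (B'[[i]]) v = 0) ∧
      (∀ i : ℤ, m + N ≤ i → ((B + B')[[i]]) v = 0) ∧
      (∀ i : ℤ, m + N ≤ i → ((c • B)[[i]]) v = 0) := by
    obtain ⟨N₁, h₁⟩ := exists_forall_ncoeff_eq_zero B v
    obtain ⟨N₂, h₂⟩ := exists_forall_ncoeff_eq_zero B' v
    refine ⟨N₁ + N₂ + (-m).toNat, fun i hi => h₁ i (by lia), fun i hi => h₂ i (by lia),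
      fun i hi => ?_, fun i hi => ?_⟩
    · rw [ncoeff_add_apply, h₁ i (by lia), h₂ i (by lia), add_zero]
    · rw [ncoeff_smul_apply, h₁ i (by lia), smul_zero]
  refine ⟨?_, ?_, ?_, ?_⟩ <;> refine ncoeff_injective fun m v => ?_ <;>
    obtain ⟨N, h1, h2, h3, h4⟩ := key m v
  · simp only [ncoeff_add_apply]
    simp only [ncoeff_outerProduct _ n B m v N h1, ncoeff_add_apply]
    simp only [LinearMap.map_add,
      smul_add, Finset.sum_add_distrib]
  · simp only [ncoeff_smul_apply]
    simp only [ncoeff_outerProduct _ n B m v N h1, ncoeff_smul_apply]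
    simp only [LinearMap.map_smul,
      Finset.smul_sum]
    exact Finset.sum_congr rfl fun j _ => smul_comm _ _ _
  · simp only [ncoeff_add_apply]
    rw [ncoeff_outerProduct A n _ m v N h3, ncoeff_outerProduct A n _ m v N h1,
      ncoeff_outerProduct A n _ m v N h2]
    simp only [ncoeff_add_apply]
    simp only [LinearMap.map_add, smul_add, Finset.sum_add_distrib]
  · simp only [ncoeff_smul_apply]
    rw [ncoeff_outerProduct A n _ m v N h4, ncoeff_outerProduct A n _ m v N h1]
    simp only [ncoeff_smul_apply]
    simp only [LinearMap.map_smul, Finset.smul_sum]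
    exact Finset.sum_congr rfl fun j _ => smul_comm _ _ _

theorem innerProduct_linear (A A' : VertexOperator ℂ V) (n : ℤ) (B B' : VertexOperator ℂ V)
    (c : ℂ) :
    innerProduct (A + A') n B = innerProduct A n B + innerProduct A' n B ∧
    innerProduct (c • A) n B = c • innerProduct A n B ∧
    innerProduct A n (B + B') = innerProduct A n B + innerProduct A n B' ∧
    innerProduct A n (c • B) = c • innerProduct A n B := by
  have key (v : V) : ∃ N : ℕ, (∀ i : ℤ, N ≤ i → (A[[i]]) v = 0) ∧
      (∀ i : ℤ, N ≤ i → (A'[[i]]) v = 0) ∧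
      (∀ i : ℤ, N ≤ i → ((A + A')[[i]]) v = 0) ∧
      (∀ i : ℤ, N ≤ i → ((c • A)[[i]]) v = 0) := by
    obtain ⟨N₁, h₁⟩ := exists_forall_ncoeff_eq_zero A v
    obtain ⟨N₂, h₂⟩ := exists_forall_ncoeff_eq_zero A' v
    refine ⟨N₁ + N₂, fun i hi => h₁ i (by lia), fun i hi => h₂ i (by lia),
      fun i hi => ?_, fun i hi => ?_⟩
    · rw [ncoeff_add_apply, h₁ i (by lia), h₂ i (by lia), add_zero]
    · rw [ncoeff_smul_apply, h₁ i (by lia), smul_zero]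
  refine ⟨?_, ?_, ?_, ?_⟩ <;> refine ncoeff_injective fun m v => ?_ <;>
    obtain ⟨N, h1, h2, h3, h4⟩ := key v
  · simp only [ncoeff_add_apply]
    rw [ncoeff_innerProduct _ n _ m v N h3, ncoeff_innerProduct _ n _ m v N h1,
      ncoeff_innerProduct _ n _ m v N h2]
    simp only [ncoeff_add_apply]
    simp only [LinearMap.map_add, smul_add, Finset.sum_add_distrib]
  · simp only [ncoeff_smul_apply]
    rw [ncoeff_innerProduct _ n _ m v N h4, ncoeff_innerProduct _ n _ m v N h1]
    simp only [ncoeff_smul_apply]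
    simp only [LinearMap.map_smul, Finset.smul_sum]
    exact Finset.sum_congr rfl fun j _ => smul_comm _ _ _
  · simp only [ncoeff_add_apply]
    simp only [ncoeff_innerProduct _ n _ m v N h1, ncoeff_add_apply]
    simp only [LinearMap.map_add,
      smul_add, Finset.sum_add_distrib]
  · simp only [ncoeff_smul_apply]
    simp only [ncoeff_innerProduct _ n _ m v N h1, ncoeff_smul_apply]
    simp only [LinearMap.map_smul,
      Finset.smul_sum]
    exact Finset.sum_congr rfl fun j _ => smul_comm _ _ _

/-- The residue product `A_(n) B` as a bilinear map. -/
def nthProductₗ (n : ℤ) :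
    VertexOperator ℂ V →ₗ[ℂ] VertexOperator ℂ V →ₗ[ℂ] VertexOperator ℂ V :=
  LinearMap.mk₂ ℂ (fun A B => nthProduct A n B)
    (fun A A' B => by
      simp only [nthProduct, (outerProduct_linear A A' n B B 0).1,
        (innerProduct_linear A A' n B B 0).1]
      abel)
    (fun c A B => by
      simp only [nthProduct, (outerProduct_linear A A n B B c).2.1,
        (innerProduct_linear A A n B B c).2.1, smul_sub])
    (fun A B B' => by
      simp only [nthProduct, (outerProduct_linear A A n B B' 0).2.2.1,
        (innerProduct_linear A A n B B' 0).2.2.1]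
      abel)
    (fun c A B => by
      simp only [nthProduct, (outerProduct_linear A A n B B c).2.2.2,
        (innerProduct_linear A A n B B c).2.2.2, smul_sub])

theorem sum_signedChoose (m n : ℤ) (N : ℕ) (G : ℕ → V) (hG : ∀ s, N ≤ s → G s = 0) :
    ∑ i ∈ Finset.range N, ∑ j ∈ Finset.range N,
      (signedChoose m i * signedChoose n j) • G (i + j) =
      ∑ s ∈ Finset.range N, signedChoose (m + n) s • G s := by
  rw [← Finset.sum_product',
    ← Finset.sum_filter_of_ne (p := fun x : ℕ × ℕ => x.1 + x.2 ∈ Finset.range N) (fun x _ hx => by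
      by_contra h
      exact hx (by rw [hG _ (by simpa using h), smul_zero])),
    ← Finset.sum_fiberwise_of_maps_to (t := Finset.range N) (g := fun x : ℕ × ℕ => x.1 + x.2)
      (fun x hx => (Finset.mem_filter.mp hx).2)]
  refine Finset.sum_congr rfl fun s hs => ?_
  have hs' := Finset.mem_range.mp hs
  have hfil : {x ∈ {x ∈ Finset.range N ×ˢ Finset.range N | x.1 + x.2 ∈ Finset.range N} |
      x.1 + x.2 = s} = Finset.HasAntidiagonal.antidiagonal s := by
    ext x
    simp only [Finset.mem_filter, Finset.mem_product, Finset.mem_range, Finset.HasAntidiagonal.mem_antidiagonal]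
    lia
  rw [hfil, signedChoose, Ring.add_choose_eq s (Commute.all m n)]
  push_cast
  rw [Finset.mul_sum, Finset.sum_smul]
  refine Finset.sum_congr rfl fun x hx => ?_
  obtain rfl := Finset.HasAntidiagonal.mem_antidiagonal.mp hx
  congr 1
  simp only [signedChoose, pow_add]
  ring

theorem outer_inner_comm (A B F : VertexOperator ℂ V) (m n : ℤ) :
    outerProduct A m (innerProduct B n F) = innerProduct B n (outerProduct A m F) := by
  refine ncoeff_injective fun p v => ?_
  obtain ⟨J, hJ⟩ := exists_forall_ncoeff_eq_zero B v
  choose N hN using fun j : ℕ => exists_forall_ncoeff_eq_zero F ((B[[(j : ℤ)]]) v)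
  let M := J + ∑ j ∈ Finset.range J, N j + n.natAbs + p.natAbs
  have hM (j : ℕ) (hj : j < J) (i : ℤ) (hi : n + p + M - j ≤ i) :
      (F[[i]]) ((B[[(j : ℤ)]]) v) = 0 := by
    have h1 := Finset.single_le_sum (f := N) (fun _ _ => Nat.zero_le _) (Finset.mem_range.mpr hj)
    exact hN j i (by simp only [M] at hi; lia)
  rw [ncoeff_outerProduct A m _ p v M fun i hi => by
      rw [ncoeff_innerProduct B n F i v J hJ]
      refine Finset.sum_eq_zero fun j hj => ?_
      rw [hM j (Finset.mem_range.mp hj) _ (by lia), smul_zero],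
    ncoeff_innerProduct B n _ p v J hJ]
  have h1 : ∀ i ∈ Finset.range M, signedChoose m i • (A[[m - i]]) (((innerProduct B n F)[[p + i]]) v)
      = ∑ j ∈ Finset.range J, ((-1) ^ n * signedChoose n j * signedChoose m i) •
        (A[[m - i]]) ((F[[n + (p + i) - j]]) ((B[[(j : ℤ)]]) v)) := fun i _ => by
    rw [ncoeff_innerProduct B n F _ v J hJ, map_sum, Finset.smul_sum]
    refine Finset.sum_congr rfl fun j _ => ?_
    rw [map_smul, smul_smul, mul_comm]
  rw [Finset.sum_congr rfl h1, Finset.sum_comm]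
  refine Finset.sum_congr rfl fun j hj => ?_
  rw [ncoeff_outerProduct A m F _ _ M fun i hi => hM j (Finset.mem_range.mp hj) i (by lia),
    Finset.smul_sum]
  refine Finset.sum_congr rfl fun i _ => ?_
  rw [smul_smul, show n + (p + (i : ℤ)) - j = n + p - j + i by ring]

theorem sub_mul_signedChoose (m : ℤ) (i : ℕ) :
    ((m : ℂ) - i) * signedChoose m i = m * signedChoose (m - 1) i := by
  suffices h : (m - i) * Ring.choose m i = m * Ring.choose (m - 1) i by
    have h' := congrArg (Int.cast : ℤ → ℂ) h
    push_cast at h'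
    simp only [signedChoose]
    linear_combination (-1) ^ i * h'
  have h1 := Ring.choose_smul_choose m (Nat.le_succ i)
  have h2 := Ring.choose_smul_choose m (Nat.succ_le_succ (Nat.zero_le i))
  simp only [Nat.succ_eq_add_one, Nat.choose_succ_self_right, Nat.choose_one_right,
    Nat.add_sub_cancel_left, Nat.add_sub_cancel, Ring.choose_one_right, zero_add,
    Nat.cast_one] at h1 h2
  linarith

theorem outer_outer (A B C F : VertexOperator ℂ V) (s : ℂ)
    (hAB : ∀ (m n : ℤ) (v : V), (A[[m]]) ((B[[n]]) v) - (B[[n]]) ((A[[m]]) v) =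
      (C[[m + n]]) v + (if m + n = 0 then (m : ℂ) * s else 0) • v) (m n : ℤ) :
    outerProduct A m (outerProduct B n F) - outerProduct B n (outerProduct A m F) =
      outerProduct C (m + n) F + (if m + n = 0 then (m : ℂ) * s else 0) • F := by
  refine ncoeff_injective fun p v => ?_
  obtain ⟨N₀, hN₀⟩ := exists_forall_ncoeff_eq_zero F v
  let N := N₀ + p.natAbs + 1
  have hN (i : ℤ) (hi : p + N ≤ i) : (F[[i]]) v = 0 := hN₀ i (by simp only [N] at hi; lia)
  have aux (A B : VertexOperator ℂ V) (m n : ℤ) :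
      ((outerProduct A m (outerProduct B n F))[[p]]) v =
        ∑ i ∈ Finset.range N, ∑ j ∈ Finset.range N, (signedChoose m i * signedChoose n j) •
          (A[[m - i]]) ((B[[n - j]]) ((F[[p + (i + j : ℕ)]]) v)) := by
    rw [ncoeff_outerProduct A m _ p v N fun i hi => by
      rw [ncoeff_outerProduct B n F i v 0 fun i' hi' => hN i' (by lia)]; simp]
    refine Finset.sum_congr rfl fun i _ => ?_
    rw [ncoeff_outerProduct B n F _ v N fun i' hi' => hN i' (by lia), map_sum, Finset.smul_sum]
    refine Finset.sum_congr rfl fun j _ => ?_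
    rw [map_smul, smul_smul, Nat.cast_add, add_assoc]
  rw [ncoeff_sub_apply, ncoeff_add_apply, ncoeff_smul_apply, aux A B m n, aux B A n m, Finset.sum_comm
      (f := fun i j => (signedChoose n i * signedChoose m j) •
          (B[[n - i]]) ((A[[m - j]]) ((F[[p + (i + j : ℕ)]]) v))),
    ncoeff_outerProduct C (m + n) F p v N hN, ← Finset.sum_sub_distrib]
  have step (i j : ℕ) : (signedChoose m i * signedChoose n j) •
          (A[[m - i]]) ((B[[n - j]]) ((F[[p + (i + j : ℕ)]]) v)) -
        (signedChoose n j * signedChoose m i) •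
          (B[[n - j]]) ((A[[m - i]]) ((F[[p + (j + i : ℕ)]]) v)) =
      (signedChoose m i * signedChoose n j) •
        (C[[m + n - (i + j : ℕ)]]) ((F[[p + (i + j : ℕ)]]) v) +
      ((m : ℂ) * s) • (signedChoose (m - 1) i * signedChoose n j) •
        (if m + n = (i + j : ℕ) then (F[[p + (i + j : ℕ)]]) v else 0) := by
    rw [mul_comm (signedChoose n j), add_comm j i, ← smul_sub, hAB, smul_add]
    congr 1
    · congr 3
      push_cast
      ring_nf
    · rw [smul_smul, smul_smul]
      by_cases h : m + n = (i + j : ℕ)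
      · rw [if_pos h, if_pos (by push_cast at h; lia)]
        congr 1
        have := sub_mul_signedChoose m i
        push_cast
        linear_combination s * signedChoose n j * this
      · rw [if_neg h, if_neg (by push_cast at h; lia)]
        simp
  simp only [← Finset.sum_sub_distrib, step, Finset.sum_add_distrib, ← Finset.smul_sum]
  rw [sum_signedChoose m n N (fun t => (C[[m + n - t]]) ((F[[p + t]]) v)) fun t ht => by
      rw [hN _ (by lia), map_zero],
    sum_signedChoose (m - 1) n N (fun t => if m + n = t then (F[[p + t]]) v else 0) fun t ht => by
      rw [hN _ (by lia), ite_self] ]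
  congr 1
  by_cases h : m + n = 0
  · rw [if_pos h, Finset.sum_eq_single 0]
    · simp [h, signedChoose]
    · intro t _ ht
      rw [if_neg (by lia), smul_zero]
    · intro h0
      exact absurd (Finset.mem_range.mpr (by simp [N])) h0
  · rw [if_neg h, zero_smul, Finset.sum_eq_zero, smul_zero]
    intro t _
    split_ifs with ht
    · have : Ring.choose (m - 1 + n) t = 0 := by
        rw [show m - 1 + n = ((t - 1 : ℕ) : ℤ) by lia, Ring.choose_natCast,
          Nat.choose_eq_zero_of_lt (by lia)]
        rfl
      simp [signedChoose, this]
    · simp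

theorem inner_inner (A B C F : VertexOperator ℂ V) (s : ℂ)
    (hAB : ∀ (m n : ℤ) (v : V), (A[[m]]) ((B[[n]]) v) - (B[[n]]) ((A[[m]]) v) =
      (C[[m + n]]) v + (if m + n = 0 then (m : ℂ) * s else 0) • v) (m n : ℤ) :
    innerProduct A m (innerProduct B n F) - innerProduct B n (innerProduct A m F) =
      -innerProduct C (m + n) F := by
  refine ncoeff_injective fun p v => ?_
  obtain ⟨N₁, h₁⟩ := exists_forall_ncoeff_eq_zero A v
  obtain ⟨N₂, h₂⟩ := exists_forall_ncoeff_eq_zero B v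
  obtain ⟨N₃, h₃⟩ := exists_forall_ncoeff_eq_zero C v
  choose f hf using fun j : ℕ => exists_forall_ncoeff_eq_zero A ((B[[(j : ℤ)]]) v)
  choose e he using fun j : ℕ => exists_forall_ncoeff_eq_zero B ((A[[(j : ℤ)]]) v)
  let M := N₁ + N₂ + N₃ + ∑ j ∈ Finset.range N₂, f j + ∑ j ∈ Finset.range N₁, e j
  have hA (i : ℤ) (hi : M ≤ i) : (A[[i]]) v = 0 := h₁ i (by simp only [M] at hi; lia)
  have hB (i : ℤ) (hi : M ≤ i) : (B[[i]]) v = 0 := h₂ i (by simp only [M] at hi; lia)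
  have hC (i : ℤ) (hi : M ≤ i) : (C[[i]]) v = 0 := h₃ i (by simp only [M] at hi; lia)
  have hAB' (j : ℕ) (i : ℤ) (hi : M ≤ i) : (A[[i]]) ((B[[(j : ℤ)]]) v) = 0 := by
    by_cases hj : j < N₂
    · have h1 := Finset.single_le_sum (f := f) (fun _ _ => Nat.zero_le _) (Finset.mem_range.mpr hj)
      exact hf j i (by simp only [M] at hi; lia)
    · rw [h₂ j (by lia), map_zero]
  have hBA' (j : ℕ) (i : ℤ) (hi : M ≤ i) : (B[[i]]) ((A[[(j : ℤ)]]) v) = 0 := by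
    by_cases hj : j < N₁
    · have h1 := Finset.single_le_sum (f := e) (fun _ _ => Nat.zero_le _) (Finset.mem_range.mpr hj)
      exact he j i (by simp only [M] at hi; lia)
    · rw [h₁ j (by lia), map_zero]
  have aux (A B : VertexOperator ℂ V) (m n : ℤ) (hA : ∀ i : ℤ, M ≤ i → (A[[i]]) v = 0)
      (hBA : ∀ (j : ℕ) (i : ℤ), M ≤ i → (B[[i]]) ((A[[(j : ℤ)]]) v) = 0) :
      ((innerProduct A m (innerProduct B n F))[[p]]) v =
        ∑ i ∈ Finset.range M, ∑ j ∈ Finset.range M,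
          ((-1) ^ (m + n) * (signedChoose m i * signedChoose n j)) •
          (F[[m + n + p - (i + j : ℕ)]]) ((B[[(j : ℤ)]]) ((A[[(i : ℤ)]]) v)) := by
    rw [ncoeff_innerProduct A m _ p v M hA]
    refine Finset.sum_congr rfl fun i _ => ?_
    rw [ncoeff_innerProduct B n F _ _ M (hBA i), Finset.smul_sum]
    refine Finset.sum_congr rfl fun j _ => ?_
    rw [smul_smul, show n + (m + p - (i : ℤ)) - j = m + n + p - (i + j : ℕ) by push_cast; ring,
      zpow_add₀ (by simp)]
    congr 1
    ring
  rw [ncoeff_sub_apply, ncoeff_neg_apply, aux A B m n hA hBA', aux B A n m hB hAB', Finset.sum_comm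
      (f := fun i j => ((-1) ^ (n + m) * (signedChoose n i * signedChoose m j)) •
          (F[[n + m + p - (i + j : ℕ)]]) ((A[[(j : ℤ)]]) ((B[[(i : ℤ)]]) v))),
    ncoeff_innerProduct C (m + n) F p v M hC, ← Finset.sum_sub_distrib]
  have step (i j : ℕ) : ((-1) ^ (m + n) * (signedChoose m i * signedChoose n j)) •
          (F[[m + n + p - (i + j : ℕ)]]) ((B[[(j : ℤ)]]) ((A[[(i : ℤ)]]) v)) -
        ((-1) ^ (n + m) * (signedChoose n j * signedChoose m i)) •
          (F[[n + m + p - (j + i : ℕ)]]) ((A[[(i : ℤ)]]) ((B[[(j : ℤ)]]) v)) =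
      -((-1 : ℂ) ^ (m + n)) • (signedChoose m i * signedChoose n j) •
        (F[[m + n + p - (i + j : ℕ)]]) ((C[[((i + j : ℕ) : ℤ)]]) v) := by
    have h0 := hAB i j v
    have h1 : (if (i : ℤ) + j = 0 then ((i : ℤ) : ℂ) * s else 0) = 0 := by
      split_ifs with h
      · rw [show i = 0 by lia]; simp
      · rfl
    rw [h1, zero_smul, add_zero] at h0
    rw [add_comm n m, add_comm j i, mul_comm (signedChoose n j), ← smul_sub, ← map_sub,
      ← neg_sub ((A[[(i : ℤ)]]) _), h0, map_neg, Nat.cast_add, smul_neg, smul_smul, neg_mul, neg_smul]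
  simp only [← Finset.sum_sub_distrib, step, ← Finset.smul_sum]
  rw [sum_signedChoose m n M (fun t => (F[[m + n + p - t]]) ((C[[(t : ℤ)]]) v)) fun t ht => by
      rw [hC _ (by lia), map_zero], neg_smul, Finset.smul_sum]
  congr 1
  exact Finset.sum_congr rfl fun t _ => smul_smul _ _ _

theorem nthProduct_commutator (A B C F : VertexOperator ℂ V) (s : ℂ)
    (hAB : ∀ (m n : ℤ) (v : V), (A[[m]]) ((B[[n]]) v) - (B[[n]]) ((A[[m]]) v) =
      (C[[m + n]]) v + (if m + n = 0 then (m : ℂ) * s else 0) • v) (m n : ℤ) :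
    nthProductₗ m A (nthProductₗ n B F) - nthProductₗ n B (nthProductₗ m A F) =
      nthProductₗ (m + n) C F + (if m + n = 0 then (m : ℂ) * s else 0) • F := by
  have sub_o (A X Y : VertexOperator ℂ V) (m : ℤ) :
      outerProduct A m (X - Y) = outerProduct A m X - outerProduct A m Y := by
    have h := (outerProduct_linear A A m (X - Y) Y 0).2.2.1
    rw [sub_add_cancel] at h
    rw [h, add_sub_cancel_right]
  have sub_i (A X Y : VertexOperator ℂ V) (m : ℤ) :
      innerProduct A m (X - Y) = innerProduct A m X - innerProduct A m Y := by
    have h := (innerProduct_linear A A m (X - Y) Y 0).2.2.1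
    rw [sub_add_cancel] at h
    rw [h, add_sub_cancel_right]
  have h1 := outer_outer A B C F s hAB m n
  have h2 := inner_inner A B C F s hAB m n
  simp only [nthProductₗ, LinearMap.mk₂_apply, nthProduct, sub_o, sub_i]
  rw [outer_inner_comm A B F m n, outer_inner_comm B A F n m]
  rw [sub_eq_iff_eq_add] at h1 h2
  rw [h1, h2]
  abel

end VertexOperator


section FieldAction

variable {g : Type*} [LieRing g] [LieAlgebra ℂ g] {h : ℂ} {V : Type*} [AddCommGroup V] [Module ℂ V]

/-- Given fields `φ x`, the linear action of `ĝ` on all fields by residue products with `φ x`. -/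
def fieldActionₗ (φ : g →ₗ[ℂ] VertexOperator ℂ V) (k : ℂ) :
    AffineLie g h →ₗ[ℂ] Module.End ℂ (VertexOperator ℂ V) where
  toFun a :=
    Finsupp.lsum ℂ (fun n : ℤ => nthProductₗ n ∘ₗ φ)
        (LoopAlgebra.toFinsupp ℂ ℤ g a.carrier.1) +
      (TrivialLieModule.equiv ℂ (loopAlgebra ℂ ℤ g) ℂ a.carrier.2 * k) • LinearMap.id
  map_add' a b := by
    change Finsupp.lsum ℂ _ (LoopAlgebra.toFinsupp ℂ ℤ g (a.carrier.1 + b.carrier.1)) +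
      (TrivialLieModule.equiv ℂ (loopAlgebra ℂ ℤ g) ℂ (a.carrier.2 + b.carrier.2) * k) • _ = _
    rw [map_add, map_add, map_add, add_mul, add_smul]
    abel
  map_smul' c a := by
    change Finsupp.lsum ℂ _ (LoopAlgebra.toFinsupp ℂ ℤ g (c • a.carrier.1)) +
      (TrivialLieModule.equiv ℂ (loopAlgebra ℂ ℤ g) ℂ (c • a.carrier.2) * k) • _ = _
    rw [map_smul, map_smul, map_smul, RingHom.id_apply, smul_add, smul_smul, smul_eq_mul,
      mul_assoc]

theorem fieldActionₗ_current (φ : g →ₗ[ℂ] VertexOperator ℂ V) (k : ℂ) (x : g) (n : ℤ)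
    (F : VertexOperator ℂ V) :
    fieldActionₗ φ k (AffineLie.current x n : AffineLie g h) F = nthProductₗ n (φ x) F := by
  change ((Finsupp.lsum ℂ (fun n : ℤ => nthProductₗ n ∘ₗ φ)
    (LoopAlgebra.toFinsupp ℂ ℤ g (AddMonoidAlgebra.single n (1 : ℂ) ⊗ₜ[ℂ] x)) +
      (TrivialLieModule.equiv ℂ (loopAlgebra ℂ ℤ g) ℂ 0 * k) • LinearMap.id : Module.End ℂ (VertexOperator ℂ V))) F = _
  rw [LoopAlgebra.toFinsupp_single_tmul, Finsupp.lsum_single, map_zero, zero_mul, zero_smul,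
    add_zero]
  rfl

theorem fieldActionₗ_central (φ : g →ₗ[ℂ] VertexOperator ℂ V) (k : ℂ)
    (F : VertexOperator ℂ V) :
    fieldActionₗ φ k (AffineLie.central : AffineLie g h) F = k • F := by
  change ((Finsupp.lsum ℂ (fun n : ℤ => nthProductₗ n ∘ₗ φ)
    (LoopAlgebra.toFinsupp ℂ ℤ g 0) +
      (TrivialLieModule.equiv ℂ (loopAlgebra ℂ ℤ g) ℂ
        ((TrivialLieModule.equiv ℂ (loopAlgebra ℂ ℤ g) ℂ).symm 1) * k) • LinearMap.id : Module.End ℂ (VertexOperator ℂ V))) F = _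
  rw [map_zero, map_zero, LinearEquiv.apply_symm_apply, one_mul, zero_add]
  rfl

theorem fieldActionₗ_lie (φ : g →ₗ[ℂ] VertexOperator ℂ V) (k : ℂ)
    (hφ : ∀ (x y : g) (m n : ℤ) (v : V),
      ((φ x)[[m]]) (((φ y)[[n]]) v) - ((φ y)[[n]]) (((φ x)[[m]]) v) =
        ((φ ⁅x, y⁆)[[m + n]]) v +
          (if m + n = 0 then (m : ℂ) * (normalizedForm g h x y * k) else 0) • v)
    (a b : AffineLie g h) (F : VertexOperator ℂ V) :
    fieldActionₗ φ k ⁅a, b⁆ F =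
      fieldActionₗ φ k a (fieldActionₗ φ k b F) - fieldActionₗ φ k b (fieldActionₗ φ k a F) := by
  induction a using AffineLie.induction_on with
  | central =>
    rw [AffineLie.central_lie, map_zero, fieldActionₗ_central, fieldActionₗ_central, map_smul,
      sub_self, LinearMap.zero_apply]
  | add a a' ha ha' =>
    simp only [add_lie, map_add, LinearMap.add_apply, ha, ha']
    abel
  | smul c a ha => simp only [smul_lie, map_smul, LinearMap.smul_apply, ha, smul_sub]
  | current x m =>
    induction b using AffineLie.induction_on with
    | central =>
      rw [← lie_skew, AffineLie.central_lie, neg_zero, map_zero, fieldActionₗ_central,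
        fieldActionₗ_central, map_smul, sub_self, LinearMap.zero_apply]
    | add b b' hb hb' =>
      simp only [lie_add, map_add, LinearMap.add_apply, hb, hb']
      abel
    | smul c b hb => simp only [lie_smul, map_smul, LinearMap.smul_apply, hb, smul_sub]
    | current y n =>
      rw [fieldActionₗ_current, fieldActionₗ_current, fieldActionₗ_current, fieldActionₗ_current,
        nthProduct_commutator (φ x) (φ y) (φ ⁅x, y⁆) F (normalizedForm g h x y * k) (hφ x y),
        AffineLie.lie_current, map_add, map_smul, LinearMap.add_apply, LinearMap.smul_apply,
        fieldActionₗ_current, fieldActionₗ_central, smul_smul, ite_mul, zero_mul, mul_assoc]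

/-- If the fields `φ x` satisfy the commutation relations of `ĝ` at level `k`, the residue products with
them make the space of all fields a `ĝ`-module. -/
def fieldAction (φ : g →ₗ[ℂ] VertexOperator ℂ V) (k : ℂ)
    (hφ : ∀ (x y : g) (m n : ℤ) (v : V),
      ((φ x)[[m]]) (((φ y)[[n]]) v) - ((φ y)[[n]]) (((φ x)[[m]]) v) =
        ((φ ⁅x, y⁆)[[m + n]]) v +
          (if m + n = 0 then (m : ℂ) * (normalizedForm g h x y * k) else 0) • v) :
    AffineLie g h →ₗ⁅ℂ⁆ Module.End ℂ (VertexOperator ℂ V) :=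
  { fieldActionₗ φ k with
    map_lie' := fun {a b} => LinearMap.ext (fieldActionₗ_lie φ k hφ a b) }

end FieldAction

namespace VertexOperator

variable {V : Type*} [AddCommGroup V] [Module ℂ V]

/-- The identity field `id_V`. -/
def identityField : VertexOperator ℂ V :=
  ofModes (fun n => if n = -1 then LinearMap.id else 0)
    fun v => ⟨0, fun n hn => by rw [if_neg (by lia)]; rfl⟩

theorem ncoeff_identityField (n : ℤ) (v : V) :
    (identityField[[n]]) v = if n = -1 then v else 0 := by
  rw [identityField, ncoeff_ofModes]
  split_ifs <;> rfl

theorem ncoeff_nthProduct_identityField (A : VertexOperator ℂ V) (n m : ℤ) (v : V) :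
    ((nthProduct A n identityField)[[m]]) v =
      (if m < 0 then signedChoose n (-1 - m).toNat • (A[[n + m + 1]]) v else 0) -
        (if 0 ≤ n + m + 1 then
          ((-1) ^ n * signedChoose n (n + m + 1).toNat) • (A[[n + m + 1]]) v else 0) := by
  obtain ⟨N, hN⟩ := exists_forall_ncoeff_eq_zero A v
  rw [nthProduct, ncoeff_sub_apply,
    ncoeff_outerProduct A n _ m v m.natAbs fun i hi => by
      rw [ncoeff_identityField, if_neg (by lia)],
    ncoeff_innerProduct A n _ m v (N + (n + m + 1).natAbs + 1) fun i hi => hN i (by lia)]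
  congr 1
  · split_ifs with hm
    · rw [Finset.sum_eq_single (-1 - m).toNat]
      · rw [ncoeff_identityField, if_pos (by lia)]
        rw [show n - ((-1 - m).toNat : ℤ) = n + m + 1 by lia]
      · intro j _ hj
        rw [ncoeff_identityField, if_neg (by lia), map_zero, smul_zero]
      · intro hj
        exact absurd (Finset.mem_range.mpr (by lia)) hj
    · refine Finset.sum_eq_zero fun j _ => ?_
      rw [ncoeff_identityField, if_neg (by lia), map_zero, smul_zero]
  · split_ifs with hm
    · rw [Finset.sum_eq_single (n + m + 1).toNat]
      · rw [ncoeff_identityField, if_pos (by lia), Int.toNat_of_nonneg hm]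
      · intro j _ hj
        rw [ncoeff_identityField, if_neg (by lia), smul_zero]
      · intro hj
        exact absurd (Finset.mem_range.mpr (by lia)) hj
    · refine Finset.sum_eq_zero fun j _ => ?_
      rw [ncoeff_identityField, if_neg (by lia), smul_zero]

theorem nthProduct_identityField (A : VertexOperator ℂ V) (n : ℕ) :
    nthProduct A n identityField = 0 := by
  refine ncoeff_injective fun m v => ?_
  rw [ncoeff_nthProduct_identityField, map_zero, Pi.zero_apply, LinearMap.zero_apply]
  have hz (t : ℕ) (ht : n < t) : signedChoose n t = 0 := by
    rw [signedChoose, Ring.choose_natCast, Nat.choose_eq_zero_of_lt ht]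
    simp
  by_cases h1 : m < 0
  · by_cases h2 : 0 ≤ (n : ℤ) + m + 1
    · obtain ⟨j, rfl⟩ : ∃ j : ℕ, m = -1 - j := ⟨(-1 - m).toNat, by lia⟩
      obtain ⟨i, rfl⟩ : ∃ i : ℕ, n = i + j := ⟨n - j, by lia⟩
      rw [if_pos h1, if_pos h2, sub_eq_zero]
      congr 1
      rw [show (-1 - (-1 - (j : ℤ))).toNat = j by lia,
        show (((i + j : ℕ) : ℤ) + (-1 - (j : ℤ)) + 1).toNat = i by lia, signedChoose, signedChoose,
        Ring.choose_natCast, Ring.choose_natCast, Nat.choose_symm_add, zpow_natCast, pow_add,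
        ← mul_assoc]
      congr 1
      rw [mul_right_comm, ← mul_pow]
      simp
    · rw [if_pos h1, if_neg h2, hz _ (by lia), zero_smul, sub_zero]
  · rw [if_neg h1, hz (n + m + 1).toNat (by lia), mul_zero, zero_smul, ite_self, sub_zero]

theorem nthProduct_neg_one_identityField (A : VertexOperator ℂ V) :
    nthProduct A (-1) identityField = A := by
  refine ncoeff_injective fun m v => ?_
  have hc (j : ℕ) : signedChoose (-1) j = 1 := by
    rw [signedChoose, Ring.choose_neg, show (1 : ℤ) + j - 1 = j by ring, Ring.choose_natCast,
      Nat.choose_self, Nat.cast_one, Int.negOnePow_def]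
    rcases Nat.even_or_odd j with hj | hj <;> simp [hj]
  rw [ncoeff_nthProduct_identityField, hc, hc]
  by_cases h : m < 0
  · rw [if_pos h, if_neg (by lia), one_smul, sub_zero]
    rw [show -1 + m + 1 = m by ring]
  · rw [if_neg h, if_pos (by lia), zero_sub]
    simp

end VertexOperator

namespace UniversalAffine

variable {g : Type*} [LieRing g] [LieAlgebra ℂ g] {h k : ℂ}

variable (g h k) in
/-- The vacuum vector `𝟏`. -/
def vacuum : UniversalAffine g h k :=
  proj 1

/-- The action of `ĝ` on `V^k(g)` by left multiplication. -/
def act (a : AffineLie g h) : Module.End ℂ (UniversalAffine g h k) :=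
  Algebra.lsmul ℂ ℂ (UniversalAffine g h k) (UniversalEnvelopingAlgebra.ι ℂ a)

theorem act_apply (a : AffineLie g h) (v : UniversalAffine g h k) :
    act a v = UniversalEnvelopingAlgebra.ι ℂ a • v := rfl

/-- The operator `x(n)` on `V^k(g)`. -/
def mode (x : g) (n : ℤ) : Module.End ℂ (UniversalAffine g h k) :=
  act (AffineLie.current x n)

theorem act_add (a b : AffineLie g h) :
    (act (a + b) : Module.End ℂ (UniversalAffine g h k)) = act a + act b := by
  simp [act]

theorem act_smul (c : ℂ) (a : AffineLie g h) :
    (act (c • a) : Module.End ℂ (UniversalAffine g h k)) = c • act a := by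
  simp [act]

theorem act_lie (a b : AffineLie g h) (v : UniversalAffine g h k) :
    act ⁅a, b⁆ v = act a (act b v) - act b (act a v) := by
  simp only [act_apply, LieHom.map_lie, LieRing.of_associative_ring_bracket, sub_smul, mul_smul]

theorem mode_vacuum (x : g) (n : ℕ) : mode x (n : ℤ) (vacuum g h k) = 0 := by
  rw [mode, act_apply, vacuum, ← map_smul, smul_eq_mul, mul_one, proj_eq_zero_iff]
  exact Submodule.subset_span (Or.inl ⟨(x, n), rfl⟩)

theorem subalgebra_eq_top (S : Subalgebra ℂ (UniversalEnvelopingAlgebra ℂ (AffineLie g h)))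
    (hS : ∀ a, UniversalEnvelopingAlgebra.ι ℂ a ∈ S) (u : UniversalEnvelopingAlgebra ℂ (AffineLie g h)) :
    u ∈ S := by
  let f : AffineLie g h →ₗ⁅ℂ⁆ S :=
    { toFun := fun a => ⟨UniversalEnvelopingAlgebra.ι ℂ a, hS a⟩
      map_add' := fun a b => Subtype.ext (map_add _ a b)
      map_smul' := fun c a => Subtype.ext (map_smul _ c a)
      map_lie' := fun {a b} => Subtype.ext (LieHom.map_lie _ a b) }
  have key : S.val.comp (UniversalEnvelopingAlgebra.lift ℂ f) = AlgHom.id ℂ _ := by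
    apply UniversalEnvelopingAlgebra.hom_ext
    ext a
    change ((UniversalEnvelopingAlgebra.lift ℂ f (UniversalEnvelopingAlgebra.ι ℂ a) : S) :
      UniversalEnvelopingAlgebra ℂ (AffineLie g h)) = UniversalEnvelopingAlgebra.ι ℂ a
    rw [UniversalEnvelopingAlgebra.lift_ι_apply]
    rfl
  have hu := DFunLike.congr_fun key u
  change ((UniversalEnvelopingAlgebra.lift ℂ f u : S) : _) = u at hu
  rw [← hu]
  exact Subtype.property _

theorem act_central (v : UniversalAffine g h k) : act AffineLie.central v = k • v := by
  obtain ⟨u, rfl⟩ := proj_surjective v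
  have hc : UniversalEnvelopingAlgebra.ι ℂ (AffineLie.central : AffineLie g h) * u =
      u * UniversalEnvelopingAlgebra.ι ℂ (AffineLie.central : AffineLie g h) := by
    have := subalgebra_eq_top (Subalgebra.centralizer ℂ
      {UniversalEnvelopingAlgebra.ι ℂ (AffineLie.central : AffineLie g h)}) (fun a => by
        rw [Subalgebra.mem_centralizer_iff]
        rintro _ rfl
        have := (UniversalEnvelopingAlgebra.ι ℂ).map_lie (AffineLie.central : AffineLie g h) a
        rw [AffineLie.central_lie, map_zero, LieRing.of_associative_ring_bracket] at this
        exact sub_eq_zero.mp this.symm) u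
    exact (Subalgebra.mem_centralizer_iff ℂ).mp this _ rfl
  rw [act_apply, ← map_smul, ← LinearMap.map_smul_of_tower, ← sub_eq_zero, ← map_sub, proj_eq_zero_iff,
    smul_eq_mul, hc, Algebra.smul_def, Algebra.commutes, ← mul_sub]
  exact Submodule.smul_mem _ _ (Submodule.subset_span (Or.inr rfl))

theorem submodule_eq_top (W : Submodule ℂ (UniversalAffine g h k)) (h1 : vacuum g h k ∈ W)
    (h2 : ∀ x n, ∀ v ∈ W, mode x n v ∈ W) (v : UniversalAffine g h k) : v ∈ W := by
  have h3 (a : AffineLie g h) : ∀ v ∈ W, act a v ∈ W := by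
    induction a using AffineLie.induction_on with
    | current x n => exact h2 x n
    | central => intro v hv; rw [act_central]; exact W.smul_mem _ hv
    | add a b ha hb => intro v hv; rw [act_add]; exact W.add_mem (ha v hv) (hb v hv)
    | smul c a ha => intro v hv; rw [act_smul]; exact W.smul_mem _ (ha v hv)
  obtain ⟨u, rfl⟩ := proj_surjective v
  let S : Subalgebra ℂ (UniversalEnvelopingAlgebra ℂ (AffineLie g h)) :=
    { carrier := {u | ∀ v ∈ W, u • v ∈ W}
      mul_mem' := fun {a b} ha hb v hv => by rw [mul_smul]; exact ha _ (hb v hv)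
      add_mem' := fun {a b} ha hb v hv => by rw [add_smul]; exact W.add_mem (ha v hv) (hb v hv)
      algebraMap_mem' := fun c v hv => by rw [algebraMap_smul]; exact W.smul_mem c hv }
  have h4 := subalgebra_eq_top S (fun a => h3 a) u _ h1
  rwa [vacuum, ← map_smul, smul_eq_mul, mul_one] at h4

theorem mode_commutator (x y : g) (m n : ℤ) (v : UniversalAffine g h k) :
    mode x m (mode y n v) - mode y n (mode x m v) =
      mode ⁅x, y⁆ (m + n) v +
        (if m + n = 0 then (m : ℂ) * (normalizedForm g h x y * k) else 0) • v := by
  simp only [mode]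
  rw [← act_lie, AffineLie.lie_current, act_add, act_smul, LinearMap.add_apply,
    LinearMap.smul_apply, act_central, smul_smul]
  congr 2
  split_ifs
  · ring
  · ring

theorem exists_forall_mode_eq_zero (x : g) (v : UniversalAffine g h k) :
    ∃ N : ℕ, ∀ n : ℤ, N ≤ n → mode x n v = 0 := by
  let W : Submodule ℂ (UniversalAffine g h k) :=
    { carrier := {v | ∀ x : g, ∃ N : ℕ, ∀ n : ℤ, N ≤ n → mode x n v = 0}
      zero_mem' := fun x => ⟨0, fun n _ => map_zero _⟩
      add_mem' := fun {v w} hv hw x => by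
        obtain ⟨N₁, h₁⟩ := hv x
        obtain ⟨N₂, h₂⟩ := hw x
        exact ⟨N₁ + N₂, fun n hn => by rw [map_add, h₁ n (by lia), h₂ n (by lia), add_zero]⟩
      smul_mem' := fun c v hv x => by
        obtain ⟨N, h⟩ := hv x
        exact ⟨N, fun n hn => by rw [map_smul, h n hn, smul_zero]⟩ }
  refine submodule_eq_top W (fun x => ⟨0, fun n hn => ?_⟩) (fun y m v hv x => ?_) v x
  · obtain ⟨j, rfl⟩ := Int.eq_ofNat_of_zero_le (by simpa using hn)
    exact mode_vacuum x j
  · obtain ⟨N₁, h₁⟩ := hv x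
    obtain ⟨N₂, h₂⟩ := hv ⁅x, y⁆
    refine ⟨N₁ + N₂ + m.natAbs + 1, fun n hn => ?_⟩
    have := mode_commutator x y n m v
    rw [h₁ n (by lia), h₂ (n + m) (by lia), if_neg (by lia), map_zero, zero_smul, sub_zero,
      add_zero] at this
    exact this

/-- The field `x(z) = ∑ x(n) z^{-n-1}`. -/
def field (x : g) : VertexOperator ℂ (UniversalAffine g h k) :=
  ofModes (mode x) (exists_forall_mode_eq_zero x)

theorem ncoeff_field (x : g) (n : ℤ) :
    (field x : VertexOperator ℂ (UniversalAffine g h k))[[n]] = mode x n :=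
  ncoeff_ofModes _ _ _

/-- The field `x(z)` as a linear function of `x`. -/
def fieldₗ : g →ₗ[ℂ] VertexOperator ℂ (UniversalAffine g h k) where
  toFun := field
  map_add' x y := ncoeff_injective fun n v => by
    rw [ncoeff_add_apply, ncoeff_field, ncoeff_field, ncoeff_field, mode, mode, mode,
      ← LinearMap.add_apply, ← act_add, AffineLie.current_add]
  map_smul' c x := ncoeff_injective fun n v => by
    rw [RingHom.id_apply, ncoeff_smul_apply, ncoeff_field, ncoeff_field, mode, mode,
      ← LinearMap.smul_apply, ← act_smul, AffineLie.current_smul]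


/-- The action of `ĝ` on fields on `V^k(g)`: `x tⁿ` acts by `F(z) ↦ x(z)_(n) F(z)`, `K` by `k`. -/
def actField :
    AffineLie g h →ₗ⁅ℂ⁆ Module.End ℂ (VertexOperator ℂ (UniversalAffine g h k)) :=
  fieldAction fieldₗ k fun x y m n v => by
    change ((field x)[[m]]) (((field y)[[n]]) v) - ((field y)[[n]]) (((field x)[[m]]) v) =
        ((field ⁅x, y⁆)[[m + n]]) v + _
    rw [ncoeff_field, ncoeff_field, ncoeff_field]
    exact mode_commutator x y m n v

theorem actField_current (x : g) (n : ℤ) (F : VertexOperator ℂ (UniversalAffine g h k)) :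
    actField (AffineLie.current x n) F = nthProduct (field x) n F :=
  fieldActionₗ_current fieldₗ k x n F

theorem actField_central (F : VertexOperator ℂ (UniversalAffine g h k)) :
    actField AffineLie.central F = k • F :=
  fieldActionₗ_central fieldₗ k F

/-- The action of `U(ĝ)` on fields. -/
def liftField : UniversalEnvelopingAlgebra ℂ (AffineLie g h) →ₐ[ℂ]
    Module.End ℂ (VertexOperator ℂ (UniversalAffine g h k)) :=
  UniversalEnvelopingAlgebra.lift ℂ actField

theorem liftField_ι (a : AffineLie g h) :
    (liftField (UniversalEnvelopingAlgebra.ι ℂ a) :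
      Module.End ℂ (VertexOperator ℂ (UniversalAffine g h k))) = actField a :=
  UniversalEnvelopingAlgebra.lift_ι_apply ℂ _ a

theorem liftField_eq_zero (u : UniversalEnvelopingAlgebra ℂ (AffineLie g h))
    (hu : u ∈ vacuumIdeal g h k) :
    (liftField u : Module.End ℂ (VertexOperator ℂ (UniversalAffine g h k))) identityField = 0 := by
  induction hu using Submodule.span_induction with
  | mem u hu =>
    rcases hu with ⟨⟨x, n⟩, rfl⟩ | rfl
    · rw [liftField_ι, actField_current, nthProduct_identityField]
    · rw [map_sub, LinearMap.sub_apply, liftField_ι, actField_central, AlgHom.commutes,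
        Module.algebraMap_end_apply, sub_self]
  | zero => rw [map_zero, LinearMap.zero_apply]
  | add u w _ _ hu hw => rw [map_add, LinearMap.add_apply, hu, hw, add_zero]
  | smul u w _ hw => rw [smul_eq_mul, map_mul, Module.End.mul_apply, hw, map_zero]

/-- The state-field correspondence `Y` of the vertex algebra `V^k(g)`, with `a_(n) = (Y a)[[n]]`. It is
the map determined by `Y(𝟏, z) = id` and `Y(x(n) v, z) = x(z)_(n) Y(v, z)`; in particular
`Y(x(-1) 𝟏, z) = x(z)`. -/
def stateField : UniversalAffine g h k →ₗ[ℂ] VertexOperator ℂ (UniversalAffine g h k) :=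
  Submodule.liftQ ((vacuumIdeal g h k).restrictScalars ℂ)
    (LinearMap.applyₗ identityField ∘ₗ liftField.toLinearMap)
    fun u hu => liftField_eq_zero u hu

theorem stateField_proj (u : UniversalEnvelopingAlgebra ℂ (AffineLie g h)) :
    stateField (proj u : UniversalAffine g h k) = liftField u identityField := rfl

theorem stateField_vacuum : stateField (vacuum g h k) = identityField := by
  rw [vacuum, stateField_proj, map_one, Module.End.one_apply]

theorem stateField_mode (x : g) (n : ℤ) (v : UniversalAffine g h k) :
    stateField (mode x n v) = nthProduct (field x) n (stateField v) := by
  obtain ⟨u, rfl⟩ := proj_surjective v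
  rw [mode, act_apply, ← map_smul, stateField_proj, stateField_proj, smul_eq_mul, map_mul,
    Module.End.mul_apply, liftField_ι, actField_current]

theorem stateField_generator (x : g) : stateField (mode x (-1) (vacuum g h k)) = field x := by
  rw [stateField_mode, stateField_vacuum, nthProduct_neg_one_identityField]

end UniversalAffine

/-! ### The C₂-algebra and the Li filtration of a vertex algebra with state-field map `Y` -/

section Zhu

variable {V : Type*} [AddCommGroup V] [Module ℂ V] (Y : V →ₗ[ℂ] VertexOperator ℂ V)

/-- `C₂(V)`, the span of all `a_(-2) b` with `a, b ∈ V`. -/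
def zhuC2 : Submodule ℂ V :=
  Submodule.span ℂ {u | ∃ a b : V, u = ((Y a)[[-2]]) b}

/-- The underlying vector space `R_V = V / C₂(V)` of the C₂-algebra of Zhu. -/
abbrev ZhuAlgebra : Type _ := V ⧸ zhuC2 Y

/-- The Li filtration: `F^p V` is the span of the vectors
`(a₁)_(-n₁-1) ⋯ (a_r)_(-n_r-1) b` with `r ≥ 0`, `aᵢ, b ∈ V`, `nᵢ ≥ 1` and `n₁ + ⋯ + n_r ≥ p`. The list
`l` holds the pairs `(aᵢ, nᵢ)`. -/
def liFiltration (p : ℕ) : Submodule ℂ V :=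
  Submodule.span ℂ {u | ∃ (l : List (V × ℕ)) (b : V), (∀ s ∈ l, 1 ≤ s.2) ∧
    p ≤ (l.map Prod.snd).sum ∧
    u = l.foldr (fun s w => ((Y s.1)[[-(s.2 : ℤ) - 1]]) w) b}

/-- The principal symbol of `v` for the Li filtration lies in `F^p V / F^{p+1} V`, that is,
`v ∈ F^p V` and `v ∉ F^{p+1} V`. -/
def HasDepth (v : V) (p : ℕ) : Prop :=
  v ∈ liFiltration Y p ∧ v ∉ liFiltration Y (p + 1)

end Zhu

/-! ### Highest root, dual Coxeter number, singular vectors -/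

section Roots

variable {g : Type*} [LieRing g] [LieAlgebra ℂ g] [FiniteDimensional ℂ g] [IsSimple ℂ g]
  {H : LieSubalgebra ℂ g} [H.IsCartanSubalgebra]

/-- `θ` is the highest root: its height with respect to the base `b` is maximal. -/
def IsHighestRoot (b : (IsKilling.rootSystem H).Base) (θ : H.root) : Prop :=
  ∀ α : H.root, b.height α ≤ b.height θ

/-- The dual Coxeter number `h^∨ = 1 + ⟨ρ, θ^∨⟩`, where `θ` is the highest root: one plus the sum of
the coefficients of the coroot `θ^∨` in the basis of simple coroots. -/
def dualCoxeterNumber (b : (IsKilling.rootSystem H).Base) (θ : H.root) : ℤ :=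
  1 + b.flip.height θ

/-- `v` is a singular vector for the action of `g[t]` on `V^k(g)`: `e_α(0) v = 0` for every positive
root `α`, and `f_θ(1) v = 0`. The root spaces are lines, spanned by `e_α` and `f_θ = e_{-θ}`. -/
def IsSingularVector (b : (IsKilling.rootSystem H).Base) (θ : H.root) {h k : ℂ}
    (v : UniversalAffine g h k) : Prop :=
  (∀ α : H.root, b.IsPos α → ∀ x ∈ rootSpace H (α.1 : H → ℂ), UniversalAffine.mode x 0 v = 0) ∧
    ∀ x ∈ rootSpace H (-(θ.1 : H → ℂ)), UniversalAffine.mode x 1 v = 0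

end Roots

end

/-! Put `κ = k + h` with `h` the dual Coxeter number, and let `x_a` be a basis of `g` of weight
vectors with dual basis `y_a`. The Sugawara operator `T = ∑_{j ≥ 0} ∑_a x_a(-1-j) y_a(j)` kills the
vacuum and satisfies `[T, x(-p)] = κ p x(-p-1)` for `p ≥ 0`, so it is `κ` times the translation
operator (`sugawara_mode`). A singular vector `v` is killed by `t g[t]` and by the positive root
vectors. Hence `T v = ∑ x_a(-1) y_a(0) v`, summed over the `x_a` in the Borel subalgebra only. The
theorem follows by comparing leading terms of the two sides in a PBW basis.

Monomials are written in the letters `x_a(-n-1)`. A Borel letter, `x_a(-1)` with `x_a` in the Borel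
subalgebra, has size 0; any other letter has size `2n+1`. The degree of a monomial is the total
weight and height of its non-Borel letters. On a monomial `M` the right side has leading term `∑
λ_M(a) x_a(-1) M` over the Cartan indices `a`, where `λ_M` is the weight of `M`. The left side is
`κ` times the derivation `shift` of the non-Borel letters, which keeps the degree and raises the
size by exactly 2. The errors have smaller height and no smaller size, or the same nonzero degree
and larger size, or size larger by at least 3 (`poly_sub_word_sort_mem`).

Suppose all monomials of `v` have positive size, and let `s` be the least size. The coefficients at
monomials `x_a(-1) M` show that no monomial of size at most `s + 2` has positive height and that
some monomial of size `s` has degree 0 (`exists_of_degree_ne_zero`). Among the latter, shift a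
non-Borel letter of largest exponent. The resulting monomial arises from one source only, through
the derivation, so its coefficient is a nonzero multiple of `κ`: a contradiction. So `v` has a
monomial in Borel letters alone (`exists_size_eq_zero`). But `C₂` and `F¹` lie in the span of words
with some letter `x(-n-1)`, `n ≥ 1` (`ncoeff_stateField_mem_deep`), and such words involve only
monomials of positive size (`poly_word_mem`).

Linear independence of the ordered monomials comes from constructing the induced module on
polynomials (`comm_single`). The dual Coxeter number matters only through `h ≠ 0` and `κ ≠ 0`: for
the Killing form divided by `2h`, the Casimir element acts on `g` by `2h` whatever `h` is. -/

set_option linter.unusedSectionVars false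

noncomputable section

attribute [local instance 100] LieRing.ofAssociativeRing

/-! ### Induced modules on polynomials: the Poincaré–Birkhoff–Witt argument. -/

namespace InducedModule

open Finsupp

variable {R L I : Type*} [CommRing R] [LieRing L] [LieAlgebra R L] [LinearOrder I]

/-- Commutative multiplication by the image of an element of `L` in the span of the variables. -/
def mulVar (coord : L →ₗ[R] I →₀ R) (M : Multiset I) : L →ₗ[R] Multiset I →₀ R :=
  lmapDomain R R (fun i => i ::ₘ M) ∘ₗ coord

/-- The part of `y` with coordinates at indices `> j`. -/
def cut (x : I → L) (coord : L →ₗ[R] I →₀ R) (j : I) : L →ₗ[R] L :=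
  LinearMap.id - linearCombination R x ∘ₗ
    (supported R R {i | i ≤ j}).subtype ∘ₗ restrictDom R R {i | i ≤ j} ∘ₗ coord

/-- The bilinear map `L × R[I] → R[I]` given by multiplication plus a correction term. -/
def opOf (coord : L →ₗ[R] I →₀ R) (C : Multiset I → L →ₗ[R] Multiset I →₀ R) :
    (Multiset I →₀ R) →ₗ[R] L →ₗ[R] Multiset I →₀ R :=
  linearCombination R fun M => mulVar coord M + C M

/-- The correction terms, correct on multisets of cardinality at most the first argument. -/
def corrAux (x : I → L) (coord : L →ₗ[R] I →₀ R) (χ : L →ₗ[R] R) :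
    ℕ → Multiset I → L →ₗ[R] Multiset I →₀ R
  -- At stage 0 only the empty monomial matters; the value at the others is a default.
  | 0, _ => LinearMap.toSpanSingleton R _ (single 0 1) ∘ₗ χ
  | n + 1, M =>
    match M.sort (· ≤ ·) with
    | [] => LinearMap.toSpanSingleton R _ (single 0 1) ∘ₗ χ
    | j :: l =>
      -- The rule `a x_j N = x_j a N + [a, x_j] N` for the least letter `j`, without its leading
      -- part, applied to the component of `a` beyond `j`. The `x i` with `i ≤ j` act by
      -- multiplication and need no correction.
      (opOf coord (corrAux x coord χ n)).flip (x j) ∘ₗ corrAux x coord χ n (l : Multiset I) ∘ₗ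
          cut x coord j +
        opOf coord (corrAux x coord χ n) (single (l : Multiset I) 1) ∘ₗ
          (-(LieAlgebra.ad R L (x j) : L →ₗ[R] L)) ∘ₗ cut x coord j

variable (x : I → L) (coord : L →ₗ[R] I →₀ R) (χ : L →ₗ[R] R)

theorem opOf_single (C : Multiset I → L →ₗ[R] Multiset I →₀ R) (M : Multiset I) (a : L) :
    opOf coord C (single M 1) a = mulVar coord M a + C M a := by
  simp [opOf]

theorem corrAux_zero (n : ℕ) (a : L) : corrAux x coord χ n 0 a = χ a • single 0 1 := by
  cases n <;> simp [corrAux]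

theorem sort_cons {j : I} {N : Multiset I} (h : ∀ i ∈ N, j ≤ i) :
    (j ::ₘ N).sort (· ≤ ·) = j :: N.sort (· ≤ ·) :=
  Multiset.sort_cons _ _ _ h

theorem corrAux_cons (n : ℕ) {j : I} {N : Multiset I} (h : ∀ i ∈ N, j ≤ i) (a : L) :
    corrAux x coord χ (n + 1) (j ::ₘ N) a =
      opOf coord (corrAux x coord χ n) (corrAux x coord χ n N (cut x coord j a)) (x j) +
      opOf coord (corrAux x coord χ n) (single N 1) ⁅cut x coord j a, x j⁆ := by
  rw [corrAux]
  simp only [sort_cons h, Multiset.sort_eq]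
  simp only [LinearMap.add_apply, LinearMap.comp_apply, LinearMap.flip_apply, LinearMap.neg_apply]
  rw [show (LieAlgebra.ad R L (x j) : L →ₗ[R] L) (cut x coord j a) = ⁅x j, cut x coord j a⁆ from rfl,
    lie_skew]

/-- Polynomials of degree at most `n`. -/
def degLE (R I : Type*) [CommRing R] (n : ℕ) : Submodule R (Multiset I →₀ R) :=
  supported R R {M | M.card ≤ n}

theorem degLE_mono {m n : ℕ} (h : m ≤ n) : degLE R I m ≤ degLE R I n :=
  supported_mono fun _ hM => le_trans hM h

theorem degLE_induction {n : ℕ} {p : (Multiset I →₀ R) → Prop} (h0 : p 0)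
    (hadd : ∀ f g, p f → p g → p (f + g)) (hsmul : ∀ (c : R) f, p f → p (c • f))
    (hs : ∀ M : Multiset I, M.card ≤ n → p (single M 1)) {f : Multiset I →₀ R}
    (hf : f ∈ degLE R I n) : p f := by
  rw [degLE, supported_eq_span_single] at hf
  induction hf using Submodule.span_induction with
  | mem f hf =>
    obtain ⟨M, hM, rfl⟩ := hf
    exact hs M hM
  | zero => exact h0
  | add f g _ _ hf hg => exact hadd f g hf hg
  | smul c f _ hf => exact hsmul c f hf

theorem mulVar_mem (M : Multiset I) (a : L) : mulVar coord M a ∈ degLE R I (M.card + 1) := by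
  rw [mulVar, LinearMap.comp_apply]
  induction coord a using Finsupp.induction_linear with
  | zero => simp
  | add f g hf hg => rw [map_add]; exact add_mem hf hg
  | single i c =>
    rw [lmapDomain_apply, mapDomain_single]
    exact single_mem_supported R _ (by simp)

theorem opOf_mem {C : Multiset I → L →ₗ[R] Multiset I →₀ R} {n : ℕ}
    (hC : ∀ M : Multiset I, M.card ≤ n → ∀ a, C M a ∈ degLE R I M.card)
    {f : Multiset I →₀ R} (hf : f ∈ degLE R I n) (a : L) : opOf coord C f a ∈ degLE R I (n + 1) := by
  refine degLE_induction (p := fun f => opOf coord C f a ∈ degLE R I (n + 1)) ?_ ?_ ?_ ?_ hf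
  · simp
  · intro f g hf hg
    rw [map_add, LinearMap.add_apply]
    exact add_mem hf hg
  · intro c f hf
    rw [map_smul, LinearMap.smul_apply]
    exact Submodule.smul_mem _ c hf
  · intro M hM
    rw [opOf_single]
    exact add_mem (degLE_mono (by lia) (mulVar_mem coord M a))
      (degLE_mono (by lia) (hC M hM a))

theorem opOf_congr {C C' : Multiset I → L →ₗ[R] Multiset I →₀ R} {n : ℕ}
    (hC : ∀ M : Multiset I, M.card ≤ n → C M = C' M)
    {f : Multiset I →₀ R} (hf : f ∈ degLE R I n) : opOf coord C f = opOf coord C' f := by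
  refine degLE_induction (p := fun f => opOf coord C f = opOf coord C' f) ?_ ?_ ?_ ?_ hf
  · simp
  · intro f g hf hg
    rw [map_add, map_add, hf, hg]
  · intro c f hf
    rw [map_smul, map_smul, hf]
  · intro M hM
    ext1 a
    rw [opOf_single, opOf_single, hC M hM]

theorem exists_cons_of_ne_zero {M : Multiset I} (h : M ≠ 0) :
    ∃ (j : I) (N : Multiset I), M = j ::ₘ N ∧ ∀ i ∈ N, j ≤ i := by
  have h1 : M.toFinset.Nonempty := by
    rwa [Multiset.toFinset_nonempty]
  have h2 : M.toFinset.min' h1 ∈ M := Multiset.mem_toFinset.mp (Finset.min'_mem _ _)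
  refine ⟨_, M.erase _, (Multiset.cons_erase h2).symm, fun i hi => Finset.min'_le _ _ ?_⟩
  exact Multiset.mem_toFinset.mpr (Multiset.mem_of_mem_erase hi)

/-- The recursion calls the previous stage only on polynomials of degree at most `n`, and this needs
the degree bound. Hence both claims are carried through one induction. -/
theorem corrAux_stable (n : ℕ) : ∀ M : Multiset I, M.card ≤ n →
    (∀ a, corrAux x coord χ n M a ∈ degLE R I M.card) ∧
      corrAux x coord χ (n + 1) M = corrAux x coord χ n M := by
  induction n with
  | zero =>
    intro M hM
    obtain rfl : M = 0 := by simpa using hM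
    refine ⟨fun a => ?_, LinearMap.ext fun a => ?_⟩
    · rw [corrAux_zero]
      exact Submodule.smul_mem _ _ (single_mem_supported R _ (by simp))
    · rw [corrAux_zero, corrAux_zero]
  | succ n ih =>
    intro M hM
    by_cases h0 : M = 0
    · subst h0
      refine ⟨fun a => ?_, LinearMap.ext fun a => ?_⟩
      · rw [corrAux_zero]
        exact Submodule.smul_mem _ _ (single_mem_supported R _ (by simp))
      · rw [corrAux_zero, corrAux_zero]
    · obtain ⟨j, N, rfl, hj⟩ := exists_cons_of_ne_zero h0
      have hN : N.card ≤ n := by simpa using hM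
      have hd : ∀ a, corrAux x coord χ n N a ∈ degLE R I n := fun a =>
        degLE_mono hN ((ih N hN).1 a)
      have hs : single N (1 : R) ∈ degLE R I N.card := single_mem_supported R _ (by simp)
      refine ⟨fun a => ?_, LinearMap.ext fun a => ?_⟩
      · rw [corrAux_cons x coord χ n hj, Multiset.card_cons]
        refine add_mem (opOf_mem coord (fun M' hM' => (ih M' (hM'.trans hN)).1) ((ih N hN).1 _) _)
          (opOf_mem coord (fun M' hM' => (ih M' (hM'.trans hN)).1) hs _)
      · rw [corrAux_cons x coord χ n hj, corrAux_cons x coord χ (n + 1) hj, (ih N hN).2,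
          opOf_congr coord (fun M' hM' => (ih M' hM').2) (hd _),
          opOf_congr coord (fun M' hM' => (ih M' hM').2) (degLE_mono hN hs)]

/-- The correction terms. -/
def corr (M : Multiset I) : L →ₗ[R] Multiset I →₀ R := corrAux x coord χ M.card M

theorem corrAux_eq_corr {n : ℕ} {M : Multiset I} (h : M.card ≤ n) :
    corrAux x coord χ n M = corr x coord χ M := by
  induction n, h using Nat.le_induction with
  | base => rfl
  | succ n h ih => rw [(corrAux_stable x coord χ n M h).2, ih]

theorem corr_mem (M : Multiset I) (a : L) : corr x coord χ M a ∈ degLE R I M.card :=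
  (corrAux_stable x coord χ _ M le_rfl).1 a

theorem corr_zero (a : L) : corr x coord χ 0 a = χ a • single 0 1 := corrAux_zero x coord χ _ a

/-- The action of `a ∈ L` on `R[I]`. -/
def act (a : L) (f : Multiset I →₀ R) : Multiset I →₀ R := opOf coord (corr x coord χ) f a

theorem act_add_left (a b : L) (f : Multiset I →₀ R) :
    act x coord χ (a + b) f = act x coord χ a f + act x coord χ b f := map_add _ _ _

theorem act_smul_left (c : R) (a : L) (f : Multiset I →₀ R) :
    act x coord χ (c • a) f = c • act x coord χ a f := map_smul _ _ _

theorem act_add (a : L) (f f' : Multiset I →₀ R) :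
    act x coord χ a (f + f') = act x coord χ a f + act x coord χ a f' := by
  simp [act]

theorem act_smul (c : R) (a : L) (f : Multiset I →₀ R) :
    act x coord χ a (c • f) = c • act x coord χ a f := by
  simp [act]

theorem act_zero (a : L) : act x coord χ a 0 = 0 := by simp [act]

theorem act_zero_left (f : Multiset I →₀ R) : act x coord χ (0 : L) f = 0 := map_zero _

theorem act_single (a : L) (M : Multiset I) :
    act x coord χ a (single M 1) = mulVar coord M a + corr x coord χ M a :=
  opOf_single ..

theorem corr_cons {j : I} {N : Multiset I} (h : ∀ i ∈ N, j ≤ i) (a : L) :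
    corr x coord χ (j ::ₘ N) a =
      act x coord χ (x j) (corr x coord χ N (cut x coord j a)) +
      act x coord χ ⁅cut x coord j a, x j⁆ (single N 1) := by
  have hs : single N (1 : R) ∈ degLE R I N.card := single_mem_supported R _ (by simp)
  rw [corr, Multiset.card_cons, corrAux_cons x coord χ _ h, act, act,
    opOf_congr coord (fun M' hM' => corrAux_eq_corr x coord χ hM') hs,
    corrAux_eq_corr x coord χ le_rfl,
    opOf_congr coord (fun M' hM' => corrAux_eq_corr x coord χ hM') (corr_mem ..)]


variable {x coord χ}

theorem cut_x_of_le (hx : ∀ i, coord (x i) = single i 1) {i j : I} (h : i ≤ j) :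
    cut x coord j (x i) = 0 := by
  simp only [cut, LinearMap.sub_apply, LinearMap.comp_apply, hx, LinearMap.id_apply,
    Submodule.subtype_apply, restrictDom_apply]
  rw [filter_single_of_pos (fun i => i ∈ {i | i ≤ j}) h]
  simp

theorem cut_eq_self {j : I} {a : L} (h : ∀ i ≤ j, coord a i = 0) : cut x coord j a = a := by
  simp only [cut, LinearMap.sub_apply, LinearMap.comp_apply, LinearMap.id_apply,
    Submodule.subtype_apply, restrictDom_apply]
  rw [(filter_eq_zero_iff (fun i => i ∈ {i | i ≤ j}) _).mpr h]
  simp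

theorem coord_cut (hx : ∀ i, coord (x i) = single i 1) {i j : I} (h : i ≤ j) (a : L) :
    coord (cut x coord j a) i = 0 := by
  have h1 (f : I →₀ R) : coord (linearCombination R x f) = f := by
    induction f using Finsupp.induction_linear with
    | zero => simp
    | add f g hf hg => rw [map_add, map_add, hf, hg]
    | single i c => simp [hx]
  simp only [cut, LinearMap.sub_apply, LinearMap.comp_apply, LinearMap.id_apply, map_sub, h1,
    Submodule.subtype_apply, restrictDom_apply, Finsupp.sub_apply]
  rw [filter_apply_pos (fun i => i ∈ {i | i ≤ j}) _ h, sub_self]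

/-- Every element is a combination of the `x i`, `i ≤ j`, and an element without such components. -/
theorem induction_cut (j : I) {p : L → Prop} (hadd : ∀ a b, p a → p b → p (a + b))
    (hsmul : ∀ (c : R) a, p a → p (c • a)) (hle : ∀ i ≤ j, p (x i))
    (hcut : ∀ a, p (cut x coord j a)) (a : L) : p a := by
  have h1 : a = linearCombination R x ((supported R R {i | i ≤ j}).subtype
      (restrictDom R R {i | i ≤ j} (coord a))) + cut x coord j a := by
    simp [cut]
  have h0 : p 0 := by simpa using hsmul 0 _ (hle j le_rfl)
  have key (f : I →₀ R) (hf : f ∈ supported R R {i | i ≤ j}) : p (linearCombination R x f) := by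
    rw [supported_eq_span_single] at hf
    induction hf using Submodule.span_induction with
    | mem f hf =>
      obtain ⟨i, hi, rfl⟩ := hf
      simpa using hle i hi
    | zero => simpa using h0
    | add f g _ _ hf hg => rw [map_add]; exact hadd _ _ hf hg
    | smul c f _ hf => rw [map_smul]; exact hsmul _ _ hf
  rw [h1]
  exact hadd _ _ (key _ (Subtype.property _)) (hcut a)

/-- The least letter `l` of a nonempty `N` satisfies `j ≤ l`, so the cut at `l` removes `x j`
altogether. -/
theorem corr_x (hx : ∀ i, coord (x i) = single i 1) (hχ : ∀ i, χ (x i) = 0) {j : I}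
    {N : Multiset I} (h : ∀ i ∈ N, j ≤ i) : corr x coord χ N (x j) = 0 := by
  by_cases h0 : N = 0
  · subst h0
    rw [corr_zero, hχ, zero_smul]
  · obtain ⟨l, N, rfl, hl⟩ := exists_cons_of_ne_zero h0
    rw [corr_cons x coord χ hl, cut_x_of_le hx (h l (Multiset.mem_cons_self _ _))]
    simp [act]

theorem act_x (hx : ∀ i, coord (x i) = single i 1) (hχ : ∀ i, χ (x i) = 0) {j : I}
    {N : Multiset I} (h : ∀ i ∈ N, j ≤ i) :
    act x coord χ (x j) (single N 1) = single (j ::ₘ N) 1 := by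
  rw [act_single, corr_x hx hχ h, add_zero, mulVar, LinearMap.comp_apply, hx, lmapDomain_apply,
    mapDomain_single]

/-- All letters of the product `a N` are at least `j`, so `x j` multiplies it without correction. -/
theorem act_mulVar (hx : ∀ i, coord (x i) = single i 1) (hχ : ∀ i, χ (x i) = 0) {j : I}
    {N : Multiset I} (h : ∀ i ∈ N, j ≤ i) {a : L} (ha : ∀ i ≤ j, coord a i = 0) :
    act x coord χ (x j) (mulVar coord N a) = mulVar coord (j ::ₘ N) a := by
  rw [mulVar, mulVar, LinearMap.comp_apply, LinearMap.comp_apply]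
  have hf : coord a ∈ supported R R {i | j ≤ i} := by
    rw [mem_supported']
    intro i hi
    exact ha i (le_of_not_ge hi)
  generalize coord a = f at hf
  rw [supported_eq_span_single] at hf
  induction hf using Submodule.span_induction with
  | mem f hf =>
    obtain ⟨i, hi, rfl⟩ := hf
    simp only [lmapDomain_apply, mapDomain_single]
    rw [act_x hx hχ, Multiset.cons_swap]
    intro m hm
    rcases Multiset.mem_cons.mp hm with rfl | hm
    · exact hi
    · exact h m hm
  | zero => simp [act_zero]
  | add f g _ _ hf hg => rw [map_add, map_add, act_add, hf, hg]
  | smul c f _ hf => rw [map_smul, map_smul, act_smul, hf]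

/-- The corrections are defined so as to make this hold: the leading parts agree by `act_mulVar`. -/
theorem act_cons (hx : ∀ i, coord (x i) = single i 1) (hχ : ∀ i, χ (x i) = 0) {j : I}
    {N : Multiset I} (h : ∀ i ∈ N, j ≤ i) {a : L} (ha : ∀ i ≤ j, coord a i = 0) :
    act x coord χ a (single (j ::ₘ N) 1) =
      act x coord χ (x j) (act x coord χ a (single N 1)) +
        act x coord χ ⁅a, x j⁆ (single N 1) := by
  rw [act_single, corr_cons x coord χ h, cut_eq_self ha, act_single x coord χ a N, act_add,
    act_mulVar hx hχ h ha, add_assoc]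

/-- The commutation relation of `a` and `b` holds on `f`. -/
def Comm (x : I → L) (coord : L →ₗ[R] I →₀ R) (χ : L →ₗ[R] R) (a b : L)
    (f : Multiset I →₀ R) : Prop :=
  act x coord χ a (act x coord χ b f) =
    act x coord χ b (act x coord χ a f) + act x coord χ ⁅a, b⁆ f

theorem Comm.symm {a b : L} {f : Multiset I →₀ R} (h : Comm x coord χ a b f) :
    Comm x coord χ b a f := by
  rw [Comm, h, ← lie_skew b a, ← neg_one_smul R ⁅a, b⁆, act_smul_left]
  simp

theorem Comm.add_left {a a' b : L} {f : Multiset I →₀ R} (h : Comm x coord χ a b f)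
    (h' : Comm x coord χ a' b f) : Comm x coord χ (a + a') b f := by
  rw [Comm] at *
  rw [act_add_left, h, h', act_add_left, act_add, add_lie, act_add_left]
  abel

theorem Comm.smul_left {a b : L} {f : Multiset I →₀ R} (c : R) (h : Comm x coord χ a b f) :
    Comm x coord χ (c • a) b f := by
  rw [Comm] at *
  rw [act_smul_left, h, act_smul_left, act_smul, smul_lie, act_smul_left, smul_add]

theorem Comm.self (a : L) (f : Multiset I →₀ R) : Comm x coord χ a a f := by
  rw [Comm, lie_self, act_zero_left, add_zero]

theorem comm_of_degLE {n : ℕ} {a b : L} (h : ∀ M : Multiset I, M.card ≤ n →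
    Comm x coord χ a b (single M 1)) {f : Multiset I →₀ R} (hf : f ∈ degLE R I n) :
    Comm x coord χ a b f := by
  refine degLE_induction (p := Comm x coord χ a b) ?_ ?_ ?_ h hf
  · simp [Comm, act_zero]
  · intro f g hf hg
    rw [Comm] at *
    rw [act_add, act_add, hf, hg, act_add, act_add, act_add]
    abel
  · intro c f hf
    rw [Comm] at *
    rw [act_smul, act_smul, hf, act_smul, act_smul, act_smul, smul_add]

theorem comm_of_mulVar {N : Multiset I} {a b c : L} {j : I} (hc : ∀ i ≤ j, coord c i = 0)
    (h : ∀ i, j ≤ i → Comm x coord χ a b (single (i ::ₘ N) 1)) :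
    Comm x coord χ a b (mulVar coord N c) := by
  rw [mulVar, LinearMap.comp_apply]
  have hf : coord c ∈ supported R R {i | j ≤ i} := by
    rw [mem_supported']
    intro i hi
    exact hc i (le_of_not_ge hi)
  generalize coord c = f at hf
  rw [supported_eq_span_single] at hf
  induction hf using Submodule.span_induction with
  | mem f hf =>
    obtain ⟨i, hi, rfl⟩ := hf
    simp only [lmapDomain_apply, mapDomain_single]
    exact h i hi
  | zero => simp [Comm, act_zero]
  | add f g _ _ hf hg =>
    rw [Comm] at *
    rw [map_add, act_add, act_add, hf, hg, act_add, act_add, act_add]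
    abel
  | smul c f _ hf =>
    rw [Comm] at *
    rw [map_smul, act_smul, act_smul, hf, act_smul, act_smul, act_smul, smul_add]

theorem comm_x (hx : ∀ i, coord (x i) = single i 1) (hχ : ∀ i, χ (x i) = 0) {j : I}
    {N : Multiset I} (h : ∀ i ∈ N, j ≤ i) {a : L} (ha : ∀ i ≤ j, coord a i = 0) :
    Comm x coord χ a (x j) (single N 1) := by
  rw [Comm, act_x hx hχ h, act_cons hx hχ h ha]

theorem comm_x_x (hx : ∀ i, coord (x i) = single i 1) (hχ : ∀ i, χ (x i) = 0) {i j : I}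
    {N : Multiset I} (hi : ∀ m ∈ N, i ≤ m) (hj : ∀ m ∈ N, j ≤ m) :
    Comm x coord χ (x i) (x j) (single N 1) := by
  rcases lt_trichotomy i j with h | rfl | h
  · refine (comm_x hx hχ hi fun m hm => ?_).symm
    rw [hx, single_eq_of_ne (by rintro rfl; exact absurd hm (not_le.mpr h))]
  · exact Comm.self _ _
  · refine comm_x hx hχ hj fun m hm => ?_
    rw [hx, single_eq_of_ne (by rintro rfl; exact absurd hm (not_le.mpr h))]

/-- Induction on the degree. By bilinearity each of `a` and `b` is either some `x i` with `i` at
most the least letter `l`, or has no coordinates up to `l`. If one is of the first kind, the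
relation is the defining rule `comm_x`, up to symmetry. If both are of the second kind, expanding at
`l` reduces it to the Jacobi identity and to lower degree. -/
theorem comm_single (hx : ∀ i, coord (x i) = single i 1) (hχ : ∀ i, χ (x i) = 0)
    (hker : ∀ a b, coord a = 0 → coord b = 0 → coord ⁅a, b⁆ = 0 ∧ χ ⁅a, b⁆ = 0) (n : ℕ) :
    ∀ (M : Multiset I), M.card ≤ n → ∀ a b : L, Comm x coord χ a b (single M 1) := by
  induction n with
  | zero =>
    intro M hM a b
    obtain rfl : M = 0 := by simpa using hM
    -- The empty monomial has no least letter, so here `L` is split into the span of all `x i` and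
    -- the kernel of `coord`.
    have hdec (p : L → Prop) (hadd : ∀ a b, p a → p b → p (a + b))
        (hsmul : ∀ (c : R) a, p a → p (c • a)) (h1 : ∀ i, p (x i)) (h2 : ∀ a, coord a = 0 → p a)
        (a : L) : p a := by
      have h3 (f : I →₀ R) : p (linearCombination R x f) ∧ coord (linearCombination R x f) = f := by
        induction f using Finsupp.induction_linear with
        | zero => simpa using h2 0 (map_zero _)
        | add f g hf hg =>
          rw [map_add, map_add, hf.2, hg.2]
          exact ⟨hadd _ _ hf.1 hg.1, rfl⟩
        | single i c =>
          rw [linearCombination_single, map_smul, hx]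
          exact ⟨hsmul _ _ (h1 i), by simp⟩
      have h4 := hadd _ _ (h3 (coord a)).1 (h2 (a - linearCombination R x (coord a))
        (by rw [map_sub, (h3 _).2, sub_self]))
      rwa [add_sub_cancel] at h4
    refine hdec (fun a => Comm x coord χ a b (single 0 1)) (fun _ _ => Comm.add_left)
      (fun c _ h => h.smul_left c) (fun i => Comm.symm ?_) (fun a ha => Comm.symm ?_) a
    · refine hdec (fun b => Comm x coord χ b (x i) (single 0 1)) (fun _ _ => Comm.add_left)
        (fun c _ h => h.smul_left c) (fun j => ?_) (fun b hb => ?_) b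
      · exact comm_x_x hx hχ (by simp) (by simp)
      · exact comm_x hx hχ (by simp) fun m _ => by rw [hb]; rfl
    · refine hdec (fun b => Comm x coord χ b a (single 0 1)) (fun _ _ => Comm.add_left)
        (fun c _ h => h.smul_left c) (fun j => ?_) (fun b hb => ?_) b
      · exact (comm_x hx hχ (by simp) fun m _ => by rw [ha]; rfl).symm
      -- The kernel acts on the monomial `1` by scalars, which commute; `hker` makes the bracket act
      -- by zero.
      · have key (c : L) (hc : coord c = 0) :
            act x coord χ c (single 0 1) = χ c • single 0 1 := by
          rw [act_single, corr_zero, mulVar, LinearMap.comp_apply, hc, map_zero, zero_add]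
        obtain ⟨h1, h2⟩ := hker b a hb ha
        rw [Comm, key a ha, key b hb, act_smul, act_smul, key a ha, key b hb, key _ h1, h2,
          zero_smul, add_zero, smul_comm]
  | succ n ih =>
    intro M hM
    by_cases h0 : M = 0
    · subst h0
      exact ih 0 (by simp)
    · obtain ⟨l, P, rfl, hl⟩ := exists_cons_of_ne_zero h0
      have hP : P.card ≤ n := by simpa using hM
      have hl' : ∀ m ∈ l ::ₘ P, l ≤ m := fun m hm => by
        rcases Multiset.mem_cons.mp hm with rfl | hm
        · exact le_rfl
        · exact hl m hm
      have hlow (i : I) (hi : i ≤ l) : ∀ m ∈ l ::ₘ P, i ≤ m := fun m hm => hi.trans (hl' m hm)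
      intro a b
      refine induction_cut (x := x) (coord := coord) l
        (p := fun a => Comm x coord χ a b _) (fun _ _ => Comm.add_left)
        (fun c _ h => h.smul_left c) (fun i hi => Comm.symm ?_) (fun a => Comm.symm ?_) a
      · refine induction_cut (x := x) (coord := coord) l
          (p := fun b => Comm x coord χ b (x i) _) (fun _ _ => Comm.add_left)
          (fun c _ h => h.smul_left c) (fun j hj => ?_) (fun b => ?_) b
        · exact comm_x_x hx hχ (hlow j hj) (hlow i hi)
        · exact comm_x hx hχ (hlow i hi) fun m hm => coord_cut hx (hm.trans hi) b
      · refine induction_cut (x := x) (coord := coord) l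
          (p := fun b => Comm x coord χ b _ _) (fun _ _ => Comm.add_left)
          (fun c _ h => h.smul_left c) (fun j hj => ?_) (fun b => ?_) b
        · exact (comm_x hx hχ (hlow j hj) fun m hm => coord_cut hx (hm.trans hj) a).symm
        · have ha : ∀ i ≤ l, coord (cut x coord l a) i = 0 := fun i hi => coord_cut hx hi a
          have hb : ∀ i ≤ l, coord (cut x coord l b) i = 0 := fun i hi => coord_cut hx hi b
          generalize cut x coord l a = a at ha
          generalize cut x coord l b = b at hb
          -- In this expansion the two middle terms are exchanged when `a` and `b` are, so they
          -- cancel in the commutator.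
          have half (a b : L) (ha : ∀ i ≤ l, coord a i = 0) (hb : ∀ i ≤ l, coord b i = 0) :
              act x coord χ a (act x coord χ b (single (l ::ₘ P) 1)) =
                act x coord χ (x l) (act x coord χ a (act x coord χ b (single P 1))) +
                act x coord χ ⁅a, x l⁆ (act x coord χ b (single P 1)) +
                act x coord χ ⁅b, x l⁆ (act x coord χ a (single P 1)) +
                act x coord χ ⁅a, ⁅b, x l⁆⁆ (single P 1) := by
            -- The polynomial `b P` has one degree too many for the induction hypothesis. Its top
            -- part has only letters at least `l` and falls under `comm_x`; the correction has
            -- degree at most that of `P`.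
            have h1 : Comm x coord χ a (x l) (act x coord χ b (single P 1)) := by
              have h2 : Comm x coord χ a (x l) (mulVar coord P b) := by
                refine comm_of_mulVar hb fun i hi => comm_x hx hχ (fun m hm => ?_) ha
                rcases Multiset.mem_cons.mp hm with rfl | hm
                · exact hi
                · exact hl m hm
              have h3 : Comm x coord χ a (x l) (corr x coord χ P b) :=
                comm_of_degLE (fun M hM => ih M (hM.trans hP) a (x l)) (corr_mem ..)
              rw [Comm] at *
              rw [act_single x coord χ b P, act_add, act_add, h2, h3, act_add, act_add, act_add]
              abel
            have h4 := ih P hP a ⁅b, x l⁆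
            rw [Comm] at h1 h4
            rw [act_cons hx hχ hl hb, act_add, h1, h4]
            abel
          have h5 := ih P hP ⁅b, a⁆ (x l)
          have h6 := ih P hP b a
          rw [Comm] at *
          rw [half b a hb ha, half a b ha hb, h6, act_add, ← act_x hx hχ hl, h5]
          rw [show ⁅b, ⁅a, x l⁆⁆ = ⁅a, ⁅b, x l⁆⁆ + ⁅⁅b, a⁆, x l⁆ by
            rw [leibniz_lie b a, add_comm], act_add_left]
          abel

/-- **Induced modules exist.** Let `x i` be independent elements of `L` such that a complement of their
span, the kernel of `coord`, is a subalgebra with a character `χ`. There is an `L`-module with basis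
the monomials `M` in the `x i`, such that `x i • M = x i M` whenever `i` is at most every factor of
`M`, and such that the subalgebra acts on the monomial `1` by `χ`. -/
def rep (hx : ∀ i, coord (x i) = single i 1) (hχ : ∀ i, χ (x i) = 0)
    (hker : ∀ a b, coord a = 0 → coord b = 0 → coord ⁅a, b⁆ = 0 ∧ χ ⁅a, b⁆ = 0) :
    L →ₗ⁅R⁆ Module.End R (Multiset I →₀ R) :=
  { (opOf coord (corr x coord χ)).flip with
    map_lie' := fun {a b} => by
      refine LinearMap.ext fun f => ?_
      have h : Comm x coord χ a b f := by
        induction f using Finsupp.induction_linear with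
        | zero => simp [Comm, act_zero]
        | add f g hf hg =>
          rw [Comm] at *
          rw [act_add, act_add, hf, hg, act_add, act_add, act_add]
          abel
        | single M c =>
          have := comm_single hx hχ hker M.card M le_rfl a b
          rw [Comm] at *
          rw [← mul_one c, ← smul_eq_mul, ← smul_single, act_smul, act_smul, this, act_smul,
            act_smul, act_smul, smul_add]
      exact (sub_eq_of_eq_add' h).symm }

theorem rep_x (hx : ∀ i, coord (x i) = single i 1) (hχ : ∀ i, χ (x i) = 0)
    (hker : ∀ a b, coord a = 0 → coord b = 0 → coord ⁅a, b⁆ = 0 ∧ χ ⁅a, b⁆ = 0) {j : I}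
    {N : Multiset I} (h : ∀ i ∈ N, j ≤ i) :
    rep hx hχ hker (x j) (single N 1) = single (j ::ₘ N) 1 :=
  act_x hx hχ h

theorem rep_one (hx : ∀ i, coord (x i) = single i 1) (hχ : ∀ i, χ (x i) = 0)
    (hker : ∀ a b, coord a = 0 → coord b = 0 → coord ⁅a, b⁆ = 0 ∧ χ ⁅a, b⁆ = 0) {a : L}
    (ha : coord a = 0) : rep hx hχ hker a (single 0 1) = χ a • single (0 : Multiset I) (1 : R) := by
  change act x coord χ a _ = _
  rw [act_single, corr_zero, mulVar, LinearMap.comp_apply, ha, map_zero, zero_add]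

end InducedModule

/-! ### Weight bases, letters, and coordinates with respect to ordered monomials. -/

section

open Finsupp LieAlgebra VertexOperator

/-- A basis `x` of `g` of weight vectors with dual basis `y`. The degree of `x a` consists of its weight,
recorded by its values on those `y c` that lie in the Cartan subalgebra, and of its height, which is
zero exactly for the elements of the Cartan subalgebra. -/
structure WeightBasis (g : Type*) [LieRing g] [LieAlgebra ℂ g] (h : ℂ) (A : Type*) [Fintype A]
    [DecidableEq A] where
  x : Module.Basis A ℂ g
  y : A → g
  deg : A → (A → ℂ) × ℤ
  form_x_y : ∀ a b, normalizedForm g h (x a) (y b) = if a = b then 1 else 0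
  lie_y_x : ∀ c a, (deg c).2 = 0 → ⁅y c, x a⁆ = (deg a).1 c • x a
  weight_apply_eq_zero : ∀ c a, (deg c).2 ≠ 0 → (deg a).1 c = 0
  deg_of_lie_x : ∀ a b c, x.repr ⁅x a, x b⁆ c ≠ 0 → deg c = deg a + deg b
  deg_of_lie_y : ∀ a b c, x.repr ⁅y a, x b⁆ c ≠ 0 → deg c = deg b - deg a
  -- The height is a linear function of the weight, so a nonzero degree already shows in the weight.
  height_eq : ∃ r : A → ℂ, ∀ a, ∑ c, r c * (deg a).1 c = (deg a).2

namespace WeightBasis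

variable {g : Type*} [LieRing g] [LieAlgebra ℂ g] {h k : ℂ} {A : Type*} [Fintype A] [DecidableEq A]

/-- The letter `(a, n)` stands for the element `x a t^(-n-1)` of `ĝ`. -/
@[ext]
structure Letter (W : WeightBasis g h A) where
  idx : A
  exp : ℕ

variable (W : WeightBasis g h A)

namespace Letter

variable {W}

/-- The letters other than `(a, 0)` with `x a` in the Borel subalgebra. -/
def IsRest (i : Letter W) : Prop := 0 < i.exp ∨ (W.deg i.idx).2 < 0

instance (i : Letter W) : Decidable i.IsRest := inferInstanceAs (Decidable (_ ∨ _))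

/-- The size of a letter: `0` for Borel letters and `2 n + 1` for the others. -/
def size (i : Letter W) : ℕ := if i.IsRest then 2 * i.exp + 1 else 0

/-- The degree of a letter, set to zero for the Borel letters. -/
def deg (i : Letter W) : (A → ℂ) × ℤ := if i.IsRest then W.deg i.idx else 0

/-- The element of `ĝ` for a letter. -/
def elem (i : Letter W) : AffineLie g h := AffineLie.current (W.x i.idx) (-(i.exp : ℤ) - 1)

/-- The sorting key of a letter. -/
def key (i : Letter W) : ℕ ×ₗ ℕ ×ₗ Fin (Fintype.card A) :=
  toLex (if i.IsRest then 1 else 0, toLex (i.exp, Fintype.equivFin A i.idx))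

theorem key_injective : Function.Injective (key : Letter W → _) := fun i j hij => by
  have h1 := congrArg (fun p => ofLex (ofLex p).2) hij
  simp only [key, ofLex_toLex, Prod.mk.injEq, EmbeddingLike.apply_eq_iff_eq] at h1
  exact Letter.ext h1.2 h1.1

/-- Borel letters come first. -/
instance : LinearOrder (Letter W) := LinearOrder.lift' key key_injective

theorem le_of_not_isRest_of_isRest {i j : Letter W} (hi : ¬i.IsRest) (hj : j.IsRest) : i ≤ j := by
  change key i ≤ key j
  rw [key, key, Prod.Lex.toLex_le_toLex]
  left
  simp [hi, hj]

end Letter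

/-- The coordinates of an element of `ĝ` with respect to the letters. -/
def coord : AffineLie g h →ₗ[ℂ] Letter W →₀ ℂ :=
  Finsupp.lcomapDomain (fun i : Letter W => ((-(i.exp : ℤ) - 1), i.idx))
    (fun i j hij => by
      simp only [Prod.mk.injEq] at hij
      exact Letter.ext hij.2 (by lia)) ∘ₗ
  (Finsupp.curryLinearEquiv ℂ).symm.toLinearMap ∘ₗ
  Finsupp.mapRange.linearMap W.x.repr.toLinearMap ∘ₗ
  (LoopAlgebra.toFinsupp ℂ ℤ g).toLinearMap ∘ₗ
  { toFun := fun a => a.carrier.1, map_add' := fun _ _ => rfl, map_smul' := fun _ _ => rfl }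


theorem coord_apply (a : AffineLie g h) (i : Letter W) :
    W.coord a i =
      W.x.repr (LoopAlgebra.toFinsupp ℂ ℤ g a.carrier.1 (-(i.exp : ℤ) - 1)) i.idx := rfl

theorem coord_current (x : g) (n : ℤ) (i : Letter W) :
    W.coord (AffineLie.current x n) i = if n = -(i.exp : ℤ) - 1 then W.x.repr x i.idx else 0 := by
  rw [coord_apply]
  change W.x.repr (LoopAlgebra.toFinsupp ℂ ℤ g (AddMonoidAlgebra.single n (1 : ℂ) ⊗ₜ[ℂ] x) _) _ = _
  rw [LoopAlgebra.toFinsupp_single_tmul, single_apply]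
  split_ifs <;> simp

theorem coord_central : W.coord (AffineLie.central : AffineLie g h) = 0 := by
  ext i
  rw [coord_apply]
  change W.x.repr (LoopAlgebra.toFinsupp ℂ ℤ g 0 _) _ = _
  simp

theorem coord_elem (i : Letter W) : W.coord i.elem = single i 1 := by
  ext j
  rw [Letter.elem, coord_current]
  by_cases hij : i = j
  · subst hij
    simp
  · rw [single_eq_of_ne (Ne.symm hij)]
    split_ifs with h1
    · rw [W.x.repr_self, single_eq_of_ne]
      rintro h2
      exact hij (Letter.ext h2.symm (by lia))
    · rfl

/-- The character of `ĝ` as a vector space sending currents to zero and `K` to `k`. -/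
def level (g : Type*) [LieRing g] [LieAlgebra ℂ g] (h k : ℂ) : AffineLie g h →ₗ[ℂ] ℂ where
  toFun a := TrivialLieModule.equiv ℂ (loopAlgebra ℂ ℤ g) ℂ a.carrier.2 * k
  map_add' a b := by
    change TrivialLieModule.equiv ℂ (loopAlgebra ℂ ℤ g) ℂ (a.carrier.2 + b.carrier.2) * k = _
    rw [map_add, add_mul]
  map_smul' c a := by
    change TrivialLieModule.equiv ℂ (loopAlgebra ℂ ℤ g) ℂ (c • a.carrier.2) * k = _
    rw [map_smul, smul_eq_mul, mul_assoc]
    rfl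

theorem level_current (x : g) (n : ℤ) : level g h k (AffineLie.current x n) = 0 := by
  change TrivialLieModule.equiv ℂ (loopAlgebra ℂ ℤ g) ℂ 0 * k = 0
  rw [map_zero, zero_mul]

theorem level_central : level g h k AffineLie.central = k := by
  change TrivialLieModule.equiv ℂ (loopAlgebra ℂ ℤ g) ℂ
    ((TrivialLieModule.equiv ℂ (loopAlgebra ℂ ℤ g) ℂ).symm 1) * k = k
  rw [LinearEquiv.apply_symm_apply, one_mul]

theorem mem_span_of_coord_eq_zero {a : AffineLie g h} (ha : W.coord a = 0) :
    a ∈ Submodule.span ℂ (Set.range (fun p : g × ℕ => AffineLie.current p.1 (p.2 : ℤ)) ∪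
      {(AffineLie.central : AffineLie g h)}) := by
  have h1 (n : ℤ) (hn : n < 0) : LoopAlgebra.toFinsupp ℂ ℤ g a.carrier.1 n = 0 := by
    apply W.x.repr.injective
    ext c
    have := DFunLike.congr_fun ha ⟨c, (-n - 1).toNat⟩
    rw [coord_apply] at this
    rw [show (-(((-n - 1).toNat : ℕ) : ℤ) - 1) = n by lia] at this
    rw [this, map_zero]
    rfl
  clear ha
  obtain ⟨f, c⟩ := a
  have h2 : (LieAlgebra.ofProd _ (f, c) : AffineLie g h) = LieAlgebra.ofProd _ (f, 0) +
      TrivialLieModule.equiv ℂ (loopAlgebra ℂ ℤ g) ℂ c • AffineLie.central := by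
    rw [AffineLie.central, ← of_smul, ← of_add, Prod.smul_mk, Prod.mk_add_mk, smul_zero, add_zero,
      zero_add, ← map_smul, smul_eq_mul, mul_one, LinearEquiv.symm_apply_apply]
  change LieAlgebra.ofProd _ (f, c) ∈ _
  rw [h2]
  refine add_mem ?_ (Submodule.smul_mem _ _ (Submodule.subset_span (Or.inr rfl)))
  change ∀ n < 0, LoopAlgebra.toFinsupp ℂ ℤ g f n = 0 at h1
  obtain ⟨F, rfl⟩ := (LoopAlgebra.toFinsupp ℂ ℤ g).symm.surjective f
  rw [LinearEquiv.apply_symm_apply] at h1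
  have h3 (F : ℤ →₀ g) :
      (LieAlgebra.ofProd _ ((LoopAlgebra.toFinsupp ℂ ℤ g).symm F, 0) : AffineLie g h) =
      F.sum fun n x => AffineLie.current x n := by
    induction F using Finsupp.induction_linear with
    | zero => simp [of_zero, ← Prod.zero_eq_mk]
    | add F G hF hG =>
      rw [Finsupp.sum_add_index' (fun n => ?_) fun n x y => AffineLie.current_add x y n, ← hF, ← hG,
        ← of_add, Prod.mk_add_mk, add_zero, ← map_add]
      simpa using AffineLie.current_smul (h := h) 0 (0 : g) n
    | single n x =>
      rw [LoopAlgebra.toFinsupp_symm_single, Finsupp.sum_single_index]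
      · rfl
      · simpa using AffineLie.current_smul (h := h) 0 (0 : g) n
  rw [h3]
  refine Submodule.sum_mem _ fun n hn => Submodule.subset_span (Or.inl ⟨(F n, n.toNat), ?_⟩)
  have : 0 ≤ n := by
    by_contra hlt
    exact (Finsupp.mem_support_iff.mp hn) (h1 n (by lia))
  simp only
  rw [Int.toNat_of_nonneg this]

/-- The kernel of `coord` is `g[t] ⊕ ℂ K`. The cocycle `m (x|y) δ_{m+n,0}` vanishes for `m, n ≥ 0`,
so this is a subalgebra and `level` is a character of it. -/
theorem coord_lie_eq_zero (a b : AffineLie g h) (ha : W.coord a = 0) (hb : W.coord b = 0) :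
    W.coord ⁅a, b⁆ = 0 ∧ level g h k ⁅a, b⁆ = 0 := by
  replace ha := W.mem_span_of_coord_eq_zero ha
  replace hb := W.mem_span_of_coord_eq_zero hb
  have hker : ⁅a, b⁆ ∈ LinearMap.ker W.coord ⊓ LinearMap.ker (level g h k) := by
    induction ha, hb using Submodule.span_induction₂ with
    | mem_mem a b ha hb =>
      rcases ha with ⟨⟨x, m⟩, rfl⟩ | rfl
      · rcases hb with ⟨⟨y, n⟩, rfl⟩ | rfl
        · rw [AffineLie.lie_current]
          have h0 : (if (m : ℤ) + n = 0 then (((m : ℤ) : ℂ)) * normalizedForm g h x y else 0) = 0 := by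
            split_ifs with h1
            · rw [show m = 0 by lia]; simp
            · rfl
          rw [h0, zero_smul, add_zero]
          refine ⟨?_, level_current _ _⟩
          change W.coord (AffineLie.current ⁅x, y⁆ ((m : ℤ) + n)) = 0
          ext i
          rw [coord_current, if_neg (by lia)]
          rfl
        · rw [← lie_skew, AffineLie.central_lie, neg_zero]
          exact zero_mem _
      · rw [AffineLie.central_lie]
        exact zero_mem _
    | zero_left => rw [zero_lie]; exact zero_mem _
    | zero_right => rw [lie_zero]; exact zero_mem _
    | add_left _ _ _ _ _ _ h1 h2 => rw [add_lie]; exact add_mem h1 h2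
    | add_right _ _ _ _ _ _ h1 h2 => rw [lie_add]; exact add_mem h1 h2
    | smul_left c _ _ _ _ h1 => rw [smul_lie]; exact Submodule.smul_mem _ _ h1
    | smul_right c _ _ _ _ h1 => rw [lie_smul]; exact Submodule.smul_mem _ _ h1
  exact hker

theorem level_elem (i : Letter W) : level g h k i.elem = 0 := level_current _ _

variable (k) in
/-- The action of `ĝ` on polynomials in the letters. -/
def polyRep : AffineLie g h →ₗ⁅ℂ⁆ Module.End ℂ (Multiset (Letter W) →₀ ℂ) :=
  InducedModule.rep W.coord_elem (W.level_elem (k := k)) W.coord_lie_eq_zero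

theorem polyRep_one {a : AffineLie g h} (ha : W.coord a = 0) :
    W.polyRep k a (single 0 1) = level g h k a • single 0 1 :=
  InducedModule.rep_one W.coord_elem (W.level_elem (k := k)) W.coord_lie_eq_zero ha

theorem polyRep_elem {j : Letter W} {N : Multiset (Letter W)} (h : ∀ i ∈ N, j ≤ i) :
    W.polyRep k j.elem (single N 1) = single (j ::ₘ N) 1 :=
  InducedModule.rep_x W.coord_elem (W.level_elem (k := k)) W.coord_lie_eq_zero h

theorem lift_polyRep_eq_zero (u : UniversalEnvelopingAlgebra ℂ (AffineLie g h))
    (hu : u ∈ vacuumIdeal g h k) :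
    UniversalEnvelopingAlgebra.lift ℂ (W.polyRep k) u (single 0 1) = 0 := by
  induction hu using Submodule.span_induction with
  | mem u hu =>
    rcases hu with ⟨⟨x, n⟩, rfl⟩ | rfl
    · have hc : W.coord (AffineLie.current x (n : ℤ)) = 0 := by
        ext i
        rw [coord_current, if_neg (by lia)]
        rfl
      rw [UniversalEnvelopingAlgebra.lift_ι_apply, W.polyRep_one hc, level_current, zero_smul]
    · rw [map_sub, LinearMap.sub_apply, UniversalEnvelopingAlgebra.lift_ι_apply,
        W.polyRep_one W.coord_central, level_central, AlgHom.commutes,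
        Module.algebraMap_end_apply, sub_self]
  | zero => rw [map_zero, LinearMap.zero_apply]
  | add u w _ _ hu hw => rw [map_add, LinearMap.add_apply, hu, hw, add_zero]
  | smul u w _ hw => rw [smul_eq_mul, map_mul, Module.End.mul_apply, hw, map_zero]

/-- The coordinates of a vector of `V^k(g)` with respect to the ordered monomials in the letters. -/
def poly : UniversalAffine g h k →ₗ[ℂ] Multiset (Letter W) →₀ ℂ :=
  Submodule.liftQ ((vacuumIdeal g h k).restrictScalars ℂ)
    (LinearMap.applyₗ (single 0 1) ∘ₗ
      (UniversalEnvelopingAlgebra.lift ℂ (W.polyRep k)).toLinearMap)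
    fun u hu => W.lift_polyRep_eq_zero u hu

theorem poly_proj (u : UniversalEnvelopingAlgebra ℂ (AffineLie g h)) :
    W.poly (UniversalAffine.proj u : UniversalAffine g h k) =
      UniversalEnvelopingAlgebra.lift ℂ (W.polyRep k) u (single 0 1) := rfl

theorem poly_vacuum : W.poly (UniversalAffine.vacuum g h k) = single 0 1 := by
  rw [UniversalAffine.vacuum, poly_proj, map_one, Module.End.one_apply]

theorem poly_act (a : AffineLie g h) (v : UniversalAffine g h k) :
    W.poly (UniversalAffine.act a v) = W.polyRep k a (W.poly v) := by
  obtain ⟨u, rfl⟩ := UniversalAffine.proj_surjective v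
  rw [UniversalAffine.act_apply, ← map_smul, poly_proj, poly_proj, smul_eq_mul, map_mul,
    Module.End.mul_apply, UniversalEnvelopingAlgebra.lift_ι_apply]

variable (k) in
/-- The operator on `V^k(g)` of a letter. -/
def op (i : Letter W) : Module.End ℂ (UniversalAffine g h k) :=
  UniversalAffine.mode (W.x i.idx) (-(i.exp : ℤ) - 1)

variable (k) in
/-- The product of the operators of the letters of a word. -/
def wordOp (l : List (Letter W)) : Module.End ℂ (UniversalAffine g h k) :=
  (l.map (W.op k)).prod

variable (k) in
/-- The vector of `V^k(g)` of a word. -/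
def word (l : List (Letter W)) : UniversalAffine g h k :=
  W.wordOp k l (UniversalAffine.vacuum g h k)

theorem wordOp_nil : W.wordOp k [] = 1 := rfl

theorem wordOp_cons (i : Letter W) (l : List (Letter W)) :
    W.wordOp k (i :: l) = W.op k i * W.wordOp k l := rfl

theorem wordOp_append (l l' : List (Letter W)) :
    W.wordOp k (l ++ l') = W.wordOp k l * W.wordOp k l' := by
  rw [wordOp, List.map_append, List.prod_append]
  rfl

theorem word_nil : W.word k [] = UniversalAffine.vacuum g h k := rfl

theorem word_cons (i : Letter W) (l : List (Letter W)) :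
    W.word k (i :: l) = W.op k i (W.word k l) := rfl

theorem word_append (l l' : List (Letter W)) :
    W.word k (l ++ l') = W.wordOp k l (W.word k l') := by
  rw [word, wordOp_append]
  rfl

/-- The independence half of the PBW theorem for `V^k(g)`: ordered words have distinct monomials as
coordinates. -/
theorem poly_word {l : List (Letter W)} (hl : l.Pairwise (· ≤ ·)) :
    W.poly (W.word k l) = single (l : Multiset (Letter W)) 1 := by
  induction l with
  | nil => rw [word_nil, poly_vacuum]; rfl
  | cons i l ih =>
    rw [List.pairwise_cons] at hl
    rw [word_cons, op, UniversalAffine.mode, poly_act, ih hl.2]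
    exact W.polyRep_elem fun m hm => hl.1 m hm

end WeightBasis

namespace UniversalAffine

variable {g : Type*} [LieRing g] [LieAlgebra ℂ g] {h k : ℂ}

variable (g h k) in
/-- The operator `x(n)` as a linear function of `x`. -/
def modeₗ (n : ℤ) : g →ₗ[ℂ] Module.End ℂ (UniversalAffine g h k) where
  toFun x := mode x n
  map_add' x y := by rw [mode, AffineLie.current_add, act_add]; rfl
  map_smul' c x := by rw [mode, AffineLie.current_smul, act_smul]; rfl

theorem modeₗ_apply (n : ℤ) (x : g) : modeₗ g h k n x = mode x n := rfl

theorem mode_sum {ι : Type*} (s : Finset ι) (x : ι → g) (n : ℤ) (v : UniversalAffine g h k) :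
    mode (∑ i ∈ s, x i) n v = ∑ i ∈ s, mode (x i) n v := by
  rw [← modeₗ_apply, map_sum, LinearMap.sum_apply]
  rfl

theorem mode_smul (c : ℂ) (x : g) (n : ℤ) (v : UniversalAffine g h k) :
    mode (c • x) n v = c • mode x n v := by
  rw [← modeₗ_apply, map_smul, LinearMap.smul_apply]
  rfl

end UniversalAffine

/-! ### Reordering words, and its effect on size and degree. -/

namespace WeightBasis

open UniversalAffine

variable {g : Type*} [LieRing g] [LieAlgebra ℂ g] {h k : ℂ} {A : Type*} [Fintype A] [DecidableEq A]
  (W : WeightBasis g h A)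

theorem mode_eq_sum (x : g) (n : ℤ) (v : UniversalAffine g h k) :
    mode x n v = ∑ c, W.x.repr x c • mode (W.x c) n v := by
  conv_lhs => rw [← W.x.sum_repr x, mode_sum]
  simp only [mode_smul]

theorem mode_eq_sum_op (x : g) (n : ℕ) (v : UniversalAffine g h k) :
    mode x (-(n : ℤ) - 1) v = ∑ c, W.x.repr x c • W.op k ⟨c, n⟩ v :=
  W.mode_eq_sum x _ v

/-- Two negative modes produce no central term, so their commutator is a combination of single
letters, of exponent one more than the sum. -/
theorem op_op (i j : Letter W) :
    W.op k i * W.op k j = W.op k j * W.op k i +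
      ∑ c, W.x.repr ⁅W.x i.idx, W.x j.idx⁆ c • W.op k ⟨c, i.exp + j.exp + 1⟩ := by
  ext v
  have h1 := mode_commutator (k := k) (W.x i.idx) (W.x j.idx) (-(i.exp : ℤ) - 1) (-(j.exp : ℤ) - 1) v
  rw [if_neg (by lia), zero_smul, add_zero, sub_eq_iff_eq_add',
    show -(i.exp : ℤ) - 1 + (-(j.exp : ℤ) - 1) = -((i.exp + j.exp + 1 : ℕ) : ℤ) - 1 by push_cast; ring,
    W.mode_eq_sum_op ⁅W.x i.idx, W.x j.idx⁆] at h1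
  rw [LinearMap.add_apply, LinearMap.sum_apply]
  exact h1

/-- The size of a monomial. -/
def size (M : Multiset (Letter W)) : ℕ := (M.map Letter.size).sum

/-- The degree of a monomial, to which only the letters outside the Borel subalgebra contribute. -/
def degree (M : Multiset (Letter W)) : (A → ℂ) × ℤ := (M.map Letter.deg).sum

@[simp] theorem size_zero : W.size 0 = 0 := rfl

@[simp] theorem degree_zero : W.degree 0 = 0 := rfl

@[simp] theorem size_cons (i : Letter W) (M : Multiset (Letter W)) :
    W.size (i ::ₘ M) = i.size + W.size M := by simp [size]

@[simp] theorem degree_cons (i : Letter W) (M : Multiset (Letter W)) :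
    W.degree (i ::ₘ M) = i.deg + W.degree M := by simp [degree]

@[simp] theorem size_add (M N : Multiset (Letter W)) : W.size (M + N) = W.size M + W.size N := by
  simp [size]

@[simp] theorem degree_add (M N : Multiset (Letter W)) :
    W.degree (M + N) = W.degree M + W.degree N := by
  simp [degree]

variable {W} in
theorem Letter.size_of_isRest {i : Letter W} (hi : i.IsRest) : i.size = 2 * i.exp + 1 := if_pos hi

variable {W} in
theorem Letter.size_of_not_isRest {i : Letter W} (hi : ¬i.IsRest) : i.size = 0 := if_neg hi

variable {W} in
theorem Letter.deg_of_isRest {i : Letter W} (hi : i.IsRest) : i.deg = W.deg i.idx := if_pos hi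

variable {W} in
theorem Letter.deg_of_not_isRest {i : Letter W} (hi : ¬i.IsRest) : i.deg = 0 := if_neg hi

variable {W} in
theorem Letter.exp_of_not_isRest {i : Letter W} (hi : ¬i.IsRest) : i.exp = 0 := by
  rw [Letter.IsRest] at hi
  lia

variable {W} in
theorem Letter.size_succ (c : A) (n : ℕ) : (⟨c, n + 1⟩ : Letter W).size = 2 * n + 3 :=
  Letter.size_of_isRest (i := ⟨c, n + 1⟩) (Or.inl n.succ_pos)

theorem size_of_forall_not_isRest {M : Multiset (Letter W)} (hM : ∀ i ∈ M, ¬i.IsRest) :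
    W.size M = 0 := by
  induction M using Multiset.induction_on with
  | empty => rfl
  | cons i M ih =>
    rw [size_cons, Letter.size_of_not_isRest (hM i (by simp)),
      ih fun j hj => hM j (Multiset.mem_cons_of_mem hj)]

theorem degree_of_forall_not_isRest {M : Multiset (Letter W)} (hM : ∀ i ∈ M, ¬i.IsRest) :
    W.degree M = 0 := by
  induction M using Multiset.induction_on with
  | empty => rfl
  | cons i M ih =>
    rw [degree_cons, Letter.deg_of_not_isRest (hM i (by simp)),
      ih fun j hj => hM j (Multiset.mem_cons_of_mem hj), add_zero]

/-- The words that arise as corrections when the word `l` is reordered. -/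
def IsCorrection (l l' : List (Letter W)) : Prop :=
  l'.length < l.length ∧ W.size l + 1 ≤ W.size l' ∧
    ((∀ i ∈ l, i.IsRest) → (∀ i ∈ l', i.IsRest) ∧ W.degree l' = W.degree l) ∧
    ((∀ i ∈ l, ¬i.IsRest) → 3 ≤ W.size l')

variable (k) in
/-- The span of the corrections to the word `l`. -/
def corrections (l : List (Letter W)) : Submodule ℂ (Module.End ℂ (UniversalAffine g h k)) :=
  Submodule.span ℂ (W.wordOp k '' {l' | W.IsCorrection l l'})

variable {W} in
theorem IsCorrection.cons {l l' : List (Letter W)} (hl : W.IsCorrection l l') (i : Letter W) :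
    W.IsCorrection (i :: l) (i :: l') := by
  obtain ⟨h1, h2, h3, h4⟩ := hl
  refine ⟨by simpa using h1, ?_, fun hr => ?_, fun hb => ?_⟩
  · simp only [← Multiset.cons_coe, size_cons]
    lia
  · obtain ⟨h5, h6⟩ := h3 fun j hj => hr j (List.mem_cons_of_mem _ hj)
    refine ⟨fun j hj => ?_, ?_⟩
    · rcases List.mem_cons.mp hj with rfl | hj
      · exact hr _ (by simp)
      · exact h5 j hj
    · simp only [← Multiset.cons_coe, degree_cons, h6]
  · have := h4 fun j hj => hb j (List.mem_cons_of_mem _ hj)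
    simp only [← Multiset.cons_coe, size_cons]
    lia

theorem op_mul_mem_corrections {l : List (Letter W)} {u : Module.End ℂ (UniversalAffine g h k)}
    (hu : u ∈ W.corrections k l) (i : Letter W) : W.op k i * u ∈ W.corrections k (i :: l) := by
  induction hu using Submodule.span_induction with
  | mem u hu =>
    obtain ⟨l', hl', rfl⟩ := hu
    exact Submodule.subset_span ⟨i :: l', hl'.cons i, rfl⟩
  | zero => rw [mul_zero]; exact zero_mem _
  | add u w _ _ hu hw => rw [mul_add]; exact add_mem hu hw
  | smul c u _ hu => rw [mul_smul_comm]; exact Submodule.smul_mem _ _ hu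

/-- The new letter has size `2 (m + n) + 3` for exponents `m`, `n`. This exceeds the size of two
non-Borel letters by 1, of a mixed pair by 2 and of two Borel letters by 3. Weights and heights add
under the bracket. -/
theorem isCorrection_swap (i j : Letter W) (l : List (Letter W)) (c : A)
    (hc : W.x.repr ⁅W.x i.idx, W.x j.idx⁆ c ≠ 0) :
    W.IsCorrection (i :: j :: l) (⟨c, i.exp + j.exp + 1⟩ :: l) := by
  have hs := Letter.size_succ (W := W) c (i.exp + j.exp)
  have hr : (⟨c, i.exp + j.exp + 1⟩ : Letter W).IsRest := Or.inl (Nat.succ_pos _)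
  have hle (m : Letter W) : m.size ≤ 2 * m.exp + 1 := by rw [Letter.size]; split_ifs <;> lia
  have h1 := hle i
  have h2 := hle j
  refine ⟨by simp, ?_, fun h3 => ⟨fun m hm => ?_, ?_⟩, fun h3 => ?_⟩
  · simp only [← Multiset.cons_coe, size_cons]
    lia
  · rcases List.mem_cons.mp hm with rfl | hm
    · exact hr
    · exact h3 m (by simp [hm])
  · simp only [← Multiset.cons_coe, degree_cons]
    rw [Letter.deg_of_isRest hr, Letter.deg_of_isRest (h3 i (by simp)),
      Letter.deg_of_isRest (h3 j (by simp)), ← add_assoc, W.deg_of_lie_x _ _ _ hc]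
  · simp only [← Multiset.cons_coe, size_cons]
    lia

theorem corrections_congr {l l' : List (Letter W)} (hl : l.Perm l') :
    W.corrections k l = W.corrections k l' := by
  have h1 (l'' : List (Letter W)) : W.IsCorrection l l'' ↔ W.IsCorrection l' l'' := by
    rw [IsCorrection, IsCorrection, hl.length_eq, Multiset.coe_eq_coe.mpr hl]
    simp only [hl.mem_iff]
  rw [corrections, corrections]
  simp only [h1]

theorem wordOp_sub_mem_corrections {l l' : List (Letter W)} (hl : l.Perm l') :
    W.wordOp k l - W.wordOp k l' ∈ W.corrections k l := by
  induction hl with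
  | nil => rw [sub_self]; exact zero_mem _
  | cons i _ ih =>
    rw [wordOp_cons, wordOp_cons, ← mul_sub]
    exact W.op_mul_mem_corrections ih i
  | swap i j l =>
    rw [wordOp_cons, wordOp_cons, wordOp_cons, wordOp_cons, ← mul_assoc, ← mul_assoc, op_op W j i,
      add_mul, add_sub_cancel_left, Finset.sum_mul]
    refine Submodule.sum_mem _ fun c _ => ?_
    by_cases hc : W.x.repr ⁅W.x j.idx, W.x i.idx⁆ c = 0
    · rw [hc, zero_smul, zero_mul]
      exact zero_mem _
    · rw [smul_mul_assoc]
      exact Submodule.smul_mem _ _ (Submodule.subset_span ⟨_, W.isCorrection_swap j i l c hc, rfl⟩)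
  | trans h1 _ ih1 ih2 =>
    rw [← W.corrections_congr h1] at ih2
    rw [← sub_add_sub_cancel]
    exact add_mem ih1 ih2

/-! ### Triangularity of the coordinates of words. -/

/-- The polynomials whose monomials all satisfy `p`. -/
def polySupported (p : Multiset (Letter W) → Prop) : Submodule ℂ (Multiset (Letter W) →₀ ℂ) :=
  supported ℂ ℂ {M | p M}

theorem polySupported_mono {p q : Multiset (Letter W) → Prop} (hpq : ∀ M, p M → q M) :
    W.polySupported p ≤ W.polySupported q :=
  supported_mono hpq

theorem eq_zero_of_mem_polySupported {p : Multiset (Letter W) → Prop}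
    {f : Multiset (Letter W) →₀ ℂ} (hf : f ∈ W.polySupported p) {M : Multiset (Letter W)}
    (hM : ¬p M) : f M = 0 :=
  (mem_supported' ℂ f).mp hf M hM

theorem single_mem_polySupported {p : Multiset (Letter W) → Prop} {M : Multiset (Letter W)}
    (hM : p M) (c : ℂ) : single M c ∈ W.polySupported p :=
  single_mem_supported ℂ c hM

theorem poly_mem_of_mem_corrections {l : List (Letter W)} {p : Multiset (Letter W) → Prop}
    {u : Module.End ℂ (UniversalAffine g h k)} (hu : u ∈ W.corrections k l)
    {w : UniversalAffine g h k}
    (hl : ∀ l', W.IsCorrection l l' → W.poly (W.wordOp k l' w) ∈ W.polySupported p) :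
    W.poly (u w) ∈ W.polySupported p := by
  induction hu using Submodule.span_induction with
  | mem u hu =>
    obtain ⟨l', hl', rfl⟩ := hu
    exact hl l' hl'
  | zero => rw [LinearMap.zero_apply, map_zero]; exact zero_mem _
  | add u w _ _ hu hw => rw [LinearMap.add_apply, map_add]; exact add_mem hu hw
  | smul c u _ hu => rw [LinearMap.smul_apply, map_smul]; exact Submodule.smul_mem _ _ hu

/-- The polynomial of a word is supported on monomials of at least the size of the word. -/
theorem poly_word_mem (l : List (Letter W)) :
    W.poly (W.word k l) ∈ W.polySupported fun M => W.size l ≤ W.size M := by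
  induction hn : l.length using Nat.strong_induction_on generalizing l with
  | _ n ih =>
    subst hn
    have h1 : l.Perm ((l : Multiset (Letter W)).sort (· ≤ ·)) :=
      Multiset.coe_eq_coe.mp (Multiset.sort_eq _ _).symm
    have h2 := W.poly_mem_of_mem_corrections (W.wordOp_sub_mem_corrections (k := k) h1)
      (p := fun M => W.size l ≤ W.size M) (w := vacuum g h k) fun l' hl' => by
        refine W.polySupported_mono (fun M hM => ?_) (ih l'.length hl'.1 l' rfl)
        have := hl'.2.1
        lia
    rw [LinearMap.sub_apply, map_sub] at h2
    have h3 := add_mem h2 (W.single_mem_polySupported (p := fun M => W.size l ≤ W.size M)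
      (M := l) le_rfl 1)
    rw [show single (l : Multiset (Letter W)) (1 : ℂ) = W.poly (W.wordOp k _ (vacuum g h k)) from
      ((W.poly_word (Multiset.pairwise_sort _ (· ≤ ·))).trans (by rw [Multiset.sort_eq])).symm,
      sub_add_cancel] at h3
    exact h3

theorem sort_append {B R : Multiset (Letter W)} (hB : ∀ i ∈ B, ¬i.IsRest) (hR : ∀ i ∈ R, i.IsRest) :
    (B.sort (· ≤ ·) ++ R.sort (· ≤ ·)).Pairwise (· ≤ ·) := by
  rw [List.pairwise_append]
  refine ⟨Multiset.pairwise_sort _ _, Multiset.pairwise_sort _ _, fun i hi j hj => ?_⟩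
  exact Letter.le_of_not_isRest_of_isRest (hB i (by simpa using hi)) (hR j (by simpa using hj))

/-- The monomial of a word `B R`, with `B` in the Borel letters and `R` in the other letters, is the
leading term of its polynomial. -/
theorem poly_word_append_mem (B R : List (Letter W)) (hB : ∀ i ∈ B, ¬i.IsRest)
    (hR : ∀ i ∈ R, i.IsRest) :
    W.poly (W.word k (B ++ R)) - single (B + R : Multiset (Letter W)) 1 ∈
      W.polySupported fun M => (W.size R + 1 ≤ W.size M ∧ W.degree M = W.degree R) ∨
        W.size R + 3 ≤ W.size M := by
  induction hn : R.length using Nat.strong_induction_on generalizing R with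
  | _ n ih =>
    subst hn
    have hpB : B.Perm ((B : Multiset (Letter W)).sort (· ≤ ·)) :=
      Multiset.coe_eq_coe.mp (Multiset.sort_eq _ _).symm
    have hpR : R.Perm ((R : Multiset (Letter W)).sort (· ≤ ·)) :=
      Multiset.coe_eq_coe.mp (Multiset.sort_eq _ _).symm
    have h0 := W.poly_word (k := k) (W.sort_append (B := B) (R := R) hB hR)
    rw [← Multiset.coe_add, Multiset.sort_eq, Multiset.sort_eq] at h0
    -- Reordering `R` yields shorter non-Borel words of the same degree and larger size, to which
    -- the induction hypothesis applies.
    have hrest {u : Module.End ℂ (UniversalAffine g h k)} (hu : u ∈ W.corrections k R) :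
        W.poly (W.wordOp k B (u (vacuum g h k))) ∈
          W.polySupported fun M => (W.size R + 1 ≤ W.size M ∧ W.degree M = W.degree R) ∨
            W.size R + 3 ≤ W.size M := by
      induction hu using Submodule.span_induction with
      | mem u hu =>
        obtain ⟨R', ⟨h1, h2, h3, -⟩, rfl⟩ := hu
        obtain ⟨h3, h4⟩ := h3 hR
        have h5 := ih R'.length h1 R' h3 rfl
        rw [word_append] at h5
        have h6 := add_mem (W.polySupported_mono (fun M hM => ?_) h5)
          (W.single_mem_polySupported (M := B + R') (p := fun M =>
            (W.size R + 1 ≤ W.size M ∧ W.degree M = W.degree R) ∨ W.size R + 3 ≤ W.size M) ?_ 1)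
        · rw [sub_add_cancel] at h6
          exact h6
        · rw [h4] at hM
          lia
        · left
          rw [size_add, degree_add, W.degree_of_forall_not_isRest (by simpa using hB), h4, zero_add]
          exact ⟨by lia, rfl⟩
      | zero => rw [LinearMap.zero_apply, map_zero, map_zero]; exact zero_mem _
      | add u w _ _ hu hw => rw [LinearMap.add_apply, map_add, map_add]; exact add_mem hu hw
      | smul c u _ hu => rw [LinearMap.smul_apply, map_smul, map_smul]; exact Submodule.smul_mem _ _ hu
    have h1 := hrest (W.wordOp_sub_mem_corrections hpR)
    have h2 := W.poly_mem_of_mem_corrections (W.wordOp_sub_mem_corrections (k := k) hpB)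
      (w := W.word k ((R : Multiset (Letter W)).sort (· ≤ ·)))
      (p := fun M => (W.size R + 1 ≤ W.size M ∧ W.degree M = W.degree R) ∨
        W.size R + 3 ≤ W.size M) fun B' hB' => by
        rw [← word_append]
        refine W.polySupported_mono (fun M hM => Or.inr ?_) (W.poly_word_mem _)
        -- Reordering Borel letters may change the degree, but it gains at least 3 in size.
        have h3 := hB'.2.2.2 hB
        rw [← Multiset.coe_add, size_add, Multiset.sort_eq] at hM
        lia
    have h3 := add_mem h1 h2
    rw [← h0, word_append, word_append]
    rw [LinearMap.sub_apply, LinearMap.sub_apply, map_sub, map_sub, map_sub] at h3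
    exact (congrArg (· ∈ _) (sub_add_sub_cancel _ _ _)).mp h3

theorem word_mem_span (l : List (Letter W)) : W.word k l ∈
    Submodule.span ℂ (Set.range fun M : Multiset (Letter W) => W.word k (M.sort (· ≤ ·))) := by
  induction hn : l.length using Nat.strong_induction_on generalizing l with
  | _ n ih =>
    subst hn
    have hp : l.Perm ((l : Multiset (Letter W)).sort (· ≤ ·)) :=
      Multiset.coe_eq_coe.mp (Multiset.sort_eq _ _).symm
    have h1 {u : Module.End ℂ (UniversalAffine g h k)} (hu : u ∈ W.corrections k l) :
        u (vacuum g h k) ∈ Submodule.span ℂ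
          (Set.range fun M : Multiset (Letter W) => W.word k (M.sort (· ≤ ·))) := by
      induction hu using Submodule.span_induction with
      | mem u hu =>
        obtain ⟨l', hl', rfl⟩ := hu
        exact ih _ hl'.1 l' rfl
      | zero => exact zero_mem _
      | add u w _ _ hu hw => exact add_mem hu hw
      | smul c u _ hu => exact Submodule.smul_mem _ _ hu
    have h2 := add_mem (h1 (W.wordOp_sub_mem_corrections hp)) (Submodule.subset_span ⟨l, rfl⟩)
    rw [LinearMap.sub_apply] at h2
    exact (congrArg (· ∈ _) (sub_add_cancel _ _)).mp h2

/-- A mode is moved to the right until it meets the vacuum, where it vanishes or becomes a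
combination of letters. -/
theorem mode_word_mem (l : List (Letter W)) (x : g) (n : ℤ) :
    mode x n (W.word k l) ∈ Submodule.span ℂ (Set.range (W.word k)) := by
  induction l generalizing x n with
  | nil =>
    rw [word_nil]
    by_cases hn : 0 ≤ n
    · obtain ⟨n, rfl⟩ := Int.eq_ofNat_of_zero_le hn
      rw [mode_vacuum]
      exact zero_mem _
    · obtain ⟨m, rfl⟩ : ∃ m : ℕ, n = -(m : ℤ) - 1 := ⟨(-n - 1).toNat, by lia⟩
      rw [W.mode_eq_sum_op]
      exact Submodule.sum_mem _ fun c _ => Submodule.smul_mem _ _ (Submodule.subset_span ⟨[_], rfl⟩)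
  | cons i l ih =>
    have h1 := mode_commutator (k := k) x (W.x i.idx) n (-(i.exp : ℤ) - 1) (W.word k l)
    rw [sub_eq_iff_eq_add] at h1
    rw [word_cons, op, h1]
    refine add_mem (add_mem (ih _ _) (Submodule.smul_mem _ _ (Submodule.subset_span ⟨l, rfl⟩))) ?_
    have h2 := ih x n
    generalize mode x n (W.word k l) = w at h2
    induction h2 using Submodule.span_induction with
    | mem w hw =>
      obtain ⟨l', rfl⟩ := hw
      exact Submodule.subset_span ⟨i :: l', rfl⟩
    | zero => rw [map_zero]; exact zero_mem _
    | add u w _ _ hu hw => rw [map_add]; exact add_mem hu hw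
    | smul c u _ hu => rw [map_smul]; exact Submodule.smul_mem _ _ hu

theorem span_word_eq_top : Submodule.span ℂ (Set.range (W.word k)) = ⊤ := by
  refine Submodule.eq_top_iff'.mpr fun v => ?_
  refine submodule_eq_top (Submodule.span ℂ (Set.range (W.word k)))
    (Submodule.subset_span ⟨[], rfl⟩) (fun x n w hw => ?_) v
  induction hw using Submodule.span_induction with
  | mem w hw =>
    obtain ⟨l, rfl⟩ := hw
    exact W.mode_word_mem l x n
  | zero => rw [map_zero]; exact zero_mem _
  | add u w _ _ hu hw => rw [map_add]; exact add_mem hu hw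
  | smul c u _ hu => rw [map_smul]; exact Submodule.smul_mem _ _ hu

/-- Every vector is the combination of ordered words given by its polynomial. -/
theorem eq_sum_word (v : UniversalAffine g h k) :
    v = (W.poly v).sum fun M c => c • W.word k (M.sort (· ≤ ·)) := by
  have h1 : v ∈ Submodule.span ℂ
      (Set.range fun M : Multiset (Letter W) => W.word k (M.sort (· ≤ ·))) := by
    have h2 : v ∈ Submodule.span ℂ (Set.range (W.word k)) := by
      rw [W.span_word_eq_top]
      trivial
    refine Submodule.span_le.mpr ?_ h2
    rintro _ ⟨l, rfl⟩
    exact W.word_mem_span l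
  change v = Finsupp.linearCombination ℂ
    (fun M : Multiset (Letter W) => W.word k (M.sort (· ≤ ·))) (W.poly v)
  induction h1 using Submodule.span_induction with
  | mem v hv =>
    obtain ⟨M, rfl⟩ := hv
    simp only
    rw [W.poly_word (Multiset.pairwise_sort _ _), Multiset.sort_eq, linearCombination_single,
      one_smul]
  | zero => rw [map_zero, map_zero]
  | add u w _ _ hu hw => rw [map_add, map_add, ← hu, ← hw]
  | smul c u _ hu => rw [map_smul, map_smul, ← hu]

end WeightBasis

/-! ### The filtration by size. -/

namespace WeightBasis

open UniversalAffine

variable {g : Type*} [LieRing g] [LieAlgebra ℂ g] {h k : ℂ} {A : Type*} [Fintype A] [DecidableEq A]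
  (W : WeightBasis g h A)

variable (k) in
/-- The span of the words of size at least `t`. -/
def fil (t : ℕ) : Submodule ℂ (UniversalAffine g h k) :=
  Submodule.span ℂ (W.word k '' {l | t ≤ W.size l})

variable {W}

theorem word_mem_fil {l : List (Letter W)} {t : ℕ} (hl : t ≤ W.size l) : W.word k l ∈ W.fil k t :=
  Submodule.subset_span ⟨l, hl, rfl⟩

theorem fil_mono {s t : ℕ} (hst : s ≤ t) : W.fil k t ≤ W.fil k s :=
  Submodule.span_mono (Set.image_mono fun _ hl => hst.trans hl)

theorem op_mem_fil (i : Letter W) {t : ℕ} {w : UniversalAffine g h k} (hw : w ∈ W.fil k t) :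
    W.op k i w ∈ W.fil k (i.size + t) := by
  induction hw using Submodule.span_induction with
  | mem w hw =>
    obtain ⟨l, hl, rfl⟩ := hw
    refine word_mem_fil (l := i :: l) ?_
    rw [← Multiset.cons_coe, size_cons]
    exact Nat.add_le_add_left hl _
  | zero => rw [map_zero]; exact zero_mem _
  | add u w _ _ hu hw => rw [map_add]; exact add_mem hu hw
  | smul c u _ hu => rw [map_smul]; exact Submodule.smul_mem _ _ hu

theorem op_mem_fil_self (i : Letter W) {t : ℕ} {w : UniversalAffine g h k} (hw : w ∈ W.fil k t) :
    W.op k i w ∈ W.fil k t :=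
  fil_mono (Nat.le_add_left _ _) (op_mem_fil i hw)

theorem wordOp_mem_fil (l : List (Letter W)) {t : ℕ} {w : UniversalAffine g h k}
    (hw : w ∈ W.fil k t) : W.wordOp k l w ∈ W.fil k t := by
  induction l with
  | nil => exact hw
  | cons i l ih => exact op_mem_fil_self i ih

/-- The commutator consists of letters of positive exponent, each of size at least 3. The gain is
measured from `w` alone, without the sizes of `i` and `j`. -/
theorem op_op_sub_mem_fil (i j : Letter W) {t : ℕ} {w : UniversalAffine g h k}
    (hw : w ∈ W.fil k t) :
    W.op k i (W.op k j w) - W.op k j (W.op k i w) ∈ W.fil k (t + 3) := by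
  have h1 := DFunLike.congr_fun (W.op_op (k := k) i j) w
  rw [LinearMap.add_apply, LinearMap.sum_apply, Module.End.mul_apply, Module.End.mul_apply] at h1
  rw [h1, add_sub_cancel_left]
  refine Submodule.sum_mem _ fun c _ => Submodule.smul_mem _ _ (fil_mono ?_ (op_mem_fil _ hw))
  rw [Letter.size_succ]
  lia

theorem op_wordOp_sub_mem_fil (i : Letter W) (B : List (Letter W)) {t : ℕ}
    {w : UniversalAffine g h k} (hw : w ∈ W.fil k t) :
    W.op k i (W.wordOp k B w) - W.wordOp k B (W.op k i w) ∈ W.fil k (t + 3) := by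
  induction B with
  | nil =>
    rw [wordOp_nil, Module.End.one_apply, Module.End.one_apply, sub_self]
    exact zero_mem _
  | cons c B ih =>
    rw [wordOp_cons, Module.End.mul_apply, Module.End.mul_apply]
    have h1 := add_mem (op_op_sub_mem_fil i c (wordOp_mem_fil B hw)) (op_mem_fil_self c ih)
    rwa [map_sub, sub_add_sub_cancel] at h1

theorem mode_zero_op (y : g) (c : Letter W) (w : UniversalAffine g h k) :
    mode y 0 (W.op k c w) =
      W.op k c (mode y 0 w) + mode ⁅y, W.x c.idx⁆ (-(c.exp : ℤ) - 1) w := by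
  have h1 := mode_commutator (k := k) y (W.x c.idx) 0 (-(c.exp : ℤ) - 1) w
  rw [if_neg (by lia), zero_smul, add_zero, sub_eq_iff_eq_add', zero_add] at h1
  exact h1

theorem repr_eq_form (z : g) (d : A) : W.x.repr z d = normalizedForm g h z (W.y d) := by
  conv_rhs => rw [← W.x.sum_repr z]
  rw [map_sum, LinearMap.sum_apply]
  simp only [map_smul, LinearMap.smul_apply, W.form_x_y, smul_eq_mul, mul_ite, mul_one, mul_zero]
  simp

theorem form_lie_left (x y z : g) :
    normalizedForm g h ⁅x, y⁆ z = -normalizedForm g h y ⁅x, z⁆ :=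
  normalizedForm_lieInvariant g h x y z

theorem form_symm (x y : g) : normalizedForm g h x y = normalizedForm g h y x :=
  (normalizedForm_isSymm g h).eq x y

/-- The coefficient is `([y_a, x_c] | y_d)`, antisymmetric in `a` and `d` by invariance of the form.
-/
theorem repr_lie_y_antisymm (a d c : A) :
    W.x.repr ⁅W.y a, W.x c⁆ d = -W.x.repr ⁅W.y d, W.x c⁆ a := by
  rw [repr_eq_form, repr_eq_form, ← lie_skew (W.y a), ← lie_skew (W.y d), map_neg, map_neg,
    LinearMap.neg_apply, LinearMap.neg_apply, form_lie_left, neg_neg, neg_neg, form_symm]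

/-! ### Leading terms of `∑ x_a(-1) y_a(0)` over the Borel subalgebra. -/

variable (k W) in
/-- The span of the words of size at least `t` and height less than `d`, and those of size at least
`t + 3`. -/
def low (t : ℕ) (d : ℤ) : Submodule ℂ (UniversalAffine g h k) :=
  Submodule.span ℂ {w | ∃ B R : List (Letter W), (∀ i ∈ B, ¬i.IsRest) ∧ (∀ i ∈ R, i.IsRest) ∧
    t ≤ W.size R ∧ (W.degree R).2 < d ∧ w = W.word k (B ++ R)} ⊔ W.fil k (t + 3)

theorem fil_le_low (t : ℕ) (d : ℤ) : W.fil k (t + 3) ≤ W.low k t d := le_sup_right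

theorem word_mem_low {B R : List (Letter W)} (hB : ∀ i ∈ B, ¬i.IsRest) (hR : ∀ i ∈ R, i.IsRest)
    {t : ℕ} {d : ℤ} (ht : t ≤ W.size R) (hd : (W.degree R).2 < d) :
    W.word k (B ++ R) ∈ W.low k t d :=
  le_sup_left (α := Submodule ℂ (UniversalAffine g h k))
    (Submodule.subset_span ⟨B, R, hB, hR, ht, hd, rfl⟩)

theorem op_mem_low {i : Letter W} (hi : ¬i.IsRest) {t : ℕ} {d : ℤ} {w : UniversalAffine g h k}
    (hw : w ∈ W.low k t d) : W.op k i w ∈ W.low k t d := by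
  have h1 : W.low k t d ≤ (W.low k t d).comap (W.op k i) := by
    refine sup_le (Submodule.span_le.mpr ?_) fun w hw => fil_le_low t d (op_mem_fil_self i hw)
    rintro _ ⟨B, R, hB, hR, ht, hd, rfl⟩
    refine word_mem_low (B := i :: B) (fun j hj => ?_) hR ht hd
    rcases List.mem_cons.mp hj with rfl | hj
    · exact hi
    · exact hB j hj
  exact h1 hw

theorem poly_mem_of_mem_fil {t : ℕ} {w : UniversalAffine g h k} (hw : w ∈ W.fil k t) :
    W.poly w ∈ W.polySupported fun M => t ≤ W.size M := by
  have h1 : W.fil k t ≤ (W.polySupported fun M => t ≤ W.size M).comap W.poly := by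
    refine Submodule.span_le.mpr ?_
    rintro _ ⟨l, hl, rfl⟩
    exact W.polySupported_mono (fun M hM => le_trans hl hM) (W.poly_word_mem l)
  exact h1 hw

theorem poly_mem_of_mem_low {t : ℕ} {d : ℤ} {w : UniversalAffine g h k} (hw : w ∈ W.low k t d) :
    W.poly w ∈ W.polySupported fun M =>
      (t ≤ W.size M ∧ (W.degree M).2 < d) ∨ t + 3 ≤ W.size M := by
  have h1 : W.low k t d ≤ (W.polySupported fun M =>
      (t ≤ W.size M ∧ (W.degree M).2 < d) ∨ t + 3 ≤ W.size M).comap W.poly := by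
    refine sup_le (Submodule.span_le.mpr ?_) fun w hw =>
      W.polySupported_mono (fun M hM => Or.inr hM) (poly_mem_of_mem_fil hw)
    rintro _ ⟨B, R, hB, hR, ht, hd, rfl⟩
    have h2 := add_mem (W.polySupported_mono (fun M hM => ?_) (W.poly_word_append_mem (k := k) B R hB hR))
      (W.single_mem_polySupported (M := B + R) (p := fun M =>
        (t ≤ W.size M ∧ (W.degree M).2 < d) ∨ t + 3 ≤ W.size M) ?_ 1)
    · rw [sub_add_cancel] at h2
      exact h2
    · rcases hM with ⟨h3, h4⟩ | h3
      · left
        rw [h4]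
        exact ⟨by lia, hd⟩
      · right
        lia
    · left
      rw [size_add, degree_add, W.degree_of_forall_not_isRest (by simpa using hB), zero_add]
      exact ⟨by lia, hd⟩
  exact h1 hw

variable (W) in
/-- The indices of the basis elements in the Borel subalgebra. -/
def borel : Finset A := {a | 0 ≤ (W.deg a).2}

variable (W) in
/-- The indices of the basis elements in the Cartan subalgebra. -/
def cartan : Finset A := {a | (W.deg a).2 = 0}

theorem not_isRest_of_mem_borel {a : A} (ha : a ∈ W.borel) : ¬(⟨a, 0⟩ : Letter W).IsRest := by
  rintro (h1 | h1)
  · exact absurd h1 (lt_irrefl _)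
  · exact absurd (Finset.mem_filter.mp ha).2 (not_le.mpr h1)

theorem mode_zero_wordOp_sub_mem_fil (y : g) {B : List (Letter W)} (hB : ∀ i ∈ B, ¬i.IsRest)
    {t : ℕ} {w : UniversalAffine g h k} (hw : w ∈ W.fil k t) :
    mode y 0 (W.wordOp k B w) - W.wordOp k B (mode y 0 w) ∈ W.fil k t := by
  induction B with
  | nil =>
    rw [wordOp_nil, Module.End.one_apply, Module.End.one_apply, sub_self]
    exact zero_mem _
  | cons c B ih =>
    rw [wordOp_cons, Module.End.mul_apply, Module.End.mul_apply, mode_zero_op, add_sub_right_comm,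
      ← map_sub, W.mode_eq_sum_op]
    exact add_mem (op_mem_fil_self c (ih fun i hi => hB i (List.mem_cons_of_mem _ hi)))
      (Submodule.sum_mem _ fun d _ => Submodule.smul_mem _ _
        (op_mem_fil_self _ (wordOp_mem_fil B hw)))

/-- Expand `[y_a, x_c]` in the basis. Borel components cancel up to commutators because their
coefficients are antisymmetric, and the remaining components are letters of negative height. -/
theorem sum_op_mode_lie_mem_low (c : A) {B R : List (Letter W)} (hB : ∀ i ∈ B, ¬i.IsRest)
    (hR : ∀ i ∈ R, i.IsRest) :
    ∑ a ∈ W.borel, W.op k ⟨a, 0⟩ (mode ⁅W.y a, W.x c⁆ (-((0 : ℕ) : ℤ) - 1) (W.word k (B ++ R))) ∈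
      W.low k (W.size R) (W.degree R).2 := by
  have hR' : W.word k R ∈ W.fil k (W.size R) := word_mem_fil le_rfl
  have hw : W.word k (B ++ R) ∈ W.fil k (W.size R) := by
    rw [word_append]
    exact wordOp_mem_fil B hR'
  have h1 (a : A) : W.op k ⟨a, 0⟩ (mode ⁅W.y a, W.x c⁆ (-((0 : ℕ) : ℤ) - 1) (W.word k (B ++ R))) =
      ∑ d ∈ W.borel, W.x.repr ⁅W.y a, W.x c⁆ d •
          W.op k ⟨a, 0⟩ (W.op k ⟨d, 0⟩ (W.word k (B ++ R))) +
        ∑ d ∈ W.borelᶜ, W.x.repr ⁅W.y a, W.x c⁆ d •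
          W.op k ⟨a, 0⟩ (W.op k ⟨d, 0⟩ (W.word k (B ++ R))) := by
    rw [W.mode_eq_sum_op, map_sum, Finset.sum_add_sum_compl]
    simp only [map_smul]
  simp only [h1, Finset.sum_add_distrib]
  refine add_mem (fil_le_low _ _ ?_) (Submodule.sum_mem _ fun a ha => Submodule.sum_mem _ fun d hd =>
    Submodule.smul_mem _ _ (op_mem_low (not_isRest_of_mem_borel ha) ?_))
  · set T := ∑ a ∈ W.borel, ∑ d ∈ W.borel, W.x.repr ⁅W.y a, W.x c⁆ d •
      W.op k ⟨a, 0⟩ (W.op k ⟨d, 0⟩ (W.word k (B ++ R))) with hT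
    -- Antisymmetry turns twice the sum into a sum of commutators, each of which gains 3 in size.
    have h2 : T + T = ∑ a ∈ W.borel, ∑ d ∈ W.borel, W.x.repr ⁅W.y a, W.x c⁆ d •
        (W.op k ⟨a, 0⟩ (W.op k ⟨d, 0⟩ (W.word k (B ++ R))) -
          W.op k ⟨d, 0⟩ (W.op k ⟨a, 0⟩ (W.word k (B ++ R)))) := by
      simp only [smul_sub, Finset.sum_sub_distrib]
      rw [← hT, sub_eq_add_neg, hT]
      congr 1
      rw [Finset.sum_comm, ← Finset.sum_neg_distrib]
      refine Finset.sum_congr rfl fun a _ => ?_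
      rw [← Finset.sum_neg_distrib]
      refine Finset.sum_congr rfl fun d _ => ?_
      rw [repr_lie_y_antisymm, neg_smul]
    have h3 : T = (1 / 2 : ℂ) • (T + T) := by
      rw [← two_smul ℂ T, smul_smul]
      norm_num
    rw [h3, h2]
    exact Submodule.smul_mem _ _ (Submodule.sum_mem _ fun a _ => Submodule.sum_mem _ fun d _ =>
      Submodule.smul_mem _ _ (op_op_sub_mem_fil _ _ hw))
  -- A letter of negative height is moved past `B` and joins `R`, which lowers the height of `R`
  -- without reducing its size.
  · have hd : (W.deg d).2 < 0 := by simpa [borel] using hd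
    have hdr : (⟨d, 0⟩ : Letter W).IsRest := Or.inr hd
    have h2 := fil_le_low (W.size R) (W.degree R).2 (op_wordOp_sub_mem_fil ⟨d, 0⟩ B hR')
    have h3 : W.word k (B ++ ⟨d, 0⟩ :: R) ∈ W.low k (W.size R) (W.degree R).2 := by
      refine word_mem_low hB (fun i hi => ?_) ?_ ?_
      · rcases List.mem_cons.mp hi with rfl | hi
        · exact hdr
        · exact hR i hi
      · rw [← Multiset.cons_coe, size_cons]
        lia
      · rw [← Multiset.cons_coe, degree_cons, Letter.deg_of_isRest hdr, Prod.snd_add]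
        simp only
        lia
    have h4 := add_mem h2 h3
    rw [word_append, word_cons] at h4
    rw [word_append]
    exact (congrArg (· ∈ _) (sub_add_cancel _ _)).mp h4

/-- Carries `y_a(0)` through `B` letter by letter: each passage costs a sum treated by
`sum_op_mode_lie_mem_low` and commutators that gain 3 in size. -/
theorem sum_op_mode_wordOp_mem_low {B R : List (Letter W)} (hB : ∀ i ∈ B, ¬i.IsRest)
    (hR : ∀ i ∈ R, i.IsRest) :
    ∑ a ∈ W.borel, W.op k ⟨a, 0⟩ (mode (W.y a) 0 (W.wordOp k B (W.word k R)) -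
        W.wordOp k B (mode (W.y a) 0 (W.word k R))) ∈
      W.low k (W.size R) (W.degree R).2 := by
  have hw : W.word k R ∈ W.fil k (W.size R) := word_mem_fil le_rfl
  induction B with
  | nil =>
    simp only [wordOp_nil, Module.End.one_apply, sub_self, map_zero, Finset.sum_const_zero]
    exact zero_mem _
  | cons c B ih =>
    have hB' : ∀ i ∈ B, ¬i.IsRest := fun i hi => hB i (List.mem_cons_of_mem _ hi)
    have hc : ¬c.IsRest := hB c (by simp)
    have h1 (a : A) : W.op k ⟨a, 0⟩ (mode (W.y a) 0 (W.wordOp k (c :: B) (W.word k R)) -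
          W.wordOp k (c :: B) (mode (W.y a) 0 (W.word k R))) =
        W.op k ⟨a, 0⟩ (mode ⁅W.y a, W.x c.idx⁆ (-((0 : ℕ) : ℤ) - 1) (W.word k (B ++ R))) +
        (W.op k c (W.op k ⟨a, 0⟩ (mode (W.y a) 0 (W.wordOp k B (W.word k R)) -
          W.wordOp k B (mode (W.y a) 0 (W.word k R)))) +
        (W.op k ⟨a, 0⟩ (W.op k c (mode (W.y a) 0 (W.wordOp k B (W.word k R)) -
          W.wordOp k B (mode (W.y a) 0 (W.word k R)))) -
        W.op k c (W.op k ⟨a, 0⟩ (mode (W.y a) 0 (W.wordOp k B (W.word k R)) -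
          W.wordOp k B (mode (W.y a) 0 (W.word k R)))))) := by
      rw [add_sub_cancel, ← map_add, wordOp_cons, Module.End.mul_apply, Module.End.mul_apply,
        mode_zero_op, Letter.exp_of_not_isRest hc, word_append, map_sub (W.op k c)]
      congr 1
      abel
    simp only [h1, Finset.sum_add_distrib]
    refine add_mem (sum_op_mode_lie_mem_low _ hB' hR) (add_mem ?_ ?_)
    · rw [← map_sum]
      exact op_mem_low hc (ih hB')
    · exact Submodule.sum_mem _ fun a _ => fil_le_low _ _
        (op_op_sub_mem_fil _ _ (mode_zero_wordOp_sub_mem_fil _ hB' hw))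

theorem mode_cartan_word {a : A} (ha : a ∈ W.cartan) {R : List (Letter W)}
    (hR : ∀ i ∈ R, i.IsRest) :
    mode (W.y a) 0 (W.word k R) = (W.degree R).1 a • W.word k R := by
  induction R with
  | nil =>
    rw [word_nil, show (0 : ℤ) = ((0 : ℕ) : ℤ) from rfl, mode_vacuum]
    simp
  | cons i R ih =>
    rw [word_cons, mode_zero_op, ih fun i hi => hR i (List.mem_cons_of_mem _ hi),
      W.lie_y_x _ _ (Finset.mem_filter.mp ha).2, mode_smul, map_smul, ← Multiset.cons_coe,
      degree_cons, Letter.deg_of_isRest (hR i (by simp)), Prod.fst_add, Pi.add_apply, add_comm,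
      add_smul]
    rfl

/-- For Borel indices `a`, bracketing with `y_a` does not raise the height and `y_a(0)` keeps
exponents. So non-Borel letters stay non-Borel and keep their size. -/
theorem mode_word_mem_span (a : A) (ha : a ∈ W.borel) {R : List (Letter W)}
    (hR : ∀ i ∈ R, i.IsRest) :
    mode (W.y a) 0 (W.word k R) ∈ Submodule.span ℂ (W.word k '' {R' | (∀ i ∈ R', i.IsRest) ∧
      W.size R' = W.size R ∧ W.degree R' = W.degree R - W.deg a}) := by
  induction R with
  | nil =>
    rw [word_nil, show (0 : ℤ) = ((0 : ℕ) : ℤ) from rfl, mode_vacuum]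
    exact zero_mem _
  | cons i R ih =>
    have hR' : ∀ i ∈ R, i.IsRest := fun i hi => hR i (List.mem_cons_of_mem _ hi)
    have hi : i.IsRest := hR i (by simp)
    rw [word_cons, mode_zero_op, W.mode_eq_sum_op]
    refine add_mem ?_ (Submodule.sum_mem _ fun c _ => ?_)
    · have h1 := ih hR'
      generalize mode (W.y a) 0 (W.word k R) = w at h1
      induction h1 using Submodule.span_induction with
      | mem w hw =>
        obtain ⟨R', ⟨h1, h2, h3⟩, rfl⟩ := hw
        refine Submodule.subset_span ⟨i :: R', ⟨fun j hj => ?_, ?_, ?_⟩, rfl⟩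
        · rcases List.mem_cons.mp hj with rfl | hj
          · exact hi
          · exact h1 j hj
        · rw [← Multiset.cons_coe, ← Multiset.cons_coe, size_cons, size_cons, h2]
        · rw [← Multiset.cons_coe, ← Multiset.cons_coe, degree_cons, degree_cons, h3, add_sub_assoc]
      | zero => rw [map_zero]; exact zero_mem _
      | add u w _ _ hu hw => rw [map_add]; exact add_mem hu hw
      | smul c u _ hu => rw [map_smul]; exact Submodule.smul_mem _ _ hu
    · by_cases hc : W.x.repr ⁅W.y a, W.x i.idx⁆ c = 0
      · rw [hc, zero_smul]
        exact zero_mem _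
      · have h1 := W.deg_of_lie_y _ _ _ hc
        have ha' : 0 ≤ (W.deg a).2 := (Finset.mem_filter.mp ha).2
        have hcr : (⟨c, i.exp⟩ : Letter W).IsRest := by
          rcases hi with hi | hi
          · exact Or.inl hi
          · right
            rw [h1, Prod.snd_sub]
            lia
        refine Submodule.smul_mem _ _ (Submodule.subset_span
          ⟨⟨c, i.exp⟩ :: R, ⟨fun j hj => ?_, ?_, ?_⟩, rfl⟩)
        · rcases List.mem_cons.mp hj with rfl | hj
          · exact hcr
          · exact hR' j hj
        · rw [← Multiset.cons_coe, ← Multiset.cons_coe, size_cons, size_cons,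
            Letter.size_of_isRest hcr, Letter.size_of_isRest hi]
        · rw [← Multiset.cons_coe, ← Multiset.cons_coe, degree_cons, degree_cons,
            Letter.deg_of_isRest hcr, Letter.deg_of_isRest hi, h1]
          abel

/-- The leading terms of `∑ x_a(-1) y_a(0)`, summed over the Borel subalgebra, on a word. -/
theorem sum_op_mode_word_mem_low {B R : List (Letter W)} (hB : ∀ i ∈ B, ¬i.IsRest)
    (hR : ∀ i ∈ R, i.IsRest) :
    ∑ a ∈ W.borel, W.op k ⟨a, 0⟩ (mode (W.y a) 0 (W.word k (B ++ R))) -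
        ∑ a ∈ W.cartan, (W.degree R).1 a • W.word k ((⟨a, 0⟩ :: B) ++ R) ∈
      W.low k (W.size R) (W.degree R).2 := by
  have h1 := sum_op_mode_wordOp_mem_low (k := k) hB hR
  have hsub : W.cartan ⊆ W.borel := fun a ha => by
    simp only [cartan, borel, Finset.mem_filter, Finset.mem_univ, true_and] at ha ⊢
    exact ha.ge
  have h2 : ∑ a ∈ W.borel, W.op k ⟨a, 0⟩ (W.wordOp k B (mode (W.y a) 0 (W.word k R))) -
      ∑ a ∈ W.cartan, (W.degree R).1 a • W.word k ((⟨a, 0⟩ :: B) ++ R) ∈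
      W.low k (W.size R) (W.degree R).2 := by
    rw [← Finset.sum_sdiff hsub, add_sub_assoc, ← Finset.sum_sub_distrib]
    -- Indices of positive height strictly lower the height of `R`; Cartan indices act on it by its
    -- weight and give the leading terms.
    refine add_mem (Submodule.sum_mem _ fun a ha => ?_) (Submodule.sum_mem _ fun a ha => ?_)
    · obtain ⟨ha, ha'⟩ := Finset.mem_sdiff.mp ha
      have ha' : 0 < (W.deg a).2 := by
        simp only [cartan, borel, Finset.mem_filter, Finset.mem_univ, true_and] at ha ha'
        exact lt_of_le_of_ne ha (Ne.symm ha')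
      have h3 := mode_word_mem_span (k := k) a ha hR
      generalize mode (W.y a) 0 (W.word k R) = w at h3
      induction h3 using Submodule.span_induction with
      | mem w hw =>
        obtain ⟨R', ⟨h3, h4, h5⟩, rfl⟩ := hw
        refine op_mem_low (not_isRest_of_mem_borel ha) ?_
        rw [← word_append]
        refine word_mem_low hB h3 h4.ge ?_
        rw [h5, Prod.snd_sub]
        lia
      | zero => rw [map_zero, map_zero]; exact zero_mem _
      | add u w _ _ hu hw => rw [map_add, map_add]; exact add_mem hu hw
      | smul c u _ hu => rw [map_smul, map_smul]; exact Submodule.smul_mem _ _ hu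
    · rw [mode_cartan_word ha hR, map_smul, map_smul, word_append, wordOp_cons,
        Module.End.mul_apply, sub_self]
      exact zero_mem _
  have h3 := add_mem h1 h2
  simp only [map_sub, Finset.sum_sub_distrib] at h3
  rw [sub_add_sub_cancel] at h3
  rw [word_append]
  exact h3

/-! ### Leading terms of the translation operator. -/

/-- The letter `x_a(-n-2)` following `x_a(-n-1)`. -/
def Letter.succ (i : Letter W) : Letter W := ⟨i.idx, i.exp + 1⟩

theorem Letter.isRest_succ (i : Letter W) : i.succ.IsRest := Or.inl (Nat.succ_pos _)

/-- The derivation of polynomials with `i ↦ (n + 1) i.succ` for letters `i = (a, n)` outside the Borel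
subalgebra. -/
def shift (M : Multiset (Letter W)) : Multiset (Letter W) →₀ ℂ :=
  (M.map fun i => if i.IsRest then single (i.succ ::ₘ M.erase i) (i.exp + 1 : ℂ) else 0).sum

theorem shift_zero : shift (0 : Multiset (Letter W)) = 0 := rfl

theorem shift_cons (i : Letter W) (M : Multiset (Letter W)) :
    shift (i ::ₘ M) = (if i.IsRest then single (i.succ ::ₘ M) (i.exp + 1 : ℂ) else 0) +
      lmapDomain ℂ ℂ (i ::ₘ ·) (shift M) := by
  rw [shift, Multiset.map_cons, Multiset.sum_cons, Multiset.erase_cons_head, shift,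
    map_multiset_sum, Multiset.map_map]
  congr 2
  refine Multiset.map_congr rfl fun j hj => ?_
  rw [Function.comp_apply]
  split_ifs with hj'
  · rw [lmapDomain_apply, mapDomain_single, Multiset.cons_swap]
    congr 2
    by_cases hij : j = i
    · subst hij
      rw [Multiset.erase_cons_head, Multiset.cons_erase hj]
    · rw [Multiset.erase_cons_tail _ (Ne.symm hij)]
  · rw [map_zero]

section

variable {T : Module.End ℂ (UniversalAffine g h k)} {κ : ℂ}

/-- A letter with raised exponent has size at least 3. When `B` consists of Borel letters, which
have size 0, their shifts are therefore errors, and so `shift` ignores them. -/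
theorem map_wordOp_sub_mem_fil
    (hT : ∀ (i : Letter W) v, T (W.op k i v) =
      W.op k i (T v) + (κ * (i.exp + 1)) • W.op k i.succ v)
    (B : List (Letter W)) {t : ℕ} {w : UniversalAffine g h k} (hw : w ∈ W.fil k t) :
    T (W.wordOp k B w) - W.wordOp k B (T w) ∈ W.fil k (t + 3) := by
  induction B with
  | nil =>
    rw [wordOp_nil, Module.End.one_apply, Module.End.one_apply, sub_self]
    exact zero_mem _
  | cons c B ih =>
    rw [wordOp_cons, Module.End.mul_apply, Module.End.mul_apply, hT, add_sub_right_comm, ← map_sub]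
    refine add_mem (op_mem_fil_self c ih) (Submodule.smul_mem _ _
      (fil_mono ?_ (op_mem_fil _ (wordOp_mem_fil B hw))))
    rw [Letter.succ, Letter.size_succ]
    lia

/-- The word `R'` collects the letters that `T` has already passed. Shifting a non-Borel letter adds
2 to the size and reordering the result at least 1 more, which gives the bound 3. -/
theorem poly_wordOp_map_word_mem (hT0 : T (vacuum g h k) = 0)
    (hT : ∀ (i : Letter W) v, T (W.op k i v) =
      W.op k i (T v) + (κ * (i.exp + 1)) • W.op k i.succ v)
    {B : List (Letter W)} (hB : ∀ i ∈ B, ¬i.IsRest) {R' : List (Letter W)}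
    (hR' : ∀ i ∈ R', i.IsRest) {R : List (Letter W)} (hR : ∀ i ∈ R, i.IsRest) :
    W.poly (W.wordOp k (B ++ R') (T (W.word k R))) -
        κ • lmapDomain ℂ ℂ (((B + R' : Multiset (Letter W))) + ·) (shift (R : Multiset (Letter W))) ∈
      W.polySupported fun M => W.size R' + W.size R + 3 ≤ W.size M := by
  induction R generalizing R' with
  | nil =>
    rw [word_nil, hT0, Multiset.coe_nil, shift_zero, map_zero, map_zero, map_zero, smul_zero,
      sub_zero]
    exact zero_mem _
  | cons i R ih =>
    have hi : i.IsRest := hR i (by simp)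
    have hR0 : ∀ j ∈ R, j.IsRest := fun j hj => hR j (List.mem_cons_of_mem _ hj)
    have h1 := ih (R' := R' ++ [i]) (fun j hj => by
      rcases List.mem_append.mp hj with hj | hj
      · exact hR' j hj
      · rw [List.mem_singleton.mp hj]; exact hi) hR0
    have h2 := W.poly_word_append_mem (k := k) B (R' ++ i.succ :: R) hB (fun j hj => by
      rcases List.mem_append.mp hj with hj | hj
      · exact hR' j hj
      · rcases List.mem_cons.mp hj with rfl | hj
        · exact i.isRest_succ
        · exact hR0 j hj)
    have h3 : W.wordOp k (B ++ R') (T (W.word k (i :: R))) =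
        W.wordOp k (B ++ (R' ++ [i])) (T (W.word k R)) +
          (κ * (i.exp + 1)) • W.word k (B ++ (R' ++ i.succ :: R)) := by
      rw [word_cons, hT, map_add, map_smul, ← List.append_assoc B R' [i], wordOp_append _ _ [i],
        ← List.append_assoc, word_append]
      rfl
    have hs : W.size R' + i.succ.size + W.size R = W.size R' + W.size (i :: R : List (Letter W)) + 2 := by
      rw [← Multiset.cons_coe, size_cons, Letter.size_of_isRest hi, Letter.succ, Letter.size_succ]
      lia
    have h4 : shift ((i :: R : List (Letter W)) : Multiset (Letter W)) =
        single (i.succ ::ₘ (R : Multiset (Letter W))) (i.exp + 1 : ℂ) +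
          lmapDomain ℂ ℂ (i ::ₘ ·) (shift (R : Multiset (Letter W))) := by
      rw [← Multiset.cons_coe, shift_cons, if_pos hi]
    have h5 : lmapDomain ℂ ℂ (((B + R' : Multiset (Letter W))) + ·)
        (lmapDomain ℂ ℂ (i ::ₘ ·) (shift (R : Multiset (Letter W)))) =
        lmapDomain ℂ ℂ (((B + (R' ++ [i] : List (Letter W)) : Multiset (Letter W))) + ·)
          (shift (R : Multiset (Letter W))) := by
      rw [lmapDomain_apply, lmapDomain_apply, lmapDomain_apply, ← mapDomain_comp]
      congr 1
      funext M
      rw [Function.comp_apply, ← Multiset.coe_add, ← add_assoc, add_assoc _ _ M]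
      rfl
    have h6 := add_mem (W.polySupported_mono (fun M hM => ?_) h1)
      (Submodule.smul_mem _ (κ * (i.exp + 1)) (W.polySupported_mono
        (q := fun M => W.size R' + W.size (i :: R : List (Letter W)) + 3 ≤ W.size M)
        (fun M hM => ?_) h2))
    · rw [h3, h4, map_add, map_add, map_smul, h5, lmapDomain_apply _ _ _ (single _ _),
        mapDomain_single, smul_add]
      convert h6 using 1
      rw [smul_sub, smul_single, smul_single, smul_eq_mul, smul_eq_mul, mul_one,
        show (B + (R' ++ i.succ :: R : List (Letter W)) : Multiset (Letter W)) =
          B + R' + i.succ ::ₘ (R : Multiset (Letter W)) by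
          rw [← Multiset.coe_add, ← Multiset.cons_coe, add_assoc] ]
      abel
    · rw [← Multiset.coe_add, size_add] at hM
      rw [← Multiset.cons_coe, size_cons]
      have : W.size (([i] : List (Letter W)) : Multiset (Letter W)) = i.size := by
        rw [← Multiset.cons_coe, size_cons]
        rfl
      lia
    · rw [← Multiset.coe_add, size_add, ← Multiset.cons_coe, size_cons] at hM
      lia

/-- The leading term of a multiple of the translation operator on a word. -/
theorem poly_map_word_mem (hT0 : T (vacuum g h k) = 0)
    (hT : ∀ (i : Letter W) v, T (W.op k i v) =
      W.op k i (T v) + (κ * (i.exp + 1)) • W.op k i.succ v)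
    {B R : List (Letter W)} (hB : ∀ i ∈ B, ¬i.IsRest) (hR : ∀ i ∈ R, i.IsRest) :
    W.poly (T (W.word k (B ++ R))) - κ • shift (B + R : Multiset (Letter W)) ∈
      W.polySupported fun M => W.size R + 3 ≤ W.size M := by
  have h1 := poly_wordOp_map_word_mem hT0 hT hB (R' := []) (by simp) hR
  have h2 := poly_mem_of_mem_fil (map_wordOp_sub_mem_fil hT B
    (word_mem_fil (k := k) (l := R) le_rfl))
  have h3 := add_mem h2 (W.polySupported_mono (fun M hM => ?_) h1)
  · have h4 : lmapDomain ℂ ℂ (((B + ([] : List (Letter W)) : Multiset (Letter W))) + ·)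
        (shift (R : Multiset (Letter W))) = shift (B + R : Multiset (Letter W)) := by
      clear h1 h2 h3
      induction B with
      | nil =>
        simp only [Multiset.coe_nil, zero_add, lmapDomain_apply]
        exact mapDomain_id
      | cons i B ih =>
        have h5 := ih fun j hj => hB j (List.mem_cons_of_mem _ hj)
        rw [← Multiset.cons_coe, Multiset.cons_add, Multiset.cons_add, shift_cons,
          if_neg (hB i (by simp)), zero_add, ← h5]
        simp only [lmapDomain_apply]
        rw [← mapDomain_comp]
        congr 1
        funext M
        simp [-Multiset.cons_coe]
    rw [h4, List.append_nil, map_sub, sub_add_sub_cancel, ← word_append] at h3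
    exact h3
  · simpa using hM

end

end WeightBasis

/-! ### The Sugawara operator. -/

namespace UniversalAffine

variable {g : Type*} [LieRing g] [LieAlgebra ℂ g] {h k : ℂ}

variable (g h k) in
/-- The product `x(q) y(r)` as a bilinear function of `x` and `y`. -/
def modeMul (q r : ℤ) : g →ₗ[ℂ] g →ₗ[ℂ] Module.End ℂ (UniversalAffine g h k) :=
  (LinearMap.mul ℂ (Module.End ℂ (UniversalAffine g h k))).compl₁₂ (modeₗ g h k q) (modeₗ g h k r)

theorem modeMul_apply (q r : ℤ) (x y : g) :
    modeMul g h k q r x y = mode x q * mode y r := rfl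

theorem mode_mul_mode (x y : g) (m n : ℤ) :
    (mode x m * mode y n : Module.End ℂ (UniversalAffine g h k)) = mode y n * mode x m +
      mode ⁅x, y⁆ (m + n) +
        (if m + n = 0 then (m : ℂ) * (normalizedForm g h x y * k) else 0) • 1 := by
  ext v
  have h1 := mode_commutator (k := k) x y m n v
  rw [sub_eq_iff_eq_add'] at h1
  rw [Module.End.mul_apply, h1, add_assoc]
  rfl

end UniversalAffine

namespace WeightBasis

open UniversalAffine

variable {g : Type*} [LieRing g] [LieAlgebra ℂ g] {h k : ℂ} {A : Type*} [Fintype A] [DecidableEq A]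
  (W : WeightBasis g h A)

theorem sum_form_y_smul_x (z : g) : ∑ c, normalizedForm g h z (W.y c) • W.x c = z := by
  conv_rhs => rw [← W.x.sum_repr z]
  simp only [repr_eq_form]

/-- The tensor `∑ x a ⊗ y a` is symmetric. -/
theorem sum_x_y_symm {V : Type*} [AddCommGroup V] [Module ℂ V] (f : g →ₗ[ℂ] g →ₗ[ℂ] V) :
    ∑ a, f (W.x a) (W.y a) = ∑ a, f (W.y a) (W.x a) := by
  have h1 (a : A) : f (W.x a) (W.y a) =
      ∑ c, normalizedForm g h (W.y a) (W.y c) • f (W.x a) (W.x c) := by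
    conv_lhs => rw [← W.sum_form_y_smul_x (W.y a)]
    simp only [map_sum, map_smul]
  have h2 (a : A) : f (W.y a) (W.x a) =
      ∑ c, normalizedForm g h (W.y a) (W.y c) • f (W.x c) (W.x a) := by
    conv_lhs => rw [← W.sum_form_y_smul_x (W.y a)]
    simp only [map_sum, map_smul, LinearMap.sum_apply, LinearMap.smul_apply]
  simp only [h1, h2]
  rw [Finset.sum_comm]
  refine Finset.sum_congr rfl fun a _ => Finset.sum_congr rfl fun c _ => ?_
  rw [form_symm]

theorem sum_form_x_smul_y (z : g) : ∑ c, normalizedForm g h z (W.x c) • W.y c = z := by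
  have h1 := W.sum_x_y_symm
    ((LinearMap.lsmul ℂ g).flip.compl₂ (normalizedForm g h z))
  simp only [LinearMap.compl₂_apply, LinearMap.flip_apply,
    LinearMap.lsmul_apply] at h1
  rw [← h1, W.sum_form_y_smul_x]

/-- The tensor `∑ x a ⊗ y a` is invariant. -/
theorem sum_lie_x_y {V : Type*} [AddCommGroup V] [Module ℂ V] (f : g →ₗ[ℂ] g →ₗ[ℂ] V) (z : g) :
    ∑ a, f ⁅W.x a, z⁆ (W.y a) = -∑ a, f (W.x a) ⁅W.y a, z⁆ := by
  have h1 (a : A) : f ⁅W.x a, z⁆ (W.y a) =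
      ∑ c, normalizedForm g h ⁅W.x a, z⁆ (W.y c) • f (W.x c) (W.y a) := by
    conv_lhs => rw [← W.sum_form_y_smul_x ⁅W.x a, z⁆]
    simp only [map_sum, map_smul, LinearMap.sum_apply, LinearMap.smul_apply]
  have h2 (a : A) : f (W.x a) ⁅W.y a, z⁆ =
      ∑ c, normalizedForm g h ⁅W.y a, z⁆ (W.x c) • f (W.x a) (W.y c) := by
    conv_lhs => rw [← W.sum_form_x_smul_y ⁅W.y a, z⁆]
    simp only [map_sum, map_smul]
  simp only [h1, h2]
  rw [Finset.sum_comm]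
  simp only [← Finset.sum_neg_distrib, ← neg_smul]
  refine Finset.sum_congr rfl fun a _ => Finset.sum_congr rfl fun c _ => ?_
  rw [← lie_skew, map_neg, LinearMap.neg_apply, form_lie_left, neg_neg, form_symm, ← lie_skew, map_neg,
    LinearMap.neg_apply]

/-- The Casimir element acts on the adjoint representation by `2 h`. -/
theorem sum_lie_lie (hh : h ≠ 0) (z : g) : ∑ a, ⁅⁅W.x a, z⁆, W.y a⁆ = -(2 * h) • z := by
  apply W.x.repr.injective
  ext d
  rw [repr_eq_form, repr_eq_form, map_sum, LinearMap.sum_apply, map_smul, LinearMap.smul_apply]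
  have h1 (a : A) : normalizedForm g h ⁅⁅W.x a, z⁆, W.y a⁆ (W.y d) =
      -W.x.repr ⁅W.y d, ⁅z, W.x a⁆⁆ a := by
    rw [repr_eq_form, form_lie_left (W.y d), ← lie_skew, map_neg, LinearMap.neg_apply, form_lie_left,
      ← lie_skew (W.x a) z, ← lie_skew (W.y a) (W.y d)]
    simp only [map_neg, LinearMap.neg_apply, neg_neg]
  simp only [h1, Finset.sum_neg_distrib]
  have h2 : killingForm ℂ g (W.y d) z = ∑ a, W.x.repr ⁅W.y d, ⁅z, W.x a⁆⁆ a := by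
    rw [killingForm_apply_apply, LinearMap.trace_eq_matrix_trace ℂ W.x, Matrix.trace]
    simp [LinearMap.toMatrix_apply]
  rw [← h2, form_symm, normalizedForm, LinearMap.smul_apply, LinearMap.smul_apply, smul_eq_mul,
    smul_eq_mul]
  field_simp

variable (k) in
/-- The operator `∑ x a (q) y a (r)`. -/
def casimirMode (q r : ℤ) : Module.End ℂ (UniversalAffine g h k) :=
  ∑ a, mode (W.x a) q * mode (W.y a) r

variable (k) in
/-- The operator `∑ [x a, z](q) y a (r)`. -/
def casimirLieMode (z : g) (q r : ℤ) : Module.End ℂ (UniversalAffine g h k) :=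
  ∑ a, mode ⁅W.x a, z⁆ q * mode (W.y a) r

/-- Invariance of `∑ x a ⊗ y a` turns the brackets with `y a` into brackets with `x a`, up to sign.
The central terms recombine to `z` by duality of the bases. -/
theorem casimirMode_mul_mode (z : g) (q r n : ℤ) :
    W.casimirMode k q r * mode z n = mode z n * W.casimirMode k q r +
      (W.casimirLieMode k z (q + n) r - W.casimirLieMode k z q (r + n)) +
        ((if q + n = 0 then (q * k : ℂ) else 0) • mode z r +
          (if r + n = 0 then (r * k : ℂ) else 0) • mode z q) := by
  have h1 (a : A) : mode (W.x a) q * mode (W.y a) r * mode z n =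
      (mode z n * (mode (W.x a) q * mode (W.y a) r) + (mode ⁅W.x a, z⁆ (q + n) * mode (W.y a) r +
        mode (W.x a) q * mode ⁅W.y a, z⁆ (r + n)) +
        ((if q + n = 0 then (q * k : ℂ) else 0) • normalizedForm g h z (W.x a) • mode (W.y a) r +
          (if r + n = 0 then (r * k : ℂ) else 0) • normalizedForm g h z (W.y a) • mode (W.x a) q) :
        Module.End ℂ (UniversalAffine g h k)) := by
    rw [mul_assoc, mode_mul_mode (W.y a), mul_add, mul_add, ← mul_assoc, mode_mul_mode (W.x a) z]
    simp only [add_mul, mul_assoc, mul_smul_comm, smul_mul_assoc, one_mul, mul_one, smul_smul,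
      form_symm z, ite_mul, zero_mul]
    have e1 : (q : ℂ) * (normalizedForm g h (W.x a) z * k) =
      (q : ℂ) * (k * normalizedForm g h (W.x a) z) := by ring
    have e2 : (r : ℂ) * (normalizedForm g h (W.y a) z * k) =
      (r : ℂ) * (k * normalizedForm g h (W.y a) z) := by ring
    rw [e1, e2]
    abel
  have h2 := W.sum_lie_x_y (modeMul g h k q (r + n)) z
  simp only [modeMul_apply] at h2
  have h3 (m : ℤ) : ∑ a, normalizedForm g h z (W.x a) • mode (W.y a) m =
      (mode z m : Module.End ℂ (UniversalAffine g h k)) := by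
    conv_rhs => rw [← modeₗ_apply, ← W.sum_form_x_smul_y z, map_sum]
    simp only [map_smul, modeₗ_apply]
  have h4 (m : ℤ) : ∑ a, normalizedForm g h z (W.y a) • mode (W.x a) m =
      (mode z m : Module.End ℂ (UniversalAffine g h k)) := by
    conv_rhs => rw [← modeₗ_apply, ← W.sum_form_y_smul_x z, map_sum]
    simp only [map_smul, modeₗ_apply]
  simp only [casimirMode, casimirLieMode, Finset.sum_mul, Finset.mul_sum, h1, h2,
    Finset.sum_add_distrib, sub_neg_eq_add, ← Finset.smul_sum, h3, h4]

/-- By invariance and symmetry of the tensor the sum is a commutator, namely the mode of `∑ [[x a,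
z], y a]`, and the Casimir value applies. No central term occurs since `q + r ≠ 0`. -/
theorem casimirLieMode_add_swap (hh : h ≠ 0) (z : g) {q r : ℤ} (hqr : q + r ≠ 0) :
    W.casimirLieMode k z q r + W.casimirLieMode k z r q = -(2 * h) • mode z (q + r) := by
  have h1 := W.sum_lie_x_y (modeMul g h k q r) z
  have h2 := W.sum_x_y_symm ((modeMul g h k q r).compl₂
    (-(LieAlgebra.ad ℂ g z : g →ₗ[ℂ] g)))
  simp only [LinearMap.compl₂_apply, LinearMap.neg_apply, LieAlgebra.ad_apply, lie_skew,
    modeMul_apply] at h1 h2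
  rw [casimirLieMode, h1, h2, casimirLieMode, neg_add_eq_sub, ← Finset.sum_sub_distrib,
    ← modeₗ_apply, ← map_smul, ← W.sum_lie_lie hh, map_sum]
  refine Finset.sum_congr rfl fun a _ => ?_
  rw [mode_mul_mode, if_neg (by lia), zero_smul, add_zero, add_sub_cancel_left, add_comm r q]
  rfl

theorem exists_forall_forall_mode_eq_zero (W : WeightBasis g h A) (v : UniversalAffine g h k) :
    ∃ N : ℕ, ∀ n : ℤ, N ≤ n → ∀ x : g, mode x n v = 0 := by
  choose N hN using fun a => exists_forall_mode_eq_zero (W.x a) v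
  refine ⟨∑ a, N a, fun n hn x => ?_⟩
  rw [W.mode_eq_sum]
  refine Finset.sum_eq_zero fun a _ => ?_
  have := Finset.single_le_sum (f := N) (fun _ _ => Nat.zero_le _) (Finset.mem_univ a)
  rw [hN a n (by lia), smul_zero]

theorem casimirMode_apply_eq_zero {r : ℤ} {v : UniversalAffine g h k}
    (hv : ∀ x : g, mode x r v = 0) (q : ℤ) : W.casimirMode k q r v = 0 := by
  rw [casimirMode, LinearMap.sum_apply]
  exact Finset.sum_eq_zero fun a _ => by rw [Module.End.mul_apply, hv, map_zero]

theorem casimirLieMode_apply_eq_zero {r : ℤ} {v : UniversalAffine g h k}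
    (hv : ∀ x : g, mode x r v = 0) (z : g) (q : ℤ) : W.casimirLieMode k z q r v = 0 := by
  rw [casimirLieMode, LinearMap.sum_apply]
  exact Finset.sum_eq_zero fun a _ => by rw [Module.End.mul_apply, hv, map_zero]

theorem finsum_casimirMode {v : UniversalAffine g h k} {N : ℕ}
    (hN : ∀ n : ℤ, N ≤ n → ∀ x : g, mode x n v = 0) :
    ∑ᶠ j : ℕ, W.casimirMode k (-1 - j) j v =
      ∑ j ∈ Finset.range N, W.casimirMode k (-1 - j) j v := by
  apply finsum_eq_sum_of_support_subset
  intro j hj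
  simp only [Finset.coe_range, Set.mem_Iio]
  by_contra hlt
  exact hj (W.casimirMode_apply_eq_zero (hN j (by lia)) _)

variable (k) in
/-- The operator `∑ x a (-1 - j) y a (j)`, over `j ≥ 0`, proportional to the mode `L(-1)` of the Sugawara
field. -/
def sugawara : Module.End ℂ (UniversalAffine g h k) where
  toFun v := ∑ᶠ j : ℕ, W.casimirMode k (-1 - j) j v
  map_add' v w := by
    obtain ⟨N₁, h₁⟩ := W.exists_forall_forall_mode_eq_zero v
    obtain ⟨N₂, h₂⟩ := W.exists_forall_forall_mode_eq_zero w
    rw [W.finsum_casimirMode (N := N₁ + N₂) fun n hn => h₁ n (by lia),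
      W.finsum_casimirMode (N := N₁ + N₂) fun n hn => h₂ n (by lia),
      W.finsum_casimirMode (N := N₁ + N₂) fun n hn x => by
        rw [map_add, h₁ n (by lia), h₂ n (by lia), add_zero] ]
    simp only [map_add, Finset.sum_add_distrib]
  map_smul' c v := by
    rw [RingHom.id_apply, smul_finsum]
    simp only [map_smul]

theorem sugawara_apply {v : UniversalAffine g h k} {N : ℕ}
    (hN : ∀ n : ℤ, N ≤ n → ∀ x : g, mode x n v = 0) :
    W.sugawara k v = ∑ j ∈ Finset.range N, W.casimirMode k (-1 - j) j v :=
  W.finsum_casimirMode hN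

theorem sugawara_vacuum : W.sugawara k (vacuum g h k) = 0 := by
  rw [W.sugawara_apply (N := 0) fun n hn x => ?_, Finset.range_zero, Finset.sum_empty]
  obtain ⟨m, rfl⟩ := Int.eq_ofNat_of_zero_le (by simpa using hn)
  exact mode_vacuum x m

/-- The commutators of the summands telescope, leaving `p` terms `G j`. These pair up under `j ↦ p -
1 - j` and contribute `h p`; the only central term, at `j = p`, contributes `k p`. -/
theorem sugawara_mode (hh : h ≠ 0) (z : g) (p : ℕ) (v : UniversalAffine g h k) :
    W.sugawara k (mode z (-(p : ℤ)) v) =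
      mode z (-(p : ℤ)) (W.sugawara k v) + ((k + h) * p) • mode z (-(p : ℤ) - 1) v := by
  obtain ⟨N₁, h₁⟩ := W.exists_forall_forall_mode_eq_zero v
  obtain ⟨N₂, h₂⟩ := W.exists_forall_forall_mode_eq_zero (mode z (-(p : ℤ)) v)
  -- Large enough to end both sums, to include `j = p`, and to make `G (N + j)` vanish, where the
  -- right mode is `N + j - p ≥ N₁`.
  set N := N₁ + N₂ + p + 1 with hN
  rw [W.sugawara_apply (N := N) fun n hn => h₁ n (by lia),
    W.sugawara_apply (N := N) fun n hn => h₂ n (by lia)]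
  set G : ℕ → UniversalAffine g h k := fun j => W.casimirLieMode k z (-1 - j) (j - p) v with hG
  have e1 (j : ℕ) : W.casimirMode k (-1 - j) j (mode z (-(p : ℤ)) v) =
      mode z (-(p : ℤ)) (W.casimirMode k (-1 - j) j v) + (G (p + j) - G j) +
        if j = p then (k * p) • mode z (-(p : ℤ) - 1) v else 0 := by
    have := DFunLike.congr_fun (W.casimirMode_mul_mode (k := k) z (-1 - j) j (-(p : ℤ))) v
    rw [if_neg (by lia), zero_smul, zero_add] at this
    rw [← Module.End.mul_apply, this, LinearMap.add_apply, LinearMap.add_apply, LinearMap.sub_apply,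
      hG]
    simp only
    rw [show -1 - ((p + j : ℕ) : ℤ) = -1 - j + -(p : ℤ) by push_cast; ring,
      show ((p + j : ℕ) : ℤ) - p = j by push_cast; ring, Module.End.mul_apply]
    congr 1
    by_cases hj : j = p
    · subst hj
      rw [if_pos (by lia), if_pos rfl, LinearMap.smul_apply, show -1 - (j : ℤ) = -(j : ℤ) - 1 by ring,
        mul_comm k]
      simp
    · rw [if_neg (by lia), if_neg hj, zero_smul, LinearMap.zero_apply]
  have e2 : ∑ j ∈ Finset.range N, (G (p + j) - G j) = -∑ j ∈ Finset.range p, G j := by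
    have a1 := Finset.sum_range_add G p N
    have a2 := Finset.sum_range_add G N p
    rw [add_comm N p, a1, Finset.sum_eq_zero (s := Finset.range p) (f := fun j => G (N + j))
      fun j _ => W.casimirLieMode_apply_eq_zero (h₁ _ (by push_cast; lia)) _ _, add_zero] at a2
    rw [Finset.sum_sub_distrib, ← a2]
    abel
  -- Reflection `j ↦ p - 1 - j` exchanges the two mode indices `-1 - j` and `j - p` of `G j`.
  have e3 : (2 : ℂ) • ∑ j ∈ Finset.range p, G j = (2 : ℂ) • (-(h * p)) • mode z (-(p : ℤ) - 1) v := by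
    rw [two_smul]
    nth_rw 2 [← Finset.sum_range_reflect]
    rw [← Finset.sum_add_distrib, Finset.sum_congr rfl fun j hj => show G j + G (p - 1 - j) =
      -(2 * h) • mode z (-(p : ℤ) - 1) v from ?_]
    · rw [Finset.sum_const, Finset.card_range, ← Nat.cast_smul_eq_nsmul ℂ, smul_smul, smul_smul]
      congr 1
      ring
    · have hj' := Finset.mem_range.mp hj
      have := DFunLike.congr_fun (W.casimirLieMode_add_swap (k := k) hh z (q := -1 - j) (r := j - p)
        (by lia)) v
      rw [LinearMap.add_apply, LinearMap.smul_apply,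
        show -1 - (j : ℤ) + (j - p) = -(p : ℤ) - 1 by ring] at this
      rw [← this, hG]
      simp only
      congr 3
      · lia
      · lia
  have e4 := smul_right_injective _ (two_ne_zero (α := ℂ)) e3
  rw [Finset.sum_congr rfl fun j _ => e1 j, Finset.sum_add_distrib, Finset.sum_add_distrib,
    ← map_sum, e2, e4, Finset.sum_ite_eq', if_pos (Finset.mem_range.mpr (by lia)), add_assoc,
    ← neg_smul, ← add_smul]
  congr 2
  ring

theorem sugawara_op (hh : h ≠ 0) (i : Letter W) (v : UniversalAffine g h k) :
    W.sugawara k (W.op k i v) =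
      W.op k i (W.sugawara k v) + ((k + h) * (i.exp + 1)) • W.op k i.succ v := by
  have h1 := W.sugawara_mode (k := k) hh (W.x i.idx) (i.exp + 1) v
  push_cast at h1
  rw [neg_add'] at h1
  rw [op, h1, op, Letter.succ]
  push_cast
  rw [neg_add']

/-- On a vector that is annihilated by `t g[t]`, the Sugawara operator is given by its first term, and
only the terms of nonnegative height contribute when the vector is annihilated by the others. -/
theorem sugawara_apply_of_singular {v : UniversalAffine g h k}
    (h1 : ∀ n : ℕ, 1 ≤ n → ∀ x : g, mode x n v = 0)
    (h2 : ∀ a, (W.deg a).2 < 0 → mode (W.y a) 0 v = 0) :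
    W.sugawara k v = ∑ a ∈ W.borel, W.op k ⟨a, 0⟩ (mode (W.y a) 0 v) := by
  rw [W.sugawara_apply (N := 1) fun n hn x => ?_, Finset.sum_range_one, casimirMode,
    LinearMap.sum_apply]
  · symm
    apply Finset.sum_subset (Finset.subset_univ _)
    intro a _ ha
    simp only [borel, Finset.mem_filter, Finset.mem_univ, true_and, not_le] at ha
    rw [h2 a ha, map_zero]
  · obtain ⟨m, rfl⟩ := Int.eq_ofNat_of_zero_le (show 0 ≤ n by lia)
    exact h1 m (by lia) x

end WeightBasis

/-! ### Comparison of coefficients in the equation for singular vectors. -/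

namespace WeightBasis

open UniversalAffine

variable {g : Type*} [LieRing g] [LieAlgebra ℂ g] {h k : ℂ} {A : Type*} [Fintype A] [DecidableEq A]
  {W : WeightBasis g h A}

theorem not_isRest_of_mem_cartan {a : A} (ha : a ∈ W.cartan) : ¬(⟨a, 0⟩ : Letter W).IsRest := by
  refine not_isRest_of_mem_borel ?_
  simp only [cartan, borel, Finset.mem_filter, Finset.mem_univ, true_and] at ha ⊢
  exact ha.ge

/-- If all Cartan values vanish, so does the weight, and with it the height, which is a linear
function of the weight. -/
theorem exists_weight_apply_ne_zero {M : Multiset (Letter W)} (hM : W.degree M ≠ 0) :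
    ∃ a ∈ W.cartan, (W.degree M).1 a ≠ 0 := by
  by_contra! h1
  obtain ⟨r, hr⟩ := W.height_eq
  have h2 (M : Multiset (Letter W)) : ∑ c, r c * (W.degree M).1 c = (W.degree M).2 ∧
      ∀ c, (W.deg c).2 ≠ 0 → (W.degree M).1 c = 0 := by
    induction M using Multiset.induction_on with
    | empty => simp
    | cons i M ih =>
      have h3 : ∑ c, r c * i.deg.1 c = i.deg.2 ∧ ∀ c, (W.deg c).2 ≠ 0 → i.deg.1 c = 0 := by
        by_cases hi : i.IsRest
        · rw [Letter.deg_of_isRest hi]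
          exact ⟨hr _, fun c hc => W.weight_apply_eq_zero c _ hc⟩
        · rw [Letter.deg_of_not_isRest hi]
          simp
      rw [degree_cons]
      refine ⟨?_, fun c hc => ?_⟩
      · simp only [Prod.fst_add, Prod.snd_add, Pi.add_apply, mul_add, Finset.sum_add_distrib, ih.1, h3.1,
          Int.cast_add]
      · simp only [Prod.fst_add, Pi.add_apply, ih.2 c hc, h3.2 c hc, add_zero]
  have h4 : (W.degree M).1 = 0 := by
    funext c
    by_cases hc : (W.deg c).2 = 0
    · exact h1 c (by simpa [cartan] using hc)
    · exact (h2 M).2 c hc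
  have h5 := (h2 M).1
  rw [h4] at h5
  simp only [Pi.zero_apply, mul_zero, Finset.sum_const_zero] at h5
  exact hM (Prod.ext h4 (by exact_mod_cast h5.symm))

theorem shift_mem (M : Multiset (Letter W)) : shift M ∈ W.polySupported fun N =>
    ∃ i ∈ M, i.IsRest ∧ N = i.succ ::ₘ M.erase i := by
  rw [shift]
  refine multiset_sum_mem _ fun f hf => ?_
  obtain ⟨i, hi, rfl⟩ := Multiset.mem_map.mp hf
  split_ifs with h1
  · exact W.single_mem_polySupported ⟨i, hi, h1, rfl⟩ _
  · exact zero_mem _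

theorem size_succ_cons_erase {M : Multiset (Letter W)} {i : Letter W} (hi : i ∈ M) (h : i.IsRest) :
    W.size (i.succ ::ₘ M.erase i) = W.size M + 2 := by
  conv_rhs => rw [← Multiset.cons_erase hi]
  rw [size_cons, size_cons, Letter.size_of_isRest h, Letter.size_of_isRest i.isRest_succ, Letter.succ]
  lia

theorem degree_succ_cons_erase {M : Multiset (Letter W)} {i : Letter W} (hi : i ∈ M)
    (h : i.IsRest) : W.degree (i.succ ::ₘ M.erase i) = W.degree M := by
  conv_rhs => rw [← Multiset.cons_erase hi]
  rw [degree_cons, degree_cons, Letter.deg_of_isRest h, Letter.deg_of_isRest i.isRest_succ,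
    Letter.succ]

variable (W) in
/-- The monomials that may occur in the error terms of `poly_sub_word_sort_mem`. -/
def IsError (M N : Multiset (Letter W)) : Prop :=
  (W.size M ≤ W.size N ∧ (W.degree N).2 < (W.degree M).2) ∨
    (W.size M + 1 ≤ W.size N ∧ W.degree N = W.degree M ∧ W.degree M ≠ 0) ∨
    W.size M + 3 ≤ W.size N

/-- The difference of both sides of the equation for singular vectors, on a basis vector. -/
theorem poly_sub_word_sort_mem {T : Module.End ℂ (UniversalAffine g h k)} {κ : ℂ}
    (hT0 : T (vacuum g h k) = 0)
    (hT : ∀ (i : Letter W) v, T (W.op k i v) =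
      W.op k i (T v) + (κ * (i.exp + 1)) • W.op k i.succ v) (M : Multiset (Letter W)) :
    W.poly (∑ a ∈ W.borel, W.op k ⟨a, 0⟩ (mode (W.y a) 0 (W.word k (M.sort (· ≤ ·)))) -
        T (W.word k (M.sort (· ≤ ·)))) -
      (∑ a ∈ W.cartan, (W.degree M).1 a • single (⟨a, 0⟩ ::ₘ M) 1 - κ • shift M) ∈
      W.polySupported (W.IsError M) := by
  set B := M.filter fun i => ¬i.IsRest with hBdef
  set R := M.filter fun i => i.IsRest with hRdef
  have hM : B + R = M := by
    rw [add_comm]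
    exact Multiset.filter_add_not _ _
  have hB : ∀ i ∈ B, ¬i.IsRest := fun i hi => (Multiset.mem_filter.mp hi).2
  have hR : ∀ i ∈ R, i.IsRest := fun i hi => (Multiset.mem_filter.mp hi).2
  have hsort : M.sort (· ≤ ·) = B.sort (· ≤ ·) ++ R.sort (· ≤ ·) := by
    refine List.Perm.eq_of_pairwise' (Multiset.pairwise_sort _ _) (W.sort_append hB hR) ?_
    rw [← Multiset.coe_eq_coe, ← Multiset.coe_add, Multiset.sort_eq, Multiset.sort_eq,
      Multiset.sort_eq, hM]
  have hBl : ∀ i ∈ B.sort (· ≤ ·), ¬i.IsRest := fun i hi => hB i (by simpa using hi)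
  have hRl : ∀ i ∈ R.sort (· ≤ ·), i.IsRest := fun i hi => hR i (by simpa using hi)
  have hsize : W.size R = W.size M := by
    rw [← hM, size_add, W.size_of_forall_not_isRest hB, zero_add]
  have hdeg : W.degree R = W.degree M := by
    rw [← hM, degree_add, W.degree_of_forall_not_isRest hB, zero_add]
  have h1 := poly_mem_of_mem_low (sum_op_mode_word_mem_low (k := k) hBl hRl)
  have h2 := poly_map_word_mem hT0 hT hBl hRl
  have h3 (a : A) (ha : a ∈ W.cartan) := W.poly_word_append_mem (k := k) (⟨a, 0⟩ :: B.sort (· ≤ ·))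
    (R.sort (· ≤ ·)) (fun i hi => by
      rcases List.mem_cons.mp hi with rfl | hi
      · exact not_isRest_of_mem_cartan ha
      · exact hBl i hi) hRl
  simp only [← Multiset.cons_coe, Multiset.sort_eq, Multiset.cons_add, hM, hsize, hdeg, ← hsort] at h1 h2 h3
  have h4 : ∑ a ∈ W.cartan, (W.degree M).1 a •
      (W.poly (W.word k ((⟨a, 0⟩ :: B.sort (· ≤ ·)) ++ R.sort (· ≤ ·))) -
        single (⟨a, 0⟩ ::ₘ M) 1) ∈ W.polySupported (W.IsError M) := by
    refine Submodule.sum_mem _ fun a ha => ?_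
    -- The reordering error of the Cartan term carries the weight as a factor. So errors of equal
    -- degree occur only when that degree is nonzero, which is essential in `exists_size_eq_zero`.
    by_cases h0 : (W.degree M).1 a = 0
    · rw [h0, zero_smul]
      exact zero_mem _
    · refine Submodule.smul_mem _ _ (W.polySupported_mono (fun N hN => ?_) (h3 a ha))
      rcases hN with hN | hN
      · refine Or.inr (Or.inl ⟨hN.1, hN.2, fun h5 => h0 ?_⟩)
        rw [h5]
        rfl
      · exact Or.inr (Or.inr hN)
  have h5 := add_mem (sub_mem (W.polySupported_mono (q := W.IsError M) (fun N hN => ?_) h1)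
    (W.polySupported_mono (q := W.IsError M) (fun N hN => Or.inr (Or.inr hN)) h2)) h4
  · refine (congrArg (· ∈ _) ?_).mp h5
    simp only [map_sub, map_sum, map_smul, smul_sub, Finset.sum_sub_distrib]
    abel
  · rcases hN with hN | hN
    · exact Or.inl hN
    · exact Or.inr (Or.inr hN)

section Singular

variable {T : Module.End ℂ (UniversalAffine g h k)} {κ : ℂ} {v : UniversalAffine g h k}

/-- The coefficients of the equation for singular vectors. -/
theorem sum_coeff_eq_zero (hT0 : T (vacuum g h k) = 0)
    (hT : ∀ (i : Letter W) v, T (W.op k i v) =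
      W.op k i (T v) + (κ * (i.exp + 1)) • W.op k i.succ v)
    (hv : T v = ∑ a ∈ W.borel, W.op k ⟨a, 0⟩ (mode (W.y a) 0 v)) :
    ∃ E : Multiset (Letter W) → Multiset (Letter W) →₀ ℂ,
      (∀ M, E M ∈ W.polySupported (W.IsError M)) ∧
      ∀ N, ∑ M ∈ (W.poly v).support, W.poly v M *
        (∑ a ∈ W.cartan, (W.degree M).1 a * (if ⟨a, 0⟩ ::ₘ M = N then 1 else 0) - κ * shift M N +
          E M N) = 0 := by
  refine ⟨fun M => _, fun M => poly_sub_word_sort_mem hT0 hT M, fun N => ?_⟩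
  set S : Module.End ℂ (UniversalAffine g h k) :=
    ∑ a ∈ W.borel, W.op k ⟨a, 0⟩ * mode (W.y a) 0 - T with hS
  have hSv (w : UniversalAffine g h k) :
      S w = ∑ a ∈ W.borel, W.op k ⟨a, 0⟩ (mode (W.y a) 0 w) - T w := by
    rw [hS, LinearMap.sub_apply, LinearMap.sum_apply]
    rfl
  simp only [← hSv]
  have h1 : W.poly (S v) N = 0 := by
    rw [hSv, hv, sub_self, map_zero]
    rfl
  rw [W.eq_sum_word v, Finsupp.sum, map_sum, map_sum, Finsupp.finsetSum_apply] at h1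
  refine (Finset.sum_congr rfl fun M _ => ?_).trans h1
  rw [map_smul, map_smul, Finsupp.smul_apply, smul_eq_mul]
  congr 1
  simp only [Finsupp.sub_apply, Finsupp.finsetSum_apply, Finsupp.smul_apply, smul_eq_mul,
    Finsupp.single_apply]
  ring

/-- Some Cartan index `a` has nonzero weight on `M`, so `x_a(-1)` times a suitable monomial of the
same size and degree appears with nonzero coefficient. Something else must cancel it, and the stated
alternatives list the possible sources. -/
theorem exists_of_degree_ne_zero (hT0 : T (vacuum g h k) = 0)
    (hT : ∀ (i : Letter W) v, T (W.op k i v) =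
      W.op k i (T v) + (κ * (i.exp + 1)) • W.op k i.succ v)
    (hv : T v = ∑ a ∈ W.borel, W.op k ⟨a, 0⟩ (mode (W.y a) 0 v))
    {M : Multiset (Letter W)} (hM : M ∈ (W.poly v).support) (hdeg : W.degree M ≠ 0) :
    ∃ N ∈ (W.poly v).support, (W.size N ≤ W.size M ∧ (W.degree M).2 < (W.degree N).2) ∨
      (W.size N < W.size M ∧ W.degree N = W.degree M) ∨ W.size N + 3 ≤ W.size M := by
  by_contra! h1
  obtain ⟨E, hE, hsum⟩ := sum_coeff_eq_zero hT0 hT hv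
  obtain ⟨a, ha, ha0⟩ := exists_weight_apply_ne_zero hdeg
  -- The maximal number of letters `(a, 0)` ensures that no other Cartan term produces `x_a(-1) M'`.
  obtain ⟨M', hM', hmax⟩ := Finset.exists_max_image
    ((W.poly v).support.filter fun N => W.size N = W.size M ∧ W.degree N = W.degree M)
    (Multiset.count ⟨a, 0⟩) ⟨M, by simp [mem_support_iff.mp hM]⟩
  obtain ⟨hM's, hsize, hdeg'⟩ := Finset.mem_filter.mp hM'
  have hc (c : A) (hc : c ∈ W.cartan) (N : Multiset (Letter W)) :
      W.size (⟨c, 0⟩ ::ₘ N) = W.size N ∧ W.degree (⟨c, 0⟩ ::ₘ N) = W.degree N := by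
    rw [size_cons, degree_cons, Letter.size_of_not_isRest (not_isRest_of_mem_cartan hc),
      Letter.deg_of_not_isRest (not_isRest_of_mem_cartan hc), zero_add, zero_add]
    exact ⟨rfl, rfl⟩
  have h2 := hsum (⟨a, 0⟩ ::ₘ M')
  rw [Finset.sum_eq_single_of_mem M' hM's] at h2
  · have h3 : W.poly v M' * (W.degree M).1 a = 0 := by
      rw [← h2, W.eq_zero_of_mem_polySupported (hE M'),
        W.eq_zero_of_mem_polySupported (shift_mem M')]
      · rw [Finset.sum_eq_single_of_mem a ha, if_pos rfl, hdeg']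
        · ring
        · intro c _ hca
          rw [if_neg, mul_zero]
          rw [Multiset.cons_inj_left, Letter.mk.injEq]
          exact fun h => hca h.1
      · rintro ⟨i, hi, hir, h4⟩
        have h5 := congrArg W.size h4
        rw [size_succ_cons_erase hi hir, (hc a ha _).1] at h5
        lia
      · rintro (h4 | h4 | h4)
        · rw [(hc a ha _).2] at h4
          lia
        · rw [(hc a ha _).1] at h4
          lia
        · rw [(hc a ha _).1] at h4
          lia
    rcases mul_eq_zero.mp h3 with h3 | h3
    · exact mem_support_iff.mp hM's h3
    · exact ha0 h3
  · intro N hN hNM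
    obtain ⟨n1, n2, n3⟩ := h1 N hN
    rw [W.eq_zero_of_mem_polySupported (hE N), W.eq_zero_of_mem_polySupported (shift_mem N),
      Finset.sum_eq_zero, mul_zero, sub_zero, add_zero, mul_zero]
    · intro c hcc
      split_ifs with h4
      · exfalso
        have hs := congrArg W.size h4
        have hd := congrArg W.degree h4
        rw [(hc a ha _).1, (hc c hcc _).1] at hs
        rw [(hc a ha _).2, (hc c hcc _).2] at hd
        by_cases hca : c = a
        · subst hca
          exact hNM ((Multiset.cons_inj_right _).mp h4)
        -- For `c ≠ a` the monomial `N` would contain one letter `(a, 0)` more than `M'`.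
        · have h5 := congrArg (Multiset.count ⟨a, 0⟩) h4
          rw [Multiset.count_cons_self, Multiset.count_cons_of_ne (by
            rw [Ne, Letter.mk.injEq]
            exact fun h => hca h.1.symm)] at h5
          have := hmax N (Finset.mem_filter.mpr ⟨hN, hs.trans hsize, hd.trans hdeg'⟩)
          lia
      · rw [mul_zero]
    -- A shifted monomial comes from one of the same degree with size smaller by 2, already excluded
    -- by `n2`.
    · rintro ⟨i, hi, hir, h4⟩
      have hs := congrArg W.size h4
      have hd := congrArg W.degree h4
      rw [size_succ_cons_erase hi hir, (hc a ha _).1] at hs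
      rw [degree_succ_cons_erase hi hir, (hc a ha _).2] at hd
      exact n2 (by lia) (hd.symm.trans hdeg')
    · rw [IsError, (hc a ha _).1, (hc a ha _).2, hsize, hdeg']
      rintro (h4 | h4 | h4)
      · have := n1 h4.1
        lia
      · exact n2 h4.1 h4.2.1.symm
      · lia

/-- If `i.succ` does not occur in `M`, this monomial can only come from shifting a copy of `i`. -/
theorem shift_apply_self {M : Multiset (Letter W)} {i : Letter W} (hi : i.IsRest)
    (hM : i.succ ∉ M) :
    shift M (i.succ ::ₘ M.erase i) = M.count i * (i.exp + 1 : ℂ) := by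
  have h1 (N : Multiset (Letter W)) : (N.map fun j => if j = i then (i.exp + 1 : ℂ) else 0).sum =
      N.count i * (i.exp + 1 : ℂ) := by
    induction N using Multiset.induction_on with
    | empty => simp
    | cons j N ih =>
      rw [Multiset.map_cons, Multiset.sum_cons, ih, Multiset.count_cons]
      simp only [eq_comm (a := i)]
      split_ifs
      · push_cast
        ring
      · simp
  rw [← h1, shift, ← Finsupp.applyAddHom_apply, map_multiset_sum, Multiset.map_map]
  congr 1
  refine Multiset.map_congr rfl fun j hj => ?_
  rw [Function.comp_apply, Finsupp.applyAddHom_apply]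
  by_cases hij : j = i
  · subst hij
    rw [if_pos hi, if_pos rfl, single_eq_same]
  · rw [if_neg hij]
    split_ifs
    · rw [single_eq_of_ne]
      intro h2
      have h3 : i.succ ∈ j.succ ::ₘ M.erase j := by
        rw [← h2]
        exact Multiset.mem_cons_self _ _
      rcases Multiset.mem_cons.mp h3 with h3 | h3
      · refine hij (Letter.ext ?_ ?_)
        · exact (congrArg Letter.idx h3).symm
        · have := congrArg Letter.exp h3
          simp only [Letter.succ] at this
          lia
      · exact hM (Multiset.mem_of_mem_erase h3)
    · rfl

/-- A nonzero vector satisfying the equation for singular vectors has a component of size zero. -/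
theorem exists_size_eq_zero (hT0 : T (vacuum g h k) = 0)
    (hT : ∀ (i : Letter W) v, T (W.op k i v) =
      W.op k i (T v) + (κ * (i.exp + 1)) • W.op k i.succ v)
    (hv : T v = ∑ a ∈ W.borel, W.op k ⟨a, 0⟩ (mode (W.y a) 0 v)) (hκ : κ ≠ 0) (hv0 : v ≠ 0) :
    ∃ M ∈ (W.poly v).support, W.size M = 0 := by
  have hne : (W.poly v).support.Nonempty := by
    rw [support_nonempty_iff]
    intro h0
    apply hv0
    rw [W.eq_sum_word v, h0, Finsupp.sum_zero_index]
  obtain ⟨M₀, hM₀, hmin⟩ := Finset.exists_min_image _ W.size hne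
  by_contra! hpos
  -- The bound is `s + 2`, with `s` the least size, because the monomial compared at the end has
  -- size `s + 2`.
  have hht : ∀ M ∈ (W.poly v).support, W.size M ≤ W.size M₀ + 2 → (W.degree M).2 ≤ 0 := by
    by_contra! h1
    obtain ⟨M₁, hM₁, hs₁, hd₁⟩ := h1
    obtain ⟨M₂, hM₂, hmax⟩ := Finset.exists_max_image
      ((W.poly v).support.filter fun M => W.size M ≤ W.size M₀ + 2) (fun M => (W.degree M).2)
      ⟨M₁, Finset.mem_filter.mpr ⟨hM₁, hs₁⟩⟩
    -- Greatest height, then least size: each alternative of `exists_of_degree_ne_zero` contradicts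
    -- one of the choices or the minimality of `s`.
    obtain ⟨M, hM, hmin'⟩ := Finset.exists_min_image
      ((W.poly v).support.filter fun M => W.size M ≤ W.size M₀ + 2 ∧
        (W.degree M).2 = (W.degree M₂).2) W.size
      ⟨M₂, Finset.mem_filter.mpr ⟨(Finset.mem_filter.mp hM₂).1, (Finset.mem_filter.mp hM₂).2, rfl⟩⟩
    obtain ⟨hMs, hs, hd⟩ := Finset.mem_filter.mp hM
    have h2 := hmax M₁ (Finset.mem_filter.mpr ⟨hM₁, hs₁⟩)
    have h3 : W.degree M ≠ 0 := fun h0 => by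
      rw [h0] at hd
      simp only [Prod.snd_zero] at hd
      lia
    obtain ⟨N, hN, h4 | h4 | h4⟩ := exists_of_degree_ne_zero hT0 hT hv hMs h3
    · have := hmax N (Finset.mem_filter.mpr ⟨hN, by lia⟩)
      lia
    · have := hmin' N (Finset.mem_filter.mpr ⟨hN, by lia, by rw [h4.2, hd]⟩)
      lia
    · have := hmin N hN
      lia
  -- At least size the other two alternatives are impossible, so a monomial of greatest height there
  -- must have degree 0.
  have hzero : ∃ M ∈ (W.poly v).support, W.size M = W.size M₀ ∧ W.degree M = 0 := by
    obtain ⟨M, hM, hmax⟩ := Finset.exists_max_image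
      ((W.poly v).support.filter fun M => W.size M = W.size M₀) (fun M => (W.degree M).2)
      ⟨M₀, Finset.mem_filter.mpr ⟨hM₀, rfl⟩⟩
    obtain ⟨hMs, hs⟩ := Finset.mem_filter.mp hM
    refine ⟨M, hMs, hs, ?_⟩
    by_contra h3
    obtain ⟨N, hN, h4 | h4 | h4⟩ := exists_of_degree_ne_zero hT0 hT hv hMs h3
    · have h5 := hmin N hN
      have := hmax N (Finset.mem_filter.mpr ⟨hN, by lia⟩)
      lia
    · have := hmin N hN
      lia
    · have := hmin N hN
      lia
  obtain ⟨M₁, hM₁, hs₁, hd₁⟩ := hzero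
  obtain ⟨i₁, hi₁, hr₁⟩ : ∃ i ∈ M₁, i.IsRest := by
    by_contra! h1
    exact hpos M₁ hM₁ (W.size_of_forall_not_isRest h1)
  -- A non-Borel letter of largest exponent over all monomials of least size and degree 0: then
  -- `i.succ` occurs in none of them.
  obtain ⟨⟨M, i⟩, hMi, hmax⟩ := Finset.exists_max_image
    ((((W.poly v).support.filter fun M => W.size M = W.size M₀ ∧ W.degree M = 0).sigma
      fun M : Multiset (Letter W) => M.toFinset.filter fun i : Letter W => i.IsRest))
    (fun p => p.2.exp) ⟨⟨M₁, i₁⟩, by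
        simp [hs₁, hd₁, hi₁, hr₁, mem_support_iff.mp hM₁]⟩
  simp only [Finset.mem_sigma, Finset.mem_filter, Multiset.mem_toFinset, Sigma.forall, and_imp] at hMi hmax
  obtain ⟨⟨hM, hs, hd⟩, hi, hr⟩ := hMi
  have hsucc (N : Multiset (Letter W)) (hN : N ∈ (W.poly v).support) (hNs : W.size N = W.size M₀)
      (hNd : W.degree N = 0) : i.succ ∉ N := fun h1 => by
    have := hmax N i.succ hN hNs hNd h1 i.isRest_succ
    simp only [Letter.succ] at this
    lia
  obtain ⟨E, hE, hsum⟩ := sum_coeff_eq_zero hT0 hT hv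
  have h2 := hsum (i.succ ::ₘ M.erase i)
  -- Of the three kinds of error, the first needs positive height in size at most `s + 2`, the
  -- second a nonzero degree, the third a size below `s`.
  have h3 (N : Multiset (Letter W)) (hN : N ∈ (W.poly v).support) :
      E N (i.succ ::ₘ M.erase i) = 0 := by
    apply W.eq_zero_of_mem_polySupported (hE N)
    rw [IsError, size_succ_cons_erase hi hr, degree_succ_cons_erase hi hr, hd]
    rintro (h4 | h4 | h4)
    · have := hht N hN (by lia)
      exact absurd h4.2 (not_lt.mpr this)
    · exact h4.2.2 h4.2.1.symm
    · have := hmin N hN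
      lia
  -- A Cartan term keeps the degree, here 0, so its coefficient, a value of the weight, is zero.
  have h4 (N : Multiset (Letter W)) : ∑ a ∈ W.cartan, (W.degree N).1 a *
      (if ⟨a, 0⟩ ::ₘ N = i.succ ::ₘ M.erase i then (1 : ℂ) else 0) = 0 := by
    refine Finset.sum_eq_zero fun a ha => ?_
    split_ifs with h5
    · have h6 := congrArg W.degree h5
      rw [degree_succ_cons_erase hi hr, hd, degree_cons,
        Letter.deg_of_not_isRest (not_isRest_of_mem_cartan ha), zero_add] at h6
      rw [h6]
      simp
    · rw [mul_zero]
  rw [Finset.sum_eq_single_of_mem M hM, h3 M hM, h4, shift_apply_self hr (hsucc M hM hs hd)] at h2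
  · simp only [zero_sub, add_zero, mul_neg, neg_eq_zero, mul_eq_zero, hκ, mem_support_iff.mp hM,
      false_or, Nat.cast_eq_zero, Multiset.count_eq_zero, hi, not_true] at h2
    exact Nat.cast_add_one_ne_zero _ h2
  -- Another source `N` would also have size `s` and degree 0, and unless `N = M` it would contain
  -- `i.succ`.
  · intro N hN hNM
    rw [h3 N hN, h4, W.eq_zero_of_mem_polySupported (shift_mem N)]
    · ring
    · rintro ⟨j, hj, hjr, h5⟩
      have h6 := congrArg W.size h5
      have h7 := congrArg W.degree h5
      rw [size_succ_cons_erase hi hr, size_succ_cons_erase hj hjr] at h6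
      rw [degree_succ_cons_erase hi hr, degree_succ_cons_erase hj hjr] at h7
      by_cases hij : i = j
      · subst hij
        rw [Multiset.cons_inj_right] at h5
        apply hNM
        rw [← Multiset.cons_erase hi, h5, Multiset.cons_erase hj]
      · have h8 : i.succ ∈ j.succ ::ₘ N.erase j := by
          rw [← h5]
          exact Multiset.mem_cons_self _ _
        rcases Multiset.mem_cons.mp h8 with h8 | h8
        · refine hij (Letter.ext (congrArg Letter.idx h8 :) ?_)
          have := congrArg Letter.exp h8
          simp only [Letter.succ] at this
          lia
        · exact hsucc N hN (by lia) (h7.symm.trans hd) (Multiset.mem_of_mem_erase h8)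

end Singular

end WeightBasis

/-! ### `C₂`, the Li filtration, and words with a letter of positive exponent. -/

namespace WeightBasis

open UniversalAffine

variable {g : Type*} [LieRing g] [LieAlgebra ℂ g] {h k : ℂ} {A : Type*} [Fintype A] [DecidableEq A]
  {W : WeightBasis g h A}

variable (W k) in
/-- The span of the words with a letter `(a, n)`, `n ≥ 1`. -/
def deep : Submodule ℂ (UniversalAffine g h k) :=
  Submodule.span ℂ (W.word k '' {l | ∃ i ∈ l, 0 < i.exp})

theorem op_mem_deep (i : Letter W) {w : UniversalAffine g h k} (hw : w ∈ W.deep k) :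
    W.op k i w ∈ W.deep k := by
  induction hw using Submodule.span_induction with
  | mem w hw =>
    obtain ⟨l, ⟨j, hj, hj'⟩, rfl⟩ := hw
    exact Submodule.subset_span ⟨i :: l, ⟨j, List.mem_cons_of_mem _ hj, hj'⟩, rfl⟩
  | zero => rw [map_zero]; exact zero_mem _
  | add u w _ _ hu hw => rw [map_add]; exact add_mem hu hw
  | smul c u _ hu => rw [map_smul]; exact Submodule.smul_mem _ _ hu

theorem op_mem_deep_of_pos {i : Letter W} (hi : 0 < i.exp) (w : UniversalAffine g h k) :
    W.op k i w ∈ W.deep k := by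
  have hw : w ∈ Submodule.span ℂ (Set.range (W.word k)) := by
    rw [W.span_word_eq_top]
    trivial
  induction hw using Submodule.span_induction with
  | mem w hw =>
    obtain ⟨l, rfl⟩ := hw
    exact Submodule.subset_span ⟨i :: l, ⟨i, List.mem_cons_self, hi⟩, rfl⟩
  | zero => rw [map_zero]; exact zero_mem _
  | add u w _ _ hu hw => rw [map_add]; exact add_mem hu hw
  | smul c u _ hu => rw [map_smul]; exact Submodule.smul_mem _ _ hu

theorem poly_mem_of_mem_deep {w : UniversalAffine g h k} (hw : w ∈ W.deep k) :
    W.poly w ∈ W.polySupported fun M => 0 < W.size M := by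
  have h1 : W.deep k ≤ W.fil k 1 := by
    refine Submodule.span_mono (Set.image_mono ?_)
    rintro l ⟨i, hi, hi'⟩
    have h2 : i.size ≤ W.size l := by
      rw [size, Multiset.map_coe]
      exact Multiset.single_le_sum (fun _ _ => Nat.zero_le _) _
        (by simpa using ⟨i, hi, rfl⟩)
    rw [Letter.size_of_isRest (Or.inl hi')] at h2
    change 1 ≤ W.size l
    lia
  exact poly_mem_of_mem_fil (h1 hw)

/-- Induction on a word for `a`. In the residue product formula the outer terms begin with a letter
of positive exponent, except possibly for `j = 0`, where the inductive claim applies at the same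
mode `q`. The inner terms apply a still lower mode of the shorter word. -/
theorem ncoeff_stateField_mem_deep (a : UniversalAffine g h k) {q : ℤ} (hq : q ≤ -2)
    (b : UniversalAffine g h k) : ((stateField a)[[q]]) b ∈ W.deep k := by
  have ha : a ∈ Submodule.span ℂ (Set.range (W.word k)) := by
    rw [W.span_word_eq_top]
    trivial
  induction ha using Submodule.span_induction generalizing q b with
  | mem a ha =>
    obtain ⟨l, rfl⟩ := ha
    induction l generalizing q b with
    | nil =>
      rw [word_nil, stateField_vacuum, ncoeff_identityField, if_neg (by lia)]
      exact zero_mem _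
    | cons i l ih =>
      rw [word_cons, op, stateField_mode, nthProduct, ncoeff_sub_apply]
      obtain ⟨N₁, h₁⟩ := exists_forall_ncoeff_eq_zero (stateField (W.word k l)) b
      obtain ⟨N₂, h₂⟩ := exists_forall_ncoeff_eq_zero (field (W.x i.idx)) b
      rw [ncoeff_outerProduct _ _ _ q b (N₁ + (-q).toNat) fun m hm => h₁ m (by lia),
        ncoeff_innerProduct _ _ _ q b N₂ h₂]
      refine sub_mem (Submodule.sum_mem _ fun j _ => Submodule.smul_mem _ _ ?_)
        (Submodule.sum_mem _ fun j _ => Submodule.smul_mem _ _ (ih (by lia) _))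
      rw [ncoeff_field, show -(i.exp : ℤ) - 1 - j = -((i.exp + j : ℕ) : ℤ) - 1 by push_cast; ring]
      change W.op k ⟨i.idx, i.exp + j⟩ _ ∈ _
      by_cases hj : j = 0
      · subst hj
        exact op_mem_deep _ (ih (by push_cast; lia) _)
      · exact op_mem_deep_of_pos (Nat.add_pos_right _ (Nat.pos_of_ne_zero hj)) _
  | zero => rw [map_zero, map_zero]; exact zero_mem _
  | add u w _ _ hu hw => rw [map_add, ncoeff_add_apply]; exact add_mem (hu hq b) (hw hq b)
  | smul c u _ hu => rw [map_smul, ncoeff_smul_apply]; exact Submodule.smul_mem _ _ (hu hq b)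

variable (W k) in
theorem zhuC2_le_deep : zhuC2 (stateField (g := g) (h := h) (k := k)) ≤ W.deep k := by
  refine Submodule.span_le.mpr ?_
  rintro _ ⟨a, b, rfl⟩
  exact ncoeff_stateField_mem_deep a le_rfl b

variable (W k) in
theorem liFiltration_one_le_deep :
    liFiltration (stateField (g := g) (h := h) (k := k)) 1 ≤ W.deep k := by
  refine Submodule.span_le.mpr ?_
  rintro _ ⟨l, b, h1, h2, rfl⟩
  cases l with
  | nil => simp at h2
  | cons s l =>
    have := h1 s List.mem_cons_self
    exact ncoeff_stateField_mem_deep s.1 (by lia) _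

/-- A nonzero vector `v` annihilated by `t g[t]` and by the elements of negative height has nonzero
image in the `C₂`-algebra, and depth zero. -/
theorem mk_ne_zero_and_hasDepth (W : WeightBasis g h A) (hh : h ≠ 0) (hk : k + h ≠ 0)
    {v : UniversalAffine g h k} (hv0 : v ≠ 0)
    (h1 : ∀ n : ℕ, 1 ≤ n → ∀ x : g, mode x n v = 0)
    (h2 : ∀ a, (W.deg a).2 < 0 → mode (W.y a) 0 v = 0) :
    (Submodule.Quotient.mk v : ZhuAlgebra (stateField (g := g) (h := h) (k := k))) ≠ 0 ∧
      HasDepth stateField v 0 := by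
  -- A vector of `deep` has only monomials of positive size, whereas `v` has one of size zero.
  have h3 : v ∉ W.deep k := fun h3 => by
    obtain ⟨M, hM, hM0⟩ := exists_size_eq_zero W.sugawara_vacuum (W.sugawara_op hh)
      (W.sugawara_apply_of_singular h1 h2) hk hv0
    exact mem_support_iff.mp hM
      (W.eq_zero_of_mem_polySupported (poly_mem_of_mem_deep h3) (by rw [hM0]; exact lt_irrefl 0))
  refine ⟨fun h4 => h3 (W.zhuC2_le_deep k ((Submodule.Quotient.mk_eq_zero _).mp h4)), ?_,
    fun h4 => h3 (W.liFiltration_one_le_deep k h4)⟩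
  exact Submodule.subset_span ⟨[], v, by simp, by simp, rfl⟩

end WeightBasis

/-! ### The basis of weight vectors of a semisimple Lie algebra. -/

section Roots

open LieModule

variable {g : Type*} [LieRing g] [LieAlgebra ℂ g] [FiniteDimensional ℂ g] [IsKilling ℂ g]
  {H : LieSubalgebra ℂ g} [H.IsCartanSubalgebra]

open Classical in
/-- The height of a weight of the adjoint representation. -/
def weightHeight (b : (IsKilling.rootSystem H).Base) (χ : Weight ℂ H g) : ℤ :=
  if hχ : χ.IsNonZero then b.height ⟨χ, by simpa using hχ⟩ else 0

theorem weightHeight_coe (b : (IsKilling.rootSystem H).Base) (α : H.root) :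
    weightHeight b α.1 = b.height α :=
  dif_pos (LieSubalgebra.isNonZero_coe_root α)

theorem weightHeight_eq_zero_iff (b : (IsKilling.rootSystem H).Base) (χ : Weight ℂ H g) :
    weightHeight b χ = 0 ↔ χ.IsZero := by
  rw [weightHeight]
  split_ifs with hχ
  · exact iff_of_false (b.height_ne_zero _) hχ
  · exact iff_of_true rfl (not_not.mp hχ)

/-- There is an element of the Cartan subalgebra on which every weight takes its height as value. -/
theorem exists_apply_eq_weightHeight (b : (IsKilling.rootSystem H).Base) :
    ∃ r : H, ∀ χ : Weight ℂ H g, χ r = (weightHeight b χ : ℂ) := by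
  -- The element of the Cartan subalgebra on which every simple root takes the value 1.
  refine ⟨(Module.evalEquiv ℂ H).symm (b.toWeightBasis.constr ℂ fun _ => (1 : ℂ)), fun χ => ?_⟩
  by_cases hχ : χ.IsNonZero
  · obtain ⟨α, rfl⟩ : ∃ α : H.root, α.1 = χ := ⟨⟨χ, by simpa using hχ⟩, rfl⟩
    rw [weightHeight_coe]
    obtain ⟨f, -, -, hf⟩ := b.exists_root_eq_sum_int α
    have h1 : α.1 ((Module.evalEquiv ℂ H).symm (b.toWeightBasis.constr ℂ fun _ => (1 : ℂ))) =
        (b.toWeightBasis.constr ℂ fun _ => (1 : ℂ)) ((IsKilling.rootSystem H).root α) := by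
      rw [← Module.apply_evalEquiv_symm_apply]
      rfl
    rw [h1, hf, map_sum, RootPairing.Base.height_eq_sum hf]
    push_cast
    refine Finset.sum_congr rfl fun j hj => ?_
    have h2 := b.toWeightBasis.constr_basis ℂ (fun _ => (1 : ℂ)) ⟨j, hj⟩
    rw [b.toWeightBasis_apply] at h2
    rw [map_zsmul, h2]
    simp
  · have h1 : χ.IsZero := not_not.mp hχ
    rw [(weightHeight_eq_zero_iff b χ).mpr h1, h1.eq]
    simp

variable (H) in
/-- The index set of a basis of weight vectors of the adjoint representation. -/
abbrev WeightIndex : Type _ := Σ χ : Weight ℂ H g, Fin (Module.finrank ℂ (rootSpace H (χ : H → ℂ)))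

instance : DecidableEq (WeightIndex H) := Classical.decEq _

open Classical in
variable (H) in
theorem isInternal_rootSpace :
    DirectSum.IsInternal fun χ : Weight ℂ H g => (rootSpace H (χ : H → ℂ)).toSubmodule := by
  rw [DirectSum.isInternal_submodule_iff_iSupIndep_and_iSup_eq_top]
  refine ⟨?_, ?_⟩
  · rw [LieSubmodule.iSupIndep_toSubmodule]
    exact iSupIndep_genWeightSpace' ℂ H g
  · rw [← LieSubmodule.iSup_toSubmodule, iSup_genWeightSpace_eq_top' ℂ H g]
    rfl

open Classical in
variable (H) in
/-- A basis of weight vectors of the adjoint representation. -/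
def weightVector : Module.Basis (WeightIndex H) ℂ g :=
  (isInternal_rootSpace H).collectedBasis fun χ => Module.finBasis ℂ (rootSpace H (χ : H → ℂ))

open Classical in
theorem lie_weightVector (z : H) (a : WeightIndex H) :
    ⁅(z : g), weightVector H a⁆ = a.1 z • weightVector H a :=
  IsKilling.lie_eq_smul_of_mem_rootSpace
    ((isInternal_rootSpace H).collectedBasis_mem
      (fun χ => Module.finBasis ℂ (rootSpace H (χ : H → ℂ))) a) z

theorem normalizedForm_nondegenerate {h : ℂ} (hh : h ≠ 0) :
    (normalizedForm g h).Nondegenerate := by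
  have h1 := IsKilling.killingForm_nondegenerate ℂ g
  have h2 : (1 : ℂ) / (2 * h) ≠ 0 := by simpa using hh
  refine ⟨fun x hx => h1.1 x fun y => ?_, fun y hy => h1.2 y fun x => ?_⟩
  · have := hx y
    rw [normalizedForm, LinearMap.smul_apply, LinearMap.smul_apply, smul_eq_mul] at this
    exact (mul_eq_zero.mp this).resolve_left h2
  · have := hy x
    rw [normalizedForm, LinearMap.smul_apply, LinearMap.smul_apply, smul_eq_mul] at this
    exact (mul_eq_zero.mp this).resolve_left h2

theorem form_lie_right {h : ℂ} (x y z : g) :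
    normalizedForm g h x ⁅y, z⁆ = -normalizedForm g h ⁅y, x⁆ z := by
  rw [normalizedForm_lieInvariant, neg_neg]

variable (H) in
/-- The basis dual to `weightVector`. -/
def dualWeightVector {h : ℂ} (hh : h ≠ 0) : Module.Basis (WeightIndex H) ℂ g :=
  LinearMap.BilinForm.dualBasis (normalizedForm g h) (normalizedForm_nondegenerate hh)
    (weightVector H)

variable {h : ℂ} (hh : h ≠ 0)

theorem form_weightVector_dualWeightVector (a c : WeightIndex H) :
    normalizedForm g h (weightVector H a) (dualWeightVector H hh c) = if a = c then 1 else 0 :=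
  LinearMap.BilinForm.apply_dualBasis_right _ (normalizedForm_isSymm g h) _ a c

theorem repr_weightVector_eq_form (z : g) (c : WeightIndex H) :
    (weightVector H).repr z c = normalizedForm g h z (dualWeightVector H hh c) := by
  conv_rhs => rw [← (weightVector H).sum_repr z]
  rw [map_sum, LinearMap.sum_apply]
  simp only [map_smul, LinearMap.smul_apply, form_weightVector_dualWeightVector, smul_eq_mul, mul_ite,
    mul_one, mul_zero]
  simp

theorem repr_dualWeightVector (z : g) (c : WeightIndex H) :
    (dualWeightVector H hh).repr z c = normalizedForm g h z (weightVector H c) :=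
  LinearMap.BilinForm.dualBasis_repr_apply _ _ _ _

/-- Invariance of the form gives a dual basis vector the opposite weight. -/
theorem lie_dualWeightVector (z : H) (a : WeightIndex H) :
    ⁅(z : g), dualWeightVector H hh a⁆ = -a.1 z • dualWeightVector H hh a := by
  apply (dualWeightVector H hh).repr.injective
  ext c
  rw [map_smul, Finsupp.smul_apply, repr_dualWeightVector, repr_dualWeightVector,
    (normalizedForm_isSymm g h).eq, form_lie_right, lie_weightVector, map_smul,
    (normalizedForm_isSymm g h).eq, LinearMap.smul_apply, form_weightVector_dualWeightVector]
  split_ifs with hca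
  · subst hca
    simp
  · simp

theorem dualWeightVector_mem_rootSpace (a : WeightIndex H) :
    dualWeightVector H hh a ∈ rootSpace H (-(a.1 : H → ℂ)) := by
  apply weightSpace_le_genWeightSpace
  rw [mem_weightSpace]
  exact fun z => lie_dualWeightVector hh z a

theorem dualWeightVector_mem {a : WeightIndex H} (ha : a.1.IsZero) :
    dualWeightVector H hh a ∈ H := by
  have h1 := dualWeightVector_mem_rootSpace hh a
  rw [ha.eq, neg_zero, rootSpace_zero_eq] at h1
  exact h1

/-- The weight of an element in terms of its brackets with the basis. -/
theorem apply_eq_of_repr_ne_zero {z : g} {χ : H → ℂ} (hz : ∀ t : H, ⁅(t : g), z⁆ = χ t • z)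
    {c : WeightIndex H} (hc : (weightVector H).repr z c ≠ 0) : χ = (c.1 : H → ℂ) := by
  funext t
  -- The weight does not depend on the scaling of the form, so the constant 1 serves.
  have h1 := form_lie_right (h := (1 : ℂ)) z (t : g) (dualWeightVector H one_ne_zero c)
  rw [lie_dualWeightVector, hz, map_smul, map_smul, LinearMap.smul_apply,
    ← repr_weightVector_eq_form, smul_eq_mul, smul_eq_mul, neg_mul, neg_inj] at h1
  exact (mul_right_cancel₀ hc h1).symm

open Classical in
/-- The degree of a basis vector. -/
def weightDegree (b : (IsKilling.rootSystem H).Base) (a : WeightIndex H) :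
    (WeightIndex H → ℂ) × ℤ :=
  (fun c => if hc : c.1.IsZero then a.1 ⟨dualWeightVector H hh c, dualWeightVector_mem hh hc⟩ else 0,
    weightHeight b a.1)

theorem weightDegree_eq (b : (IsKilling.rootSystem H).Base) {a c d : WeightIndex H} {m n : ℤ}
    (hcd : (d.1 : H → ℂ) = (m : ℂ) • (a.1 : H → ℂ) + (n : ℂ) • (c.1 : H → ℂ)) :
    weightDegree hh b d = m • weightDegree hh b a + n • weightDegree hh b c := by
  refine Prod.ext ?_ ?_
  · funext e
    simp only [weightDegree, Prod.fst_add, Prod.smul_fst, Pi.add_apply, Pi.smul_apply, hcd]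
    split_ifs <;> simp
  · obtain ⟨r, hr⟩ := exists_apply_eq_weightHeight b
    have h1 := congrFun hcd r
    simp only [Pi.add_apply, Pi.smul_apply, hr, smul_eq_mul] at h1
    exact_mod_cast h1

/-- The basis of weight vectors of a semisimple Lie algebra. -/
def rootWeightBasis (b : (IsKilling.rootSystem H).Base) : WeightBasis g h (WeightIndex H) where
  x := weightVector H
  y := dualWeightVector H hh
  deg := weightDegree hh b
  form_x_y := form_weightVector_dualWeightVector hh
  lie_y_x c a hc := by
    have hc' : c.1.IsZero := (weightHeight_eq_zero_iff b c.1).mp hc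
    rw [weightDegree]
    simp only [dif_pos hc']
    exact lie_weightVector ⟨_, dualWeightVector_mem hh hc'⟩ a
  weight_apply_eq_zero c a hc := by
    simp only [weightDegree]
    exact dif_neg fun hc' => hc ((weightHeight_eq_zero_iff b c.1).mpr hc')
  deg_of_lie_x a c d hd := by
    have h1 := apply_eq_of_repr_ne_zero (χ := (a.1 : H → ℂ) + (c.1 : H → ℂ)) (fun t => by
      rw [leibniz_lie, lie_weightVector, lie_weightVector, smul_lie, lie_smul, ← add_smul]
      rfl) hd
    simpa using weightDegree_eq hh b (m := 1) (n := 1) (a := a) (c := c) (d := d) (by simp [← h1])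
  deg_of_lie_y a c d hd := by
    have h1 := apply_eq_of_repr_ne_zero (χ := (c.1 : H → ℂ) - (a.1 : H → ℂ)) (fun t => by
      rw [leibniz_lie, lie_dualWeightVector, lie_weightVector, smul_lie, lie_smul, ← add_smul,
        neg_add_eq_sub]
      rfl) hd
    have := weightDegree_eq hh b (m := 1) (n := -1) (a := c) (c := a) (d := d) (by
      simp [← h1, sub_eq_add_neg])
    simpa [sub_eq_add_neg] using this
  height_eq := by
    obtain ⟨r, hr⟩ := exists_apply_eq_weightHeight b
    refine ⟨(dualWeightVector H hh).repr r, fun a => ?_⟩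
    have h1 : ⁅(r : g), weightVector H a⁆ = (∑ c, (dualWeightVector H hh).repr r c *
        (weightDegree hh b a).1 c) • weightVector H a := by
      conv_lhs => rw [← (dualWeightVector H hh).sum_repr (r : g), sum_lie]
      rw [Finset.sum_smul]
      refine Finset.sum_congr rfl fun c _ => ?_
      rw [smul_lie, mul_smul, weightDegree]
      simp only
      split_ifs with hc
      · rw [lie_weightVector ⟨_, dualWeightVector_mem hh hc⟩ a]
      -- Since `[r, r] = 0`, invariance gives `ht(c) (r | x_c) = 0`, and the height of a nonzero
      -- weight is nonzero.
      · have h2 : (dualWeightVector H hh).repr (r : g) c = 0 := by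
          rw [repr_dualWeightVector]
          have h3 := form_lie_right (h := h) (r : g) (r : g) (weightVector H c)
          rw [lie_self, lie_weightVector, hr, map_smul, map_zero, LinearMap.zero_apply, neg_zero,
            smul_eq_mul, mul_eq_zero, Int.cast_eq_zero, weightHeight_eq_zero_iff] at h3
          exact h3.resolve_left hc
        rw [h2, zero_smul, zero_smul]
    rw [lie_weightVector, hr] at h1
    exact (smul_left_injective ℂ ((weightVector H).ne_zero a) h1).symm

end Roots

/-! ### The highest root and the annihilator of a singular vector. -/

section HighestRoot

open LieModule UniversalAffine

variable {g : Type*} [LieRing g] [LieAlgebra ℂ g] [FiniteDimensional ℂ g] [IsSimple ℂ g]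
  {H : LieSubalgebra ℂ g} [H.IsCartanSubalgebra] {b : (IsKilling.rootSystem H).Base} {θ : H.root}

variable (b) in
theorem weightHeight_eq_sub {χ φ ψ : Weight ℂ H g} (hψ : (ψ : H → ℂ) = χ - φ) :
    weightHeight b ψ = weightHeight b χ - weightHeight b φ := by
  obtain ⟨r, hr⟩ := exists_apply_eq_weightHeight b
  have h1 := congrFun hψ r
  rw [Pi.sub_apply, hr, hr, hr] at h1
  exact_mod_cast h1

variable (b) in
theorem weightHeight_neg (χ : Weight ℂ H g) : weightHeight b (-χ) = -weightHeight b χ := by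
  obtain ⟨r, hr⟩ := exists_apply_eq_weightHeight b
  have h1 := congrFun (Weight.coe_neg (α := χ)) r
  rw [Pi.neg_apply, hr, hr] at h1
  exact_mod_cast h1

theorem IsHighestRoot.isPos (hθ : IsHighestRoot b θ) : b.IsPos θ := by
  let := (IsKilling.rootSystem H).indexNeg
  have h1 := hθ θ
  have h2 := hθ (-θ)
  rw [b.height_reflectionPerm_self] at h2
  have := b.height_ne_zero θ
  rw [RootPairing.Base.isPos_iff]
  lia

/-- If the pairing were negative, adding the simple root to `θ` would give a root of greater height.
-/
theorem IsHighestRoot.pairingIn_nonneg (hθ : IsHighestRoot b θ) {j : H.root} (hj : j ∈ b.support) :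
    0 ≤ (IsKilling.rootSystem H).pairingIn ℤ θ j := by
  by_contra! h1
  have hpos := hθ.isPos
  rw [RootPairing.Base.isPos_iff] at hpos
  have hj1 := RootPairing.Base.height_one_of_mem_support hj
  obtain ⟨α, hα⟩ := RootPairing.root_add_root_mem_of_pairingIn_neg _ h1 fun h2 => by
    let := (IsKilling.rootSystem H).indexNeg
    have h3 : θ = -j := (IsKilling.rootSystem H).root.injective
      (h2.trans (show (IsKilling.rootSystem H).root ((IsKilling.rootSystem H).reflectionPerm j j) = _ by
        rw [RootPairing.root_reflectionPerm, RootPairing.reflection_apply_self]).symm)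
    rw [h3, b.height_reflectionPerm_self] at hpos
    lia
  have h2 := b.height_add hα
  have := hθ α
  lia

/-- The coefficients of `θ^∨` in the simple coroots have one sign. Nonpositive ones are excluded by
`2 = ⟨θ, θ^∨⟩`, since `θ` pairs nonnegatively with simple coroots. -/
theorem IsHighestRoot.dualCoxeterNumber_pos (hθ : IsHighestRoot b θ) : 0 < dualCoxeterNumber b θ := by
  rw [dualCoxeterNumber]
  obtain ⟨f, -, hf, hf'⟩ := b.flip.exists_root_eq_sum_int θ
  rw [RootPairing.Base.height_eq_sum hf']
  rcases hf with hf | hf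
  · have h1 : 0 ≤ ∑ j ∈ b.flip.support, f j := Finset.sum_nonneg fun j _ => hf.le j
    lia
  · exfalso
    have h1 : (2 : ℤ) = ∑ j ∈ b.support, f j * (IsKilling.rootSystem H).pairingIn ℤ θ j := by
      have h2 : ((IsKilling.rootSystem H).toLinearMap ((IsKilling.rootSystem H).root θ))
          ((IsKilling.rootSystem H).coroot θ) = 2 := RootPairing.root_coroot_two _ _
      have h3 : (IsKilling.rootSystem H).coroot θ =
        ∑ j ∈ b.support, f j • (IsKilling.rootSystem H).coroot j := hf'
      rw [h3, map_sum] at h2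
      apply Int.cast_injective (α := ℂ)
      push_cast
      rw [← h2]
      refine Finset.sum_congr rfl fun j _ => ?_
      rw [map_zsmul, RootPairing.root_coroot_eq_pairing, zsmul_eq_mul]
      congr 1
      exact ((IsKilling.rootSystem H).algebraMap_pairingIn ℤ θ j).symm
    have h4 : ∑ j ∈ b.support, f j * (IsKilling.rootSystem H).pairingIn ℤ θ j ≤ 0 :=
      Finset.sum_nonpos fun j hj => mul_nonpos_of_nonpos_of_nonneg (hf.le j) (hθ.pairingIn_nonneg hj)
    lia

/-- The lowest root space is annihilated by the negative root spaces. -/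
theorem IsHighestRoot.lie_eq_zero (hθ : IsHighestRoot b θ) {χ : Weight ℂ H g}
    (hχ : weightHeight b χ < 0) {x y : g} (hy : y ∈ rootSpace H (χ : H → ℂ))
    (hx : x ∈ rootSpace H (-(θ.1 : H → ℂ))) : ⁅y, x⁆ = 0 := by
  have h1 := lie_mem_genWeightSpace_of_mem_genWeightSpace hy hx
  by_contra h0
  let ψ : Weight ℂ H g := ⟨(χ : H → ℂ) + -(θ.1 : H → ℂ), fun h2 => h0 (by simpa [h2] using h1)⟩
  have h2 := weightHeight_eq_sub b (ψ := ψ) (χ := χ) (φ := θ.1) (sub_eq_add_neg _ _).symm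
  have hpos := hθ.isPos
  rw [RootPairing.Base.isPos_iff, ← weightHeight_coe] at hpos
  have h3 : (-ψ).IsNonZero := fun h3 => by
    have h4 := (weightHeight_eq_zero_iff b (-ψ)).mpr h3
    rw [weightHeight_neg] at h4
    lia
  have h4 := hθ ⟨-ψ, by simpa using h3⟩
  rw [← weightHeight_coe, ← weightHeight_coe, weightHeight_neg] at h4
  lia

/-- The adjoint representation is generated by the lowest root space under the action of the positive
root spaces. -/
theorem IsHighestRoot.eq_top_of_rootSpace_le (hθ : IsHighestRoot b θ) {S : Submodule ℂ g}
    (h1 : ∀ x ∈ rootSpace H (-(θ.1 : H → ℂ)), x ∈ S)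
    (h2 : ∀ α : H.root, b.IsPos α → ∀ e ∈ rootSpace H (α.1 : H → ℂ), ∀ w ∈ S, ⁅e, w⁆ ∈ S) :
    S = ⊤ := by
  let p (T : Submodule ℂ g) : Prop := (∀ x ∈ rootSpace H (-(θ.1 : H → ℂ)), x ∈ T) ∧
    ∀ α : H.root, b.IsPos α → ∀ e ∈ rootSpace H (α.1 : H → ℂ), ∀ w ∈ T, ⁅e, w⁆ ∈ T
  let W : Submodule ℂ g := sInf {T | p T}
  have hW : p W := by
    refine ⟨fun x hx => ?_, fun α hα e he w hw => ?_⟩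
    · rw [Submodule.mem_sInf]
      exact fun T hT => hT.1 x hx
    · rw [Submodule.mem_sInf] at hw ⊢
      exact fun T hT => hT.2 α hα e he w (hw T hT)
  -- The part of the least such subspace `W` that `g` maps back into `W`. It has the defining
  -- properties of `W`, hence equals `W`, which is therefore an ideal, nonzero because it contains
  -- the lowest root space.
  let W₀ : Submodule ℂ g :=
    { carrier := {w | w ∈ W ∧ ∀ y : g, ⁅y, w⁆ ∈ W}
      zero_mem' := ⟨zero_mem _, fun y => by rw [lie_zero]; exact zero_mem _⟩
      add_mem' := fun {u w} hu hw => ⟨add_mem hu.1 hw.1, fun y => by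
        rw [lie_add]; exact add_mem (hu.2 y) (hw.2 y)⟩
      smul_mem' := fun c u hu => ⟨Submodule.smul_mem _ c hu.1, fun y => by
        rw [lie_smul]; exact Submodule.smul_mem _ c (hu.2 y)⟩ }
  have hW₀ : p W₀ := by
    refine ⟨fun x hx => ⟨hW.1 x hx, fun y => ?_⟩, fun α hα e he w hw =>
      ⟨hW.2 α hα e he w hw.1, fun y => ?_⟩⟩
    · have hy : y ∈ ⨆ χ : Weight ℂ H g, (rootSpace H (χ : H → ℂ)).toSubmodule := by
        rw [← LieSubmodule.iSup_toSubmodule, iSup_genWeightSpace_eq_top' ℂ H g]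
        trivial
      induction hy using Submodule.iSup_induction' with
      | mem χ y hy =>
        rcases lt_trichotomy (weightHeight b χ) 0 with h3 | h3 | h3
        · rw [hθ.lie_eq_zero h3 hy hx]
          exact zero_mem _
        · change y ∈ rootSpace H (χ : H → ℂ) at hy
          rw [((weightHeight_eq_zero_iff b χ).mp h3).eq, rootSpace_zero_eq] at hy
          refine (congrArg (· ∈ W) (IsKilling.lie_eq_smul_of_mem_rootSpace hx ⟨y, hy⟩)).mpr ?_
          exact Submodule.smul_mem _ _ (hW.1 x hx)
        · have h4 : χ.IsNonZero := fun h4 => h3.ne' ((weightHeight_eq_zero_iff b χ).mpr h4)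
          refine hW.2 ⟨χ, by simpa using h4⟩ ?_ y hy x (hW.1 x hx)
          rwa [RootPairing.Base.isPos_iff, ← weightHeight_coe]
      | zero => rw [zero_lie]; exact zero_mem _
      | add y z _ _ hy hz => rw [add_lie]; exact add_mem hy hz
    · rw [leibniz_lie]
      exact add_mem (hw.2 _) (hW.2 α hα e he _ (hw.2 y))
  have hle : W ≤ W₀ := sInf_le hW₀
  let I : LieIdeal ℂ g := { W with lie_mem := fun {y w} hw => (hle hw).2 y }
  have hI : I = ⊤ := by
    refine (IsSimple.eq_bot_or_eq_top I).resolve_left fun h3 => ?_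
    refine (-θ.1 : Weight ℂ H g).genWeightSpace_ne_bot' ((LieSubmodule.eq_bot_iff _).mpr fun x hx => ?_)
    have h4 : x ∈ I := hW.1 x hx
    rwa [h3, LieSubmodule.mem_bot] at h4
  refine top_le_iff.mp fun x _ => ?_
  have hx : x ∈ I := by rw [hI]; trivial
  exact (sInf_le (show p S from ⟨h1, h2⟩) : W ≤ S) hx

/-- A singular vector is annihilated by `t g[t]`. -/
theorem IsSingularVector.mode_eq_zero (hθ : IsHighestRoot b θ) {h k : ℂ} {v : UniversalAffine g h k}
    (hv : IsSingularVector b θ v) (n : ℕ) (hn : 1 ≤ n) (x : g) : mode x n v = 0 := by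
  have hker (n : ℤ) (x : g) : x ∈ LinearMap.ker ((modeₗ g h k n).flip v) ↔ mode x n v = 0 :=
    LinearMap.mem_ker
  have hlie (m n : ℤ) (hmn : m + n ≠ 0) (x y : g) (hx : mode x m v = 0) (hy : mode y n v = 0) :
      mode ⁅x, y⁆ (m + n) v = 0 := by
    have h1 := mode_commutator (k := k) x y m n v
    rw [hx, hy, map_zero, map_zero, sub_self, if_neg hmn, zero_smul, add_zero] at h1
    exact h1.symm
  -- The `x` with `x(1) v = 0` include the lowest root space and are stable under positive root
  -- vectors, since `e(0) v = 0`.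
  have hbase (x : g) : mode x 1 v = 0 := by
    have h1 := hθ.eq_top_of_rootSpace_le (S := LinearMap.ker ((modeₗ g h k 1).flip v))
      (fun x hx => (hker 1 x).mpr (hv.2 x hx)) fun α hα e he w hw => by
        rw [hker] at hw ⊢
        exact hlie 0 1 (by lia) e w (hv.1 α hα e he) hw
    exact (hker 1 x).mp (h1 ▸ Submodule.mem_top)
  induction n, hn using Nat.le_induction generalizing x with
  | base => exact hbase x
  | succ n hn ih =>
    obtain ⟨r, hr⟩ := exists_apply_eq_weightHeight b
    have h0 (x y : g) : mode ⁅x, y⁆ ((n + 1 : ℕ) : ℤ) v = 0 := by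
      have h3 := hlie n 1 (by lia) x y (ih x) (hbase y)
      exact_mod_cast h3
    have h1 := hθ.eq_top_of_rootSpace_le
      (S := LinearMap.ker ((modeₗ g h k ((n + 1 : ℕ) : ℤ)).flip v)) (fun x hx => ?_)
      fun α hα e he w hw => (hker _ _).mpr (h0 e w)
    · exact (hker _ x).mp (h1 ▸ Submodule.mem_top)
    -- Brackets are covered by `[x(n), y(1)] = [x, y](n + 1)`. A lowest root vector is one:
    -- bracketing with `r` multiplies it by minus the height of `θ`, which is nonzero.
    · rw [hker]
      have h2 := h0 (r : g) x
      have hpos := hθ.isPos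
      rw [RootPairing.Base.isPos_iff, ← weightHeight_coe] at hpos
      rw [show ⁅(r : g), x⁆ = _ from IsKilling.lie_eq_smul_of_mem_rootSpace hx r, mode_smul,
        Pi.neg_apply, hr] at h2
      exact (smul_eq_zero.mp h2).resolve_left (by simpa using hpos.ne')

end HighestRoot

end

end

/-- Every nonzero singular vector of `V^k(g)`, `k ≠ -h^∨`, has nonzero image in `R_{V^k(g)}`;
equivalently, its principal symbol for the Li filtration has depth zero. -/
theorem theorem1p2 {g : Type*} [LieRing g] [LieAlgebra ℂ g] [FiniteDimensional ℂ g]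
    [LieAlgebra.IsSimple ℂ g] (H : LieSubalgebra ℂ g) [H.IsCartanSubalgebra]
    (b : (LieAlgebra.IsKilling.rootSystem H).Base) (θ : H.root) (hθ : IsHighestRoot b θ)
    (k : ℂ) (hk : k ≠ -(dualCoxeterNumber b θ : ℂ))
    (v : UniversalAffine g (dualCoxeterNumber b θ : ℂ) k)
    (hv : IsSingularVector b θ v) (hv0 : v ≠ 0) :
    (Submodule.Quotient.mk v : ZhuAlgebra (UniversalAffine.stateField (g := g)
      (h := (dualCoxeterNumber b θ : ℂ)) (k := k))) ≠ 0 ∧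
    HasDepth UniversalAffine.stateField v 0 := by
  have hpos := hθ.dualCoxeterNumber_pos
  have hh : (dualCoxeterNumber b θ : ℂ) ≠ 0 := by exact_mod_cast hpos.ne'
  refine (rootWeightBasis hh b).mk_ne_zero_and_hasDepth hh (fun h => hk (eq_neg_of_add_eq_zero_left h))
    hv0 (hv.mode_eq_zero hθ) fun a ha => ?_
  change weightHeight b a.1 < 0 at ha
  have hne : (-a.1).IsNonZero := fun h0 => by
    have := (weightHeight_eq_zero_iff b (-a.1)).mpr h0
    rw [weightHeight_neg] at this
    lia
  -- The dual vector `y_a` has the weight opposite to `x_a`, so for negative height it is a positive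
  -- root vector.
  refine hv.1 ⟨-a.1, by simpa using hne⟩ ?_ _ (dualWeightVector_mem_rootSpace hh a)
  rw [RootPairing.Base.isPos_iff, ← weightHeight_coe, weightHeight_neg]
  lia
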